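/- Let $\omega=\omega(K)$ be the exponent of matrix multiplication over a field $K$ (any field; the result holds for each), i.e. the infimum of all $\tau$ such that $n\times n$ matrices over $K$ can be multiplied by bilinear algorithms with $O(n^\tau)$ multiplications. Algorithms are programs of a random access machine with integer registers and arrays, the operations $+,-,\times$ and integer division, indirect addressing and fair coin tosses; time is measured by the logarithmic cost criterion (every number read or computed is charged its length in bits). An instance consists of integers $n,k,M\ge 1$ and a directed or undirected graph $G$ on $n$ vertices with integer edge weights in $[-M,M]$. A *$k$-path* is a simple path on $k$ vertices, and its weight is the sum of its edge weights. **(1) Algorithms.** For every $c\in\mathbb N$ there are randomized algorithms $\mathcal A$ and $\mathcal P$, real constants $C,C'$ and natural numbers $a,b,b'$ such that, with $$T(n,k,M)=C\,2^k\,k^{a}\,M\,n^{\omega}\,\bigl(\log(n+M+1)\bigr)^{b}\;=\;\tilde O\bigl(2^k\,\mathrm{poly}(k)\,M\,n^\omega\bigr),$$ the following holds on every instance. * $\mathcal A$ always halts within time $T(n,k,M)$ and, with probability at least $1-n^{-c}$, outputs the minimum weight of a $k$-path of $G$, or reports that there is none if $G$ has no $k$-path. * $\mathcal P$ always halts within time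 $C'\,k\,(1+\log n)^{b'}\,T(n,k,M)$ and, with probability at least $1-n^{-c}$, outputs a $k$-path of $G$ of minimum weight (its vertices in order), or reports that there is none if $G$ has no $k$-path. **(2) The walk polynomial.** Let $\mathbb F$ be the field with $2^{\lceil\log_2 k\rceil+3}$ elements and let $\mathbb F[\mathbb Z_2^k]$ be the group algebra of $\mathbb Z_2^k$ (written multiplicatively, with identity $1$). For $y_{i,j,c}\in\mathbb F$ ($1\le c\le k-1$, $1\le i,j\le n$) and $v_1,\dots,v_n\in\mathbb Z_2^k$ put $x_i=1+v_i$, and let $B_c$ be the $n\times n$ matrix over $(\mathbb F[\mathbb Z_2^k])[z]$ with entry $y_{i,j,c}\,x_i\,z^{w(i,j)+M}$ if $(i,j)$ is an edge of weight $w(i,j)$, and $0$ otherwise. Let $P'(z)=\vec 1\cdot B_1\cdots B_{k-1}\cdot\vec x$. If $G$ has no $k$-path, then $P'=0$ for all choices of the $y_{i,j,c}$ and $v_i$. If $d$ is the minimum weight of a $k$-path of $G$, then $P'$ never has a nonzero coefficient in a degree less than $d+(k-1)M$, and for independent uniformly random $y_{i,j,c}$ and $v_i$, the lowest degree in which $P'$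 has a nonzero coefficient is exactly $d+(k-1)M$ with probability at least $1/5$. -/

import Mathlib

open scoped Matrix

noncomputable section

/-! ### Randomized random access machines with logarithmic cost

Programs are written in structured form.  They work on integer registers `reg i` and integer
arrays `arr a`, whose cells are addressed indirectly by computed addresses; a program mentions
only finitely many registers and arrays.  Every number that is read or computed is charged its
length in bits, and one instruction tosses a fair coin. -/

namespace RAM

/-- Length in bits of an integer, sign not counted. -/
def len (z : ℤ) : ℕ := Nat.size z.natAbs

/-- The memory: registers, arrays, and the number of coins tossed so far. -/
structure State where
  reg : ℕ → ℤ
  arr : ℕ → ℕ → ℤ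
  tossed : ℕ

/-- Integer expressions; `read a e` is the cell of array `a` with address `e`. -/
inductive Expr where
  | lit (z : ℤ)
  | reg (i : ℕ)
  | read (a : ℕ) (e : Expr)
  | add (e₁ e₂ : Expr)
  | sub (e₁ e₂ : Expr)
  | mul (e₁ e₂ : Expr)
  | div (e₁ e₂ : Expr)

/-- Value of an expression.  Negative addresses are read as `0`, and division is integer division
with `x / 0 = 0`. -/
def Expr.eval (s : State) : Expr → ℤ
  | .lit z => z
  | .reg i => s.reg i
  | .read a e => s.arr a (e.eval s).toNat
  | .add e₁ e₂ => e₁.eval s + e₂.eval s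
  | .sub e₁ e₂ => e₁.eval s - e₂.eval s
  | .mul e₁ e₂ => e₁.eval s * e₂.eval s
  | .div e₁ e₂ => e₁.eval s / e₂.eval s

/-- Cost of evaluating an expression: each of its subexpressions is charged `1` plus the length of
its value (thus every operand, every address and every result is charged). -/
def Expr.cost (s : State) : Expr → ℕ
  | .lit z => 1 + len z
  | .reg i => 1 + len (s.reg i)
  | .read a e => e.cost s + (1 + len ((Expr.read a e).eval s))
  | .add e₁ e₂ => e₁.cost s + e₂.cost s + (1 + len ((Expr.add e₁ e₂).eval s))
  | .sub e₁ e₂ => e₁.cost s + e₂.cost s + (1 + len ((Expr.sub e₁ e₂).eval s))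
  | .mul e₁ e₂ => e₁.cost s + e₂.cost s + (1 + len ((Expr.mul e₁ e₂).eval s))
  | .div e₁ e₂ => e₁.cost s + e₂.cost s + (1 + len ((Expr.div e₁ e₂).eval s))

/-- Programs.  `write a e₁ e₂` stores `e₂` in the cell of array `a` with address `e₁`; `toss i`
stores a random bit in register `i`; `branch` and `loop` test whether their expression is
positive. -/
inductive Cmd where
  | skip
  | assign (i : ℕ) (e : Expr)
  | write (a : ℕ) (e₁ e₂ : Expr)
  | toss (i : ℕ)
  | seq (p q : Cmd)
  | branch (e : Expr) (p q : Cmd)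
  | loop (e : Expr) (p : Cmd)

def State.setReg (s : State) (i : ℕ) (z : ℤ) : State :=
  { s with reg := Function.update s.reg i z }

def State.setArr (s : State) (a : ℕ) (m : ℕ) (z : ℤ) : State :=
  { s with arr := Function.update s.arr a (Function.update (s.arr a) m z) }

/-- `Exec coin p s s' t`: with the sequence of coin tosses `coin`, the program `p` started in `s`
halts in `s'` after time `t`. -/
inductive Exec (coin : ℕ → Bool) : Cmd → State → State → ℕ → Prop where
  | skip (s : State) : Exec coin .skip s s 1
  | assign (i : ℕ) (e : Expr) (s : State) :
      Exec coin (.assign i e) s (s.setReg i (e.eval s)) (e.cost s + 1)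
  | write (a : ℕ) (e₁ e₂ : Expr) (s : State) :
      Exec coin (.write a e₁ e₂) s (s.setArr a (e₁.eval s).toNat (e₂.eval s))
        (e₁.cost s + e₂.cost s + 1)
  | toss (i : ℕ) (s : State) :
      Exec coin (.toss i) s
        { s.setReg i (if coin s.tossed then 1 else 0) with tossed := s.tossed + 1 } 1
  | seq {p q : Cmd} {s s' s'' : State} {t t' : ℕ} :
      Exec coin p s s' t → Exec coin q s' s'' t' → Exec coin (.seq p q) s s'' (t + t')
  | branch_pos {e : Expr} {p q : Cmd} {s s' : State} {t : ℕ} :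
      0 < e.eval s → Exec coin p s s' t → Exec coin (.branch e p q) s s' (e.cost s + 1 + t)
  | branch_neg {e : Expr} {p q : Cmd} {s s' : State} {t : ℕ} :
      e.eval s ≤ 0 → Exec coin q s s' t → Exec coin (.branch e p q) s s' (e.cost s + 1 + t)
  | loop_neg {e : Expr} {p : Cmd} {s : State} :
      e.eval s ≤ 0 → Exec coin (.loop e p) s s (e.cost s + 1)
  | loop_pos {e : Expr} {p : Cmd} {s s' s'' : State} {t t' : ℕ} :
      0 < e.eval s → Exec coin p s s' t → Exec coin (.loop e p) s' s'' t' →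
        Exec coin (.loop e p) s s'' (e.cost s + 1 + t + t')

/-- The law of an infinite sequence of independent fair coin tosses. -/
def coinLaw : MeasureTheory.Measure (ℕ → Bool) :=
  MeasureTheory.Measure.infinitePi fun _ => (PMF.uniformOfFintype Bool).toMeasure

/-- Started in `s`, the program `p` halts within time `T` for every outcome of the coin tosses, and
the probability that its final state does not satisfy `Good` is at most `δ`. -/
def Solves (p : Cmd) (s : State) (T δ : ℝ) (Good : State → Prop) : Prop :=
  (∀ coin : ℕ → Bool, ∃ s' t, Exec coin p s s' t ∧ (t : ℝ) ≤ T) ∧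
    coinLaw.real {coin | ∃ s' t, Exec coin p s s' t ∧ ¬ Good s'} ≤ δ

end RAM

/-! ### Weighted graphs and minimum-weight `k`-paths -/

/-- A directed graph on `n` vertices with integer edge weights.  Undirected graphs are those with
symmetric adjacency and symmetric weights.  The value of `wt` at a non-edge is irrelevant. -/
structure WeightedDigraph (n : ℕ) extends Digraph (Fin n) where
  wt : Fin n → Fin n → ℤ

namespace WeightedDigraph

variable {n : ℕ}

/-- All edge weights lie in `[-M, M]`. -/
def WeightsIn (G : WeightedDigraph n) (M : ℕ) : Prop :=
  ∀ i j, G.Adj i j → -(M : ℤ) ≤ G.wt i j ∧ G.wt i j ≤ M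

/-- `l` lists, in order, the vertices of a simple path on `k` vertices. -/
def IsKPath (G : WeightedDigraph n) (k : ℕ) (l : List (Fin n)) : Prop :=
  l.length = k ∧ l.Nodup ∧ l.IsChain G.Adj

/-- The sum of the weights of the edges between consecutive vertices of `l`. -/
def pathWeight (G : WeightedDigraph n) (l : List (Fin n)) : ℤ :=
  (List.zipWith G.wt l l.tail).sum

/-- `d` is the minimum weight of a simple path on `k` vertices (in particular there is one). -/
def IsMinWeight (G : WeightedDigraph n) (k : ℕ) (d : ℤ) : Prop :=
  IsLeast {z | ∃ l, G.IsKPath k l ∧ G.pathWeight l = z} d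

open Classical in
/-- The initial memory: registers `0`, `1`, `2` hold `n`, `k`, `M`; for vertices `i`, `j`, cell
`i * n + j` of array `0` tells whether `(i, j)` is an edge, and the same cell of array `1` holds
its weight.  All other registers and cells are `0`. -/
def input (G : WeightedDigraph n) (k M : ℕ) : RAM.State where
  reg r := if r = 0 then n else if r = 1 then k else if r = 2 then M else 0
  arr a m :=
    if h : m < n * n then
      let i : Fin n := ⟨m / n, Nat.div_lt_of_lt_mul h⟩
      let j : Fin n := ⟨m % n, Nat.mod_lt m (Nat.pos_of_ne_zero (by rintro rfl; simp at h))⟩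
      if G.Adj i j then (if a = 0 then 1 else if a = 1 then G.wt i j else 0) else 0
    else 0
  tossed := 0

/-- Correct output for the weight problem: register `0` tells whether there is a simple path on
`k` vertices, and if so, register `1` is the minimum weight of such a path. -/
def WeightAnswer (G : WeightedDigraph n) (k : ℕ) (s : RAM.State) : Prop :=
  (s.reg 0 = 1 ∧ G.IsMinWeight k (s.reg 1)) ∨ (s.reg 0 = 0 ∧ ¬ ∃ l, G.IsKPath k l)

/-- Correct output for the path problem: register `0` tells whether there is a simple path on `k`
vertices, and if so, the first `k` cells of array `0` are the successive vertices of such a path of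
minimum weight. -/
def PathAnswer (G : WeightedDigraph n) (k : ℕ) (s : RAM.State) : Prop :=
  (s.reg 0 = 1 ∧ ∃ l, G.IsKPath k l ∧ G.IsMinWeight k (G.pathWeight l) ∧
      ∀ i (h : i < l.length), s.arr 0 i = ((l[i] : Fin n) : ℕ)) ∨
    (s.reg 0 = 0 ∧ ¬ ∃ l, G.IsKPath k l)

end WeightedDigraph

/-! ### The exponent of matrix multiplication -/

/-- Over `K`, two `n × n` matrices can be multiplied by a bilinear algorithm with `r`
multiplications; equivalently, the `n × n` matrix multiplication tensor has rank at most `r`. -/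
def HasBilinearMatMul (K : Type*) [Field K] (n r : ℕ) : Prop :=
  ∃ (α β : Fin r → (Matrix (Fin n) (Fin n) K →ₗ[K] K)) (γ : Fin r → Matrix (Fin n) (Fin n) K),
    ∀ A B : Matrix (Fin n) (Fin n) K, A * B = ∑ t, (α t A * β t B) • γ t

/-- The exponent `ω` of matrix multiplication over the field `K`. -/
def matMulExponent (K : Type*) [Field K] : ℝ :=
  sInf {τ : ℝ | ∃ C : ℝ, ∀ n : ℕ, 1 ≤ n →
    ∃ r : ℕ, (r : ℝ) ≤ C * (n : ℝ) ^ τ ∧ HasBilinearMatMul K n r}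

/-! ### The walk polynomial over the group algebra of `ℤ₂ᵏ` -/

/-- The field with `2 ^ (⌈log₂ k⌉ + 3)` elements. -/
abbrev WalkField (k : ℕ) : Type := GaloisField 2 (Nat.clog 2 k + 3)

/-- The group algebra over `WalkField k` of the group `ℤ₂ᵏ`, written multiplicatively. -/
abbrev WalkAlgebra (k : ℕ) : Type :=
  MonoidAlgebra (WalkField k) (Multiplicative (Fin k → ZMod 2))

/-- The random choices: a scalar `y c i j` for each position `c` in a walk and each pair of
vertices, and a vector `v i` of `ℤ₂ᵏ` for each vertex. -/
abbrev WalkChoice (n k : ℕ) : Type :=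
  (Fin (k - 1) → Fin n → Fin n → WalkField k) × (Fin n → Fin k → ZMod 2)

namespace WeightedDigraph

variable {n : ℕ}

/-- The element `1 + v i` of the group algebra. -/
def vertexValue {k : ℕ} (v : Fin n → Fin k → ZMod 2) (i : Fin n) : WalkAlgebra k :=
  1 + MonoidAlgebra.of (WalkField k) _ (Multiplicative.ofAdd (v i))

open Classical in
/-- The matrix with entries `y i j * x i * z ^ (w (i, j) + M)` at the edges and `0` elsewhere. -/
def walkMatrix (G : WeightedDigraph n) {k : ℕ} (M : ℕ) (y : Fin n → Fin n → WalkField k)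
    (x : Fin n → WalkAlgebra k) : Matrix (Fin n) (Fin n) (Polynomial (WalkAlgebra k)) :=
  fun i j =>
    if G.Adj i j then Polynomial.C (y i j • x i) * Polynomial.X ^ (G.wt i j + M).toNat else 0

/-- The walk polynomial `1 ⬝ B₁ ⋯ Bₖ₋₁ ⬝ x` in `z`, evaluated at `x i = 1 + v i`. -/
def walkPoly (G : WeightedDigraph n) {k : ℕ} (M : ℕ) (c : WalkChoice n k) :
    Polynomial (WalkAlgebra k) :=
  (fun _ => 1) ⬝ᵥ
    ((List.ofFn fun p => G.walkMatrix M (c.1 p) (vertexValue c.2)).prod *ᵥ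
      fun i => Polynomial.C (vertexValue c.2 i))

end WeightedDigraph

end

/-!
The exponent of matrix multiplication is at least `2`, because the matrices `γ t` of a bilinear
algorithm span the space of all `n × n` matrices (`two_le_matMulExponent`).  The time granted
therefore contains the factor `n ^ 2`, and dynamic programming over walks, which treats each pair
of vertices once for every length, degree and subset of `k` coordinates, meets it without any fast
matrix multiplication.  One program, `RAM.solveProg`, serves both problems.

The program computes sums over walks with values in the exterior algebra of `ℤᵏ`, in coordinates
that are indexed by bit masks (`KPath.table`).  A walk contributes the exterior product of the
vectors `(1, v, v², …)` of its vertices `v`, times random integer scalars, one for each position and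
vertex.  A walk with a repeated vertex contributes `0`, and a simple walk on `k` vertices contributes
a nonzero Vandermonde determinant times its scalars (`KPath.suffixForm_zero_ne_zero_iff`).  The sums
are graded by the weight.  Revealing the scalars position by position along a minimum-weight path,
each of them enters linearly and spoils the entry of that path for at most one value; with `t`-bit
scalars the entry is nonzero with probability at least `1 - k / 2 ^ t`
(`KPath.card_table_eq_zero_le`), and `t` is chosen with `k * n ^ c < 2 ^ t`.  Conversely, from a
nonzero entry a simple path of the recorded weight can be traced back, each step choosing a
predecessor whose term is nonzero (`KPath.Trace`).  Hence no weight found is too small, a path is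
found only if there is one, and the only error is that the entry of a minimum path vanishes.

The program is verified in a small program logic.  `RAM.Runs` bounds the number of unit steps and
keeps all numbers below a bound `B`, so that the logarithmic time is at most the number of steps
times `RAM.unitCost B`, where `B` has `O(k² log (n + M))` bits.  The law of the coin tosses enters
through `RAM.coinLaw_real_coinBits_le`.

For the walk polynomial, `(1 + v)² = 0` in characteristic two, so that every nonzero coefficient
comes from a simple path of the corresponding weight
(`KPath.exists_isKPath_of_coeff_walkPoly_ne_zero`).  If the vectors along a minimum-weight path are
linearly independent, which has probability at least `1 / 4`, then the product of its elements
`1 + v` has coefficient `1` at the identity; the scalars, from a field with at least `8 * k`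
elements, then make the coefficient of its degree vanish with probability at most `1 / 8`, and
`1 / 4 * 7 / 8 ≥ 1 / 5`.  For `k = 1` there are no scalars, and the coefficient at the identity is the parity
of the number of nonzero vectors (`KPath.fifth_le_card_walkChoice`).
-/
/-! ### Counting zeros of multilinear forms in random scalars -/

namespace KPath

/-- A form `∑ i ∈ J, y i * a i` that is linear in a group `J` of random scalars, with coefficients
that do not depend on them, vanishes for at most one value of `y i₀` whenever `a i₀ ≠ 0`. -/
theorem card_linear_form_eq_zero_le {ι κ R : Type*} [Finite ι] [Finite κ] [DecidableEq ι]
    [CommRing R] [IsDomain R] {val : κ → R} (hval : Function.Injective val) (J : Finset ι)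
    (a : ι → (ι → κ) → R) {i₀ : ι} (hi₀ : i₀ ∈ J)
    (ha : ∀ i ∈ J, ∀ y b, a i (Function.update y i₀ b) = a i y) :
    Nat.card {y : ι → κ // ∑ i ∈ J, val (y i) * a i y = 0} * Nat.card κ ≤
      Nat.card {y : ι → κ // a i₀ y = 0} * Nat.card κ + Nat.card (ι → κ) := by
  classical
  let E := {y : ι → κ // ∑ i ∈ J, val (y i) * a i y = 0 ∧ a i₀ y ≠ 0}
  have h1 : Nat.card {y : ι → κ // ∑ i ∈ J, val (y i) * a i y = 0} ≤
      Nat.card {y : ι → κ // a i₀ y = 0} + Nat.card E := by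
    rw [← Nat.card_sum]
    refine Nat.card_le_card_of_injective
      (fun y => if h : a i₀ y.1 = 0 then Sum.inl ⟨y.1, h⟩ else Sum.inr ⟨y.1, y.2, h⟩) ?_
    intro y y' h
    apply Subtype.ext
    by_cases h₁ : a i₀ y.1 = 0 <;> by_cases h₂ : a i₀ y'.1 = 0 <;> simp [h₁, h₂] at h
    · exact h
    · exact (Subtype.ext_iff.1 h :)
  have h2 : Nat.card E * Nat.card κ ≤ Nat.card (ι → κ) := by
    rw [← Nat.card_prod]
    refine Nat.card_le_card_of_injective (fun p => Function.update p.1.1 i₀ p.2) ?_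
    rintro ⟨⟨y, hy, hay⟩, b⟩ ⟨⟨y', hy', hay'⟩, b'⟩ h
    simp only at h
    have hb : b = b' := by simpa using congrFun h i₀
    have hoff : ∀ i, i ≠ i₀ → y i = y' i := fun i hi => by simpa [hi] using congrFun h i
    have hcoef : ∀ i ∈ J, a i y = a i y' := fun i hi => by
      rw [← ha i hi y b, h, ha i hi y' b']
    have hrest : ∑ i ∈ J.erase i₀, val (y i) * a i y = ∑ i ∈ J.erase i₀, val (y' i) * a i y' :=
      Finset.sum_congr rfl fun i hi => by
        rw [hoff i (Finset.ne_of_mem_erase hi), hcoef i (Finset.mem_of_mem_erase hi)]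
    rw [← Finset.add_sum_erase _ _ hi₀] at hy hy'
    rw [hrest, hcoef i₀ hi₀] at hy
    have hv : val (y i₀) = val (y' i₀) :=
      mul_right_cancel₀ hay' (add_right_cancel (hy.trans hy'.symm))
    have : y = y' := by
      funext i
      by_cases hi : i = i₀
      · rw [hi]; exact hval hv
      · exact hoff i hi
    subst this
    rw [hb]
  calc _ ≤ (Nat.card {y : ι → κ // a i₀ y = 0} + Nat.card E) * Nat.card κ :=
        Nat.mul_le_mul_right _ h1
    _ ≤ _ := by rw [add_mul]; omega

/-! ### Walk vectors over a commutative algebra -/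

section WalkVec

open Polynomial

variable {F A : Type*} [Field F] [CommRing A] [Algebra F A] {n : ℕ}

open Classical in
/-- The row vector `1 ⬝ B₀ ⋯ B_{c-1}` of the walk polynomial over an arbitrary algebra. -/
noncomputable def walkVec (G : WeightedDigraph n) (M : ℕ) (x : Fin n → A)
    (y : ℕ → Fin n → Fin n → F) : ℕ → Fin n → A[X]
  | 0, _ => 1
  | c + 1, j => ∑ i, walkVec G M x y c i *
      if G.Adj i j then C (y c i j • x i) * X ^ (G.wt i j + M).toNat else 0

variable (G : WeightedDigraph n) (M : ℕ) (x : Fin n → A)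

open Classical in
theorem coeff_walkVec_succ (y : ℕ → Fin n → Fin n → F) (c e : ℕ) (j : Fin n) :
    (walkVec G M x y (c + 1) j).coeff e = ∑ i, y c i j •
      if G.Adj i j ∧ (G.wt i j + M).toNat ≤ e then
        (walkVec G M x y c i).coeff (e - (G.wt i j + M).toNat) * x i else 0 := by
  rw [walkVec, Polynomial.finsetSum_coeff]
  refine Finset.sum_congr rfl fun i _ => ?_
  by_cases h : G.Adj i j
  · rw [if_pos h, ← mul_assoc, coeff_mul_X_pow']
    by_cases h' : (G.wt i j + M).toNat ≤ e
    · simp [h, h']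
    · simp [h, h']
  · simp [h]

theorem walkVec_congr {y y' : ℕ → Fin n → Fin n → F} {c : ℕ} (h : ∀ p < c, y p = y' p) :
    walkVec G M x y c = walkVec G M x y' c := by
  induction c with
  | zero => rfl
  | succ c ih =>
    funext j
    rw [walkVec, walkVec, ih fun p hp => h p (by omega), h c (by omega)]

theorem _root_.WeightedDigraph.pathWeight_cons_cons (i j : Fin n) (l : List (Fin n)) :
    G.pathWeight (i :: j :: l) = G.wt i j + G.pathWeight (j :: l) := by
  simp [WeightedDigraph.pathWeight]

/-- A nonzero coefficient of the walk vector, multiplied by the values along a walk `j :: s`,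
comes from a walk ending in `j :: s` on which the product of the values is nonzero. -/
theorem exists_walk_of_coeff_ne_zero (hw : G.WeightsIn M) (y : ℕ → Fin n → Fin n → F) (c : ℕ) :
    ∀ (j : Fin n) (s : List (Fin n)) (e : ℕ), (j :: s).IsChain G.Adj →
      (walkVec G M x y c j).coeff e * ((j :: s).map x).prod ≠ 0 →
      ∃ l : List (Fin n), l.length = c + (s.length + 1) ∧ l.IsChain G.Adj ∧
        (l.map x).prod ≠ 0 ∧ G.pathWeight l + c * M = e + G.pathWeight (j :: s) := by
  induction c with
  | zero =>
    intro j s e hs h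
    have he : e = 0 := by
      by_contra he
      simp [walkVec, coeff_one, he] at h
    refine ⟨j :: s, by simp, hs, right_ne_zero_of_mul h, by simp [he]⟩
  | succ c ih =>
    intro j s e hs h
    classical
    rw [coeff_walkVec_succ, Finset.sum_mul] at h
    obtain ⟨i, -, hi⟩ := Finset.exists_ne_zero_of_sum_ne_zero h
    by_cases hc : G.Adj i j ∧ (G.wt i j + M).toNat ≤ e
    · rw [if_pos hc, smul_mul_assoc] at hi
      have hi' := right_ne_zero_of_smul hi
      obtain ⟨l, hl, hlc, hlx, hlw⟩ := ih i (j :: s) (e - (G.wt i j + M).toNat)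
        (List.isChain_cons_cons.2 ⟨hc.1, hs⟩) (by simpa [mul_assoc] using hi')
      refine ⟨l, by rw [hl, List.length_cons]; omega, hlc, hlx, ?_⟩
      rw [WeightedDigraph.pathWeight_cons_cons] at hlw
      have := (hw i j hc.1).1
      have h2 := hc.2
      push_cast [h2] at hlw ⊢
      rw [Int.toNat_of_nonneg (by omega)] at hlw
      linarith
    · rw [if_neg hc] at hi
      simp at hi

theorem nodup_of_prod_ne_zero {x : Fin n → A} (hx : ∀ i, x i * x i = 0) {l : List (Fin n)}
    (h : (l.map x).prod ≠ 0) : l.Nodup := by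
  induction l with
  | nil => simp
  | cons i l ih =>
    rw [List.map_cons, List.prod_cons] at h
    refine List.nodup_cons.2 ⟨fun hi => h ?_, ih (right_ne_zero_of_mul h)⟩
    obtain ⟨u, hu⟩ := List.dvd_prod (List.mem_map_of_mem (f := x) hi)
    rw [hu, ← mul_assoc, hx, zero_mul]

/-- Scalars indexed by a position `p < m` and two vertices, extended by zero to all positions. -/
def extendScalars {m : ℕ} (Y : Fin m × Fin n × Fin n → F) (p : ℕ) (i j : Fin n) : F :=
  if h : p < m then Y (⟨p, h⟩, i, j) else 0

variable [Finite F]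

/-- In a linear functional of the walk vector at position `c + 1`, the scalar of the edge `(i₀, j₀)` is
multiplied by the value at `i₀` one position earlier; conditioned on that value being nonzero, the
functional vanishes for at most one choice of the scalar. -/
theorem card_walkVec_step {m c : ℕ} (hc : c < m) (L : Fin n → A →ₗ[F] F) (e : ℕ) {i₀ j₀ : Fin n}
    (hadj : G.Adj i₀ j₀) (he : (G.wt i₀ j₀ + M).toNat ≤ e) :
    Nat.card {Y : Fin m × Fin n × Fin n → F //
        ∑ j, L j ((walkVec G M x (extendScalars Y) (c + 1) j).coeff e) = 0} * Nat.card F ≤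
      Nat.card {Y : Fin m × Fin n × Fin n → F //
        L j₀ ((walkVec G M x (extendScalars Y) c i₀).coeff (e - (G.wt i₀ j₀ + M).toNat) * x i₀) =
          0} * Nat.card F + Nat.card (Fin m × Fin n × Fin n → F) := by
  classical
  let a : Fin m × Fin n × Fin n → (Fin m × Fin n × Fin n → F) → F := fun q Y =>
    L q.2.2 (if G.Adj q.2.1 q.2.2 ∧ (G.wt q.2.1 q.2.2 + M).toNat ≤ e then
        (walkVec G M x (extendScalars Y) c q.2.1).coeff (e - (G.wt q.2.1 q.2.2 + M).toNat) *
          x q.2.1 else 0)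
  let J : Finset (Fin m × Fin n × Fin n) := {q | q.1 = ⟨c, hc⟩}
  have key := card_linear_form_eq_zero_le (val := (id : F → F)) Function.injective_id J a
    (i₀ := (⟨c, hc⟩, i₀, j₀)) (by simp [J]) (by
      intro q _ Y b
      simp only [a]
      rw [walkVec_congr G M x (y' := extendScalars Y)]
      intro p hp
      funext i j
      unfold extendScalars
      split_ifs with h
      · rw [Function.update_of_ne]
        simp only [ne_eq, Prod.mk.injEq, Fin.mk.injEq, not_and]
        omega
      · rfl)
  have hsum : ∀ Y : Fin m × Fin n × Fin n → F,
      ∑ j, L j ((walkVec G M x (extendScalars Y) (c + 1) j).coeff e) =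
        ∑ q ∈ J, id (Y q) * a q Y := by
    intro Y
    have hJ : J = {(⟨c, hc⟩ : Fin m)} ×ˢ Finset.univ := by
      ext ⟨p, i, j⟩
      simp only [J, Finset.mem_filter, Finset.mem_univ, true_and, Finset.mem_product,
        Finset.mem_singleton, and_true]
    rw [hJ, Finset.sum_product, Finset.sum_singleton, ← Finset.univ_product_univ,
      Finset.sum_product_right]
    refine Finset.sum_congr rfl fun j _ => ?_
    rw [coeff_walkVec_succ, map_sum]
    refine Finset.sum_congr rfl fun i _ => ?_
    rw [map_smul, smul_eq_mul]
    simp [extendScalars, hc, a]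
  simp only [hsum]
  refine key.trans (le_of_eq ?_)
  simp only [a, if_pos (And.intro hadj he)]

/-- The exponent reached after `c` steps along `π`. -/
def stepDegree (π : ℕ → Fin n) (c : ℕ) : ℕ :=
  ∑ p ∈ Finset.range c, (G.wt (π p) (π (p + 1)) + M).toNat

open Classical in
/-- Replacing the last part of a walk by the prescribed walk `π`, one scalar at a time: with the
first `c` scalars random, the contribution at the degree of `π` vanishes with probability at most
`c / |F|`. -/
theorem card_walkVec_eq_zero_le {m k : ℕ} (φ : A →ₗ[F] F) (π : ℕ → Fin n)
    (hadj : ∀ p < m, G.Adj (π p) (π (p + 1)))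
    (h0 : φ (∏ p ∈ Finset.Ico 0 k, x (π p)) ≠ 0) (c : ℕ) (hc : c ≤ m) (hck : c < k) :
    Nat.card {Y : Fin m × Fin n × Fin n → F //
        φ ((walkVec G M x (extendScalars Y) c (π c)).coeff (stepDegree G M π c) *
          ∏ p ∈ Finset.Ico c k, x (π p)) = 0} * Nat.card F ≤
      c * Nat.card (Fin m × Fin n × Fin n → F) := by
  induction c with
  | zero =>
    rw [zero_mul, Nat.card_eq_zero.2 (Or.inl ⟨fun Y => h0 ?_⟩), zero_mul]
    simpa [walkVec, stepDegree] using Y.2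
  | succ c ih =>
    have h1 := card_walkVec_step G M x (show c < m by omega)
      (fun j => if j = π (c + 1) then
        φ ∘ₗ LinearMap.mulRight F (∏ p ∈ Finset.Ico (c + 1) k, x (π p)) else 0)
      (stepDegree G M π (c + 1)) (hadj c (by omega))
      (by simp [stepDegree, Finset.sum_range_succ])
    have h2 : stepDegree G M π (c + 1) - (G.wt (π c) (π (c + 1)) + M).toNat =
        stepDegree G M π c := by simp [stepDegree, Finset.sum_range_succ]
    have h3 : ∀ Y : Fin m × Fin n × Fin n → F, ∑ j, (if j = π (c + 1) then
        φ ∘ₗ LinearMap.mulRight F (∏ p ∈ Finset.Ico (c + 1) k, x (π p)) else 0)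
          ((walkVec G M x (extendScalars Y) (c + 1) j).coeff (stepDegree G M π (c + 1))) =
        φ ((walkVec G M x (extendScalars Y) (c + 1) (π (c + 1))).coeff (stepDegree G M π (c + 1)) *
          ∏ p ∈ Finset.Ico (c + 1) k, x (π p)) := by
      intro Y
      rw [Finset.sum_eq_single (π (c + 1)) (fun j _ hj => by simp [hj]) (by simp)]
      simp
    have h4 := ih (by omega) (by omega)
    simp only [h3, h2, if_true, LinearMap.comp_apply, LinearMap.mulRight_apply, mul_assoc] at h1
    rw [Finset.prod_eq_prod_Ico_succ_bot (show c < k by omega)] at h4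
    rw [add_mul]
    omega

end WalkVec

end KPath

/-! ### The walk polynomial -/

namespace KPath

open Polynomial

section WalkPoly

variable {n k : ℕ}

theorem sum_row_prod_eq_walkVec {F A : Type*} [Field F] [CommRing A] [Algebra F A]
    (G : WeightedDigraph n) (M : ℕ) (x : Fin n → A) (y : ℕ → Fin n → Fin n → F) (m : ℕ)
    (B : ℕ → Matrix (Fin n) (Fin n) A[X])
    (hB : ∀ p < m, ∀ j, walkVec G M x y (p + 1) j = ∑ i, walkVec G M x y p i * B p i j) :
    (fun _ => (1 : A[X])) ᵥ* (List.ofFn fun p : Fin m => B p).prod = walkVec G M x y m := by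
  induction m with
  | zero => simp only [List.ofFn_zero, List.prod_nil, Matrix.vecMul_one]; rfl
  | succ m ih =>
    rw [List.ofFn_succ_last, List.prod_append, List.prod_singleton, ← Matrix.vecMul_vecMul]
    simp only [Fin.val_castSucc, Fin.val_last]
    rw [ih fun p hp => hB p (by omega)]
    funext j
    rw [hB m (by omega)]
    rfl

/-- The random scalars of a choice, as a function of one variable. -/
def uncurryScalars {F : Type*} {m : ℕ} :
    (Fin m → Fin n → Fin n → F) ≃ (Fin m × Fin n × Fin n → F) where
  toFun Y q := Y q.1 q.2.1 q.2.2
  invFun Y p i j := Y (p, i, j)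
  left_inv _ := rfl
  right_inv _ := rfl

theorem walkPoly_eq (G : WeightedDigraph n) (M : ℕ) (c : WalkChoice n k) :
    G.walkPoly M c = ∑ j, walkVec G M (WeightedDigraph.vertexValue c.2)
      (extendScalars (uncurryScalars c.1)) (k - 1) j *
        C (WeightedDigraph.vertexValue c.2 j) := by
  classical
  rw [WeightedDigraph.walkPoly, Matrix.dotProduct_mulVec]
  have h := sum_row_prod_eq_walkVec G M (WeightedDigraph.vertexValue c.2)
    (extendScalars (uncurryScalars c.1)) (k - 1)
    (fun p => G.walkMatrix M (extendScalars (uncurryScalars c.1) p)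
      (WeightedDigraph.vertexValue c.2)) (fun p _ j => rfl)
  have h2 : (List.ofFn fun p : Fin (k - 1) => G.walkMatrix M (extendScalars (uncurryScalars c.1) p)
      (WeightedDigraph.vertexValue c.2)) =
      List.ofFn fun p => G.walkMatrix M (c.1 p) (WeightedDigraph.vertexValue c.2) := by
    congr 1
    funext p
    congr 1
    funext i j
    simp [extendScalars, uncurryScalars]
  rw [← h2, h]
  rfl

theorem vertexValue_mul_self (v : Fin n → Fin k → ZMod 2) (i : Fin n) :
    WeightedDigraph.vertexValue v i * WeightedDigraph.vertexValue v i = 0 := by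
  have h2 : (2 : WalkAlgebra k) = 0 := by
    have : (2 : WalkField k) = 0 := CharTwo.two_eq_zero
    have h := congrArg (algebraMap (WalkField k) (WalkAlgebra k)) this
    rwa [map_ofNat, map_zero] at h
  have h1 : MonoidAlgebra.of (WalkField k) _ (Multiplicative.ofAdd (v i)) *
      MonoidAlgebra.of (WalkField k) _ (Multiplicative.ofAdd (v i)) = 1 := by
    have h0 : v i + v i = 0 := funext fun _ => CharTwo.add_self_eq_zero _
    rw [← map_mul, ← ofAdd_add, h0, ofAdd_zero, map_one]
  rw [WeightedDigraph.vertexValue]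
  linear_combination h1 + (1 + MonoidAlgebra.of (WalkField k) _ (Multiplicative.ofAdd (v i))) * h2

/-- A nonzero coefficient of the walk polynomial exhibits a simple path of the corresponding
weight. -/
theorem exists_isKPath_of_coeff_walkPoly_ne_zero {G : WeightedDigraph n} {M : ℕ} (hk : 1 ≤ k)
    (hw : G.WeightsIn M) (c : WalkChoice n k) {e : ℕ} (h : (G.walkPoly M c).coeff e ≠ 0) :
    ∃ l, G.IsKPath k l ∧ G.pathWeight l + ((k : ℤ) - 1) * M = e := by
  rw [walkPoly_eq, Polynomial.finsetSum_coeff] at h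
  obtain ⟨j, -, hj⟩ := Finset.exists_ne_zero_of_sum_ne_zero h
  rw [coeff_mul_C, ← List.prod_singleton (x := WeightedDigraph.vertexValue c.2 j),
    ← List.map_singleton (f := WeightedDigraph.vertexValue c.2)] at hj
  obtain ⟨l, hl, hlc, hlx, hlw⟩ := exists_walk_of_coeff_ne_zero G M _ hw _ (k - 1) j [] e
    (List.isChain_singleton j) hj
  refine ⟨l, ⟨by rw [hl, List.length_nil]; omega,
    nodup_of_prod_ne_zero (vertexValue_mul_self c.2) hlx, hlc⟩, ?_⟩
  rw [Nat.cast_sub hk] at hlw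
  simpa [WeightedDigraph.pathWeight] using hlw

/-- The coefficient of the identity in the group algebra. -/
noncomputable def coeffOne (k : ℕ) : WalkAlgebra k →ₗ[WalkField k] WalkField k where
  toFun f := f.coeff 1
  map_add' _ _ := rfl
  map_smul' _ _ := rfl

theorem coeffOne_of (u : Fin k → ZMod 2) :
    coeffOne k (MonoidAlgebra.of (WalkField k) _ (Multiplicative.ofAdd u)) =
      if u = 0 then 1 else 0 := by
  show (MonoidAlgebra.single (Multiplicative.ofAdd u) (1 : WalkField k)).coeff 1 = _
  rw [MonoidAlgebra.coeff_single, Finsupp.single_apply]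
  congr 1

theorem coeffOne_one : coeffOne k 1 = 1 := by
  have h := coeffOne_of (0 : Fin k → ZMod 2)
  rwa [if_pos rfl, ofAdd_zero, map_one] at h

/-- For independent vectors the only subset with sum zero is the empty one. -/
theorem coeffOne_prod_of_linearIndependent {w : Fin k → Fin k → ZMod 2}
    (hw : LinearIndependent (ZMod 2) w) :
    coeffOne k (∏ c, (1 + MonoidAlgebra.of (WalkField k) _ (Multiplicative.ofAdd (w c)))) = 1 := by
  rw [Finset.prod_one_add, map_sum, Finset.sum_eq_single ∅]
  · simpa using coeffOne_one
  · intro t _ ht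
    rw [← map_prod, ← ofAdd_sum, coeffOne_of, if_neg]
    intro h0
    obtain ⟨i, hi⟩ := Finset.nonempty_iff_ne_empty.2 ht
    have := linearIndependent_iff'.1 hw t (fun _ => 1) (by simpa using h0) i hi
    exact one_ne_zero this
  · simp

/-- A random square matrix over `𝔽₂` is invertible with probability `∏ i ∈ {1, …, k}, (1 - 2⁻ⁱ)`, which
is at least `1 / 4`; the induction keeps the sharper bound `1 / 4 + 2⁻ᵏ⁻¹`. -/
theorem quarter_le_card_linearIndependent (k : ℕ) :
    (1 / 4 : ℝ) * (2 ^ k) ^ k ≤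
      Nat.card {w : Fin k → Fin k → ZMod 2 // LinearIndependent (ZMod 2) w} := by
  have hprod : ∀ k : ℕ, 1 ≤ k → (1 / 4 + (1 / 2) ^ (k + 1) : ℝ) * (2 ^ k) ^ k ≤
      ∏ i : Fin k, ((2 : ℝ) ^ k - 2 ^ (i : ℕ)) := by
    intro k hk
    induction k, hk using Nat.le_induction with
    | base => norm_num
    | succ k hk ih =>
      have h1 : ∏ i : Fin (k + 1), ((2 : ℝ) ^ (k + 1) - 2 ^ (i : ℕ)) =
          (2 ^ (k + 1) - 1) * (2 ^ k * ∏ i : Fin k, ((2 : ℝ) ^ k - 2 ^ (i : ℕ))) := by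
        rw [Fin.prod_univ_succ]
        have : ∀ i : Fin k, ((2 : ℝ) ^ (k + 1) - 2 ^ ((i.succ : Fin (k + 1)) : ℕ)) =
            2 * ((2 : ℝ) ^ k - 2 ^ (i : ℕ)) := by
          intro i
          rw [Fin.val_succ]
          ring
        simp only [this, Finset.prod_mul_distrib, Finset.prod_const, Finset.card_univ,
          Fintype.card_fin]
        simp
      rw [h1]
      set a : ℝ := (1 / 2) ^ (k + 1) with ha
      have ha2 : (2 : ℝ) ^ (k + 1) * a = 1 := by rw [ha, ← mul_pow]; norm_num
      have ha0 : 0 < a := by positivity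
      have ha4 : a ≤ 1 / 4 := by
        have : a ≤ (1 / 2) ^ (1 + 1) := pow_le_pow_of_le_one (by norm_num) (by norm_num) (by omega)
        norm_num at this ⊢
        exact this
      have hp : (0 : ℝ) < 2 ^ (k + 1) := by positivity
      have e1 : ((2 : ℝ) ^ (k + 1)) ^ (k + 1) = 2 ^ (k + 1) * (2 ^ k * (2 ^ k) ^ k) := by
        have : ((2 : ℝ) ^ (k + 1)) ^ k = 2 ^ k * (2 ^ k) ^ k := by
          rw [← mul_pow, ← pow_succ']
        rw [pow_succ, this, mul_comm]
      have e2 : ((1 : ℝ) / 2) ^ (k + 1 + 1) = a / 2 := by rw [pow_succ, ha]; ring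
      rw [e1, e2]
      have e3 : ((2 : ℝ) ^ (k + 1) - 1) = 2 ^ (k + 1) * (1 - a) := by linear_combination ha2
      rw [e3]
      have e4 : (1 / 4 + a / 2 : ℝ) ≤ (1 - a) * (1 / 4 + a) := by nlinarith
      calc (1 / 4 + a / 2) * (2 ^ (k + 1) * (2 ^ k * (2 ^ k) ^ k))
          ≤ ((1 - a) * (1 / 4 + a)) * (2 ^ (k + 1) * (2 ^ k * (2 ^ k) ^ k)) := by gcongr
        _ = 2 ^ (k + 1) * (1 - a) * (2 ^ k * ((1 / 4 + a) * (2 ^ k) ^ k)) := by ring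
        _ ≤ _ := by
          have : 0 ≤ 1 - a := by linarith
          gcongr
  have hcard : (Nat.card {w : Fin k → Fin k → ZMod 2 // LinearIndependent (ZMod 2) w} : ℝ) =
      ∏ i : Fin k, ((2 : ℝ) ^ k - 2 ^ (i : ℕ)) := by
    have h := card_linearIndependent (K := ZMod 2) (V := Fin k → ZMod 2) (k := k) (by simp)
    rw [h, Nat.cast_prod]
    refine Finset.prod_congr rfl fun i _ => ?_
    rw [Module.finrank_fin_fun, ZMod.card,
      Nat.cast_sub (Nat.pow_le_pow_right (by norm_num) i.2.le)]
    push_cast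
    rfl
  rw [hcard]
  rcases Nat.eq_zero_or_pos k with rfl | hk
  · norm_num
  · refine le_trans ?_ (hprod k hk)
    gcongr
    have : (0 : ℝ) ≤ (1 / 2) ^ (k + 1) := by positivity
    linarith

/-- The restriction of a random family to the values of an injection is uniformly distributed. -/
theorem card_comp_injective {X : Type*} [Finite X] {π : Fin k → Fin n}
    (hπ : Function.Injective π) (P : (Fin k → X) → Prop) :
    Nat.card {v : Fin n → X // P (v ∘ π)} * Nat.card (Fin k → X) =
      Nat.card {w : Fin k → X // P w} * Nat.card (Fin n → X) := by
  classical
  let e : (Fin n → X) ≃ (Fin k → X) × ({i // i ∉ Set.range π} → X) :=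
    (Equiv.piEquivPiSubtypeProd (fun i => i ∈ Set.range π) fun _ => X).trans
      (Equiv.prodCongr ((Equiv.ofInjective π hπ).arrowCongr (Equiv.refl X)).symm (Equiv.refl _))
  have he : ∀ v, (e v).1 = v ∘ π := fun v => rfl
  have h1 : Nat.card {v : Fin n → X // P (v ∘ π)} =
      Nat.card {w : Fin k → X // P w} * Nat.card ({i // i ∉ Set.range π} → X) := by
    rw [← Nat.card_prod]
    refine Nat.card_congr ((e.subtypeEquiv (q := fun p => P p.1) fun v => by rw [he]).trans ?_)
    exact Equiv.prodSubtypeFstEquivSubtypeProd (p := P)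
  have h2 := Nat.card_congr e
  rw [Nat.card_prod] at h2
  rw [h1, h2]
  ring

end WalkPoly

end KPath

namespace KPath

open Polynomial

section WalkPolyProbability

variable {n k : ℕ}

theorem _root_.WeightedDigraph.pathWeight_eq_sum (G : WeightedDigraph n) (x₀ : Fin n)
    (l : List (Fin n)) : G.pathWeight l =
      ∑ p ∈ Finset.range (l.length - 1), G.wt (l.getD p x₀) (l.getD (p + 1) x₀) := by
  induction l with
  | nil => simp [WeightedDigraph.pathWeight]
  | cons i l ih =>
    cases l with
    | nil => simp [WeightedDigraph.pathWeight]
    | cons j l =>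
      rw [WeightedDigraph.pathWeight_cons_cons, ih]
      simp only [List.length_cons, Nat.add_sub_cancel]
      rw [Finset.sum_range_succ', add_comm]
      congr 1

theorem stepDegree_getD {G : WeightedDigraph n} {M : ℕ} (hw : G.WeightsIn M) (x₀ : Fin n)
    {l : List (Fin n)} (hl : l.IsChain G.Adj) (hne : 1 ≤ l.length) :
    (stepDegree G M (fun p => l.getD p x₀) (l.length - 1) : ℤ) =
      G.pathWeight l + ((l.length : ℤ) - 1) * M := by
  rw [stepDegree, Nat.cast_sum, G.pathWeight_eq_sum x₀]
  have : ∀ p ∈ Finset.range (l.length - 1),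
      (((G.wt (l.getD p x₀) (l.getD (p + 1) x₀) + M).toNat : ℕ) : ℤ) =
        G.wt (l.getD p x₀) (l.getD (p + 1) x₀) + M := by
    intro p hp
    rw [Finset.mem_range] at hp
    have h := List.isChain_iff_getElem.1 hl p (by omega)
    have h' := (hw _ _ h).1
    rw [Int.toNat_of_nonneg]
    rw [List.getD_eq_getElem _ _ (by omega), List.getD_eq_getElem _ _ (by omega)]
    omega
  rw [Finset.sum_congr rfl this, Finset.sum_add_distrib, Finset.sum_const, Finset.card_range]
  rw [nsmul_eq_mul, Nat.cast_sub hne, Nat.cast_one]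

theorem eight_mul_le_card_walkField (k : ℕ) : 8 * k ≤ Nat.card (WalkField k) := by
  rw [GaloisField.card 2 _ (by omega), pow_add]
  have := Nat.le_pow_clog (one_lt_two) k
  omega

theorem coeffOne_coeff_walkPoly (G : WeightedDigraph n) (M e : ℕ) (c : WalkChoice n k) :
    coeffOne k ((G.walkPoly M c).coeff e) =
      ∑ j, (coeffOne k ∘ₗ LinearMap.mulRight (WalkField k) (WeightedDigraph.vertexValue c.2 j))
        ((walkVec G M (WeightedDigraph.vertexValue c.2)
          (extendScalars (uncurryScalars c.1)) (k - 1) j).coeff e) := by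
  rw [walkPoly_eq, Polynomial.finsetSum_coeff, map_sum]
  exact Finset.sum_congr rfl fun j _ => by
    rw [coeff_mul_C, LinearMap.comp_apply, LinearMap.mulRight_apply]

/-- For vectors that are independent along a path, the coefficient of the walk polynomial that
belongs to the path vanishes for at most one eighth of the scalars. -/
theorem card_coeff_walkPoly_eq_zero_le (G : WeightedDigraph n) (M : ℕ) (hk : 2 ≤ k)
    (π : ℕ → Fin n) (hadj : ∀ p < k - 1, G.Adj (π p) (π (p + 1))) (v : Fin n → Fin k → ZMod 2)
    (hv : LinearIndependent (ZMod 2) fun c : Fin k => v (π c)) :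
    8 * Nat.card {Y : Fin (k - 1) → Fin n → Fin n → WalkField k //
        coeffOne k ((G.walkPoly M (Y, v)).coeff (stepDegree G M π (k - 1))) = 0} ≤
      Nat.card (Fin (k - 1) → Fin n → Fin n → WalkField k) := by
  have h0 : coeffOne k (∏ p ∈ Finset.Ico 0 k, WeightedDigraph.vertexValue v (π p)) ≠ 0 := by
    have h := coeffOne_prod_of_linearIndependent hv
    rw [← Finset.range_eq_Ico, Finset.prod_range]
    simp only [WeightedDigraph.vertexValue]
    rw [h]
    exact one_ne_zero
  obtain ⟨m, rfl⟩ : ∃ m, k = m + 2 := ⟨k - 2, by omega⟩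
  have hm : m + 2 - 1 = m + 1 := rfl
  have h1 := card_walkVec_step G M (WeightedDigraph.vertexValue v)
    (m := m + 2 - 1) (c := m) (by omega)
    (fun j => coeffOne (m + 2) ∘ₗ LinearMap.mulRight _ (WeightedDigraph.vertexValue v j))
    (stepDegree G M π (m + 1)) (hadj m (by omega))
    (by simp [stepDegree, Finset.sum_range_succ])
  have h2 := card_walkVec_eq_zero_le G M (WeightedDigraph.vertexValue v) (m := m + 2 - 1)
    (coeffOne (m + 2)) π hadj h0 m (by omega) (by omega)
  have h3 : stepDegree G M π (m + 1) - (G.wt (π m) (π (m + 1)) + M).toNat =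
      stepDegree G M π m := by simp [stepDegree, Finset.sum_range_succ]
  have h4 : Finset.Ico m (m + 2) = {m, m + 1} := by
    ext p; simp only [Finset.mem_Ico, Finset.mem_insert, Finset.mem_singleton]; omega
  rw [h4, Finset.prod_pair (by omega)] at h2
  simp only [h3, LinearMap.comp_apply, LinearMap.mulRight_apply, mul_assoc] at h1
  have h5 : Nat.card {Y : Fin (m + 2 - 1) → Fin n → Fin n → WalkField (m + 2) //
        coeffOne (m + 2) ((G.walkPoly M (Y, v)).coeff (stepDegree G M π (m + 2 - 1))) = 0} =
      Nat.card {Y : Fin (m + 2 - 1) × Fin n × Fin n → WalkField (m + 2) //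
        ∑ j, coeffOne (m + 2) ((walkVec G M (WeightedDigraph.vertexValue v) (extendScalars Y)
          (m + 1) j).coeff (stepDegree G M π (m + 1)) * WeightedDigraph.vertexValue v j) = 0} := by
    refine Nat.card_congr (uncurryScalars.subtypeEquiv fun Y => ?_)
    rw [coeffOne_coeff_walkPoly]
    rfl
  have h6 := Nat.card_congr (uncurryScalars (n := n) (m := m + 2 - 1) (F := WalkField (m + 2)))
  rw [← h6] at h1 h2
  rw [← h5] at h1
  have h7 := eight_mul_le_card_walkField (m + 2)
  refine Nat.le_of_mul_le_mul_right (c := m + 2) ?_ (by omega)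
  calc _ = Nat.card {Y : Fin (m + 2 - 1) → Fin n → Fin n → WalkField (m + 2) //
        coeffOne (m + 2) ((G.walkPoly M (Y, v)).coeff (stepDegree G M π (m + 2 - 1))) = 0} *
        (8 * (m + 2)) := by ring
    _ ≤ _ := Nat.mul_le_mul_left _ h7
    _ ≤ _ := h1.trans (Nat.add_le_add_right h2 _)
    _ ≤ _ := by nlinarith

/-- On a single vertex the walk polynomial records the parity of the number of nonzero vectors. -/
theorem card_coeff_walkPoly_one_eq_zero_le (G : WeightedDigraph n) (M : ℕ) (i₀ : Fin n) :
    2 * Nat.card {c : WalkChoice n 1 // coeffOne 1 ((G.walkPoly M c).coeff 0) = 0} ≤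
      Nat.card (WalkChoice n 1) := by
  let val : (Fin 1 → ZMod 2) → WalkField 1 := fun u => 1 + if u = 0 then 1 else 0
  have hval : Function.Injective val := by
    have h2 : (1 + 1 : WalkField 1) = 0 := CharTwo.add_self_eq_zero 1
    have hne : ∀ u : Fin 1 → ZMod 2, u ≠ 0 → u = 1 := by decide
    intro u u' h
    by_cases hu : u = 0 <;> by_cases hu' : u' = 0 <;> simp [val, hu, hu'] at h
    · rw [hu, hu']
    · rw [hne u hu, hne u' hu']
  have h1 := card_linear_form_eq_zero_le hval (Finset.univ : Finset (Fin n)) (fun _ _ => 1)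
    (Finset.mem_univ i₀) (fun _ _ _ _ => rfl)
  have h2 : ∀ c : WalkChoice n 1, coeffOne 1 ((G.walkPoly M c).coeff 0) =
      ∑ i, val (c.2 i) * 1 := by
    intro c
    rw [coeffOne_coeff_walkPoly]
    refine Finset.sum_congr rfl fun i _ => ?_
    show coeffOne 1 ((1 : (WalkAlgebra 1)[X]).coeff 0 * WeightedDigraph.vertexValue c.2 i) = _
    rw [coeff_one_zero, one_mul, mul_one, WeightedDigraph.vertexValue, map_add, coeffOne_one,
      coeffOne_of]
  simp only [h2]
  have : Subsingleton (Fin (1 - 1) → Fin n → Fin n → WalkField 1) := by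
    show Subsingleton (Fin 0 → Fin n → Fin n → WalkField 1)
    infer_instance
  have h3 : Nat.card {c : WalkChoice n 1 // ∑ i, val (c.2 i) * 1 = 0} ≤
      Nat.card {y : Fin n → Fin 1 → ZMod 2 // ∑ i, val (y i) * 1 = 0} := by
    refine Nat.card_le_card_of_injective (fun c => ⟨c.1.2, c.2⟩) fun c c' h => ?_
    exact Subtype.ext (Prod.ext (Subsingleton.elim _ _) (Subtype.ext_iff.1 h))
  have h4 : Nat.card (WalkChoice n 1) = Nat.card (Fin n → Fin 1 → ZMod 2) := by
    rw [WalkChoice, Nat.card_prod]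
    have : Nat.card (Fin (1 - 1) → Fin n → Fin n → WalkField 1) = 1 :=
      Nat.card_eq_one_iff_unique.2 ⟨this, ⟨fun _ _ _ => 0⟩⟩
    rw [this, one_mul]
  have h5 : Nat.card {y : Fin n → Fin 1 → ZMod 2 // (1 : WalkField 1) = 0} = 0 :=
    Nat.card_eq_zero.2 (Or.inl ⟨fun y => one_ne_zero y.2⟩)
  have h6 : Nat.card (Fin 1 → ZMod 2) = 2 := by simp
  rw [h5, h6] at h1
  omega

theorem card_subtype_add_card_not {α : Type*} [Finite α] (p : α → Prop) :
    Nat.card {a // p a} + Nat.card {a // ¬ p a} = Nat.card α := by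
  classical
  rw [← Nat.card_sum, Nat.card_congr (Equiv.sumCompl p)]

theorem mul_card_le_card_not {a b N : ℕ} (m : ℕ) {r : ℝ} (hm : (0 : ℝ) < m) (hr : r ≤ 1 - 1 / m)
    (h₁ : m * a ≤ N) (h₂ : a + b = N) : r * N ≤ b := by
  have h₁' : (a : ℝ) ≤ 1 / m * N := by
    rw [one_div, ← div_eq_inv_mul, le_div_iff₀ hm, mul_comm]
    exact_mod_cast h₁
  have h₂' : (a : ℝ) + b = N := by exact_mod_cast h₂
  calc r * N ≤ (1 - 1 / m) * N := by gcongr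
    _ ≤ b := by rw [sub_mul]; linarith

/-- For `2 ≤ k` the vectors along a minimum path are independent with probability at least `1 / 4`, and
then the scalars are good with probability at least `7 / 8`; for `k = 1` the probability is at least
`1 / 2`. -/
theorem fifth_le_card_walkChoice {G : WeightedDigraph n} {M : ℕ} (hk : 1 ≤ k)
    (hw : G.WeightsIn M) {d : ℤ} (hd : G.IsMinWeight k d) :
    (1 / 5 : ℝ) * Nat.card (WalkChoice n k) ≤
      Nat.card {c : WalkChoice n k //
        ∃ m : ℕ, IsLeast {e : ℕ | (G.walkPoly M c).coeff e ≠ 0} m ∧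
          (m : ℤ) = d + (k - 1) * M} := by
  obtain ⟨⟨l, ⟨hlen, hnd, hch⟩, hlw⟩, hmin⟩ := hd
  have hl0 : 0 < l.length := by omega
  let x₀ : Fin n := l[0]
  let π : ℕ → Fin n := fun p => l.getD p x₀
  have hadj : ∀ p < k - 1, G.Adj (π p) (π (p + 1)) := by
    intro p hp
    simp only [π]
    rw [List.getD_eq_getElem _ _ (by omega), List.getD_eq_getElem _ _ (by omega)]
    exact List.isChain_iff_getElem.1 hch p (by omega)
  have he : (stepDegree G M π (k - 1) : ℤ) = d + (k - 1) * M := by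
    have := stepDegree_getD hw x₀ hch hl0
    rw [hlen, hlw] at this
    exact this
  -- it suffices that the coefficient of the minimum path does not vanish
  have hgood : Nat.card {c : WalkChoice n k //
      coeffOne k ((G.walkPoly M c).coeff (stepDegree G M π (k - 1))) ≠ 0} ≤
      Nat.card {c : WalkChoice n k //
        ∃ m : ℕ, IsLeast {e : ℕ | (G.walkPoly M c).coeff e ≠ 0} m ∧
          (m : ℤ) = d + (k - 1) * M} := by
    refine Nat.card_le_card_of_injective
      (fun c => ⟨c.1, stepDegree G M π (k - 1), ⟨fun h => c.2 ?_, fun e hne => ?_⟩, he⟩) ?_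
    · rw [h, map_zero]
    · obtain ⟨l', hl', hw'⟩ := exists_isKPath_of_coeff_walkPoly_ne_zero hk hw c.1 hne
      have := hmin ⟨l', hl', rfl⟩
      zify
      rw [he, ← hw']
      linarith
    · intro c c' h
      exact Subtype.ext (Subtype.ext_iff.1 h :)
  refine le_trans ?_ (Nat.cast_le.2 hgood)
  rcases Nat.lt_or_ge k 2 with hk2 | hk2
  · obtain rfl : k = 1 := by omega
    have h1 := card_coeff_walkPoly_one_eq_zero_le G M x₀
    have h2 := card_subtype_add_card_not
      (fun c : WalkChoice n 1 => coeffOne 1 ((G.walkPoly M c).coeff 0) = 0)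
    exact mul_card_le_card_not 2 (by norm_num) (by norm_num) h1 h2
  · let πf : Fin k → Fin n := fun c => π c
    have hπ : Function.Injective πf := by
      intro a b h
      simp only [πf, π] at h
      rw [List.getD_eq_getElem _ _ (by omega), List.getD_eq_getElem _ _ (by omega)] at h
      exact Fin.ext ((hnd.getElem_inj_iff).1 h)
    let V := {v : Fin n → Fin k → ZMod 2 // LinearIndependent (ZMod 2) (v ∘ πf)}
    let Ys := Fin (k - 1) → Fin n → Fin n → WalkField k
    have hV : (1 / 4 : ℝ) * Nat.card (Fin n → Fin k → ZMod 2) ≤ Nat.card V := by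
      have h1 := card_comp_injective hπ fun w : Fin k → Fin k → ZMod 2 =>
        LinearIndependent (ZMod 2) w
      have h2 := quarter_le_card_linearIndependent k
      have h3 : (Nat.card (Fin k → Fin k → ZMod 2) : ℝ) = (2 ^ k) ^ k := by simp
      have h1' : (Nat.card V : ℝ) * (2 ^ k) ^ k =
          Nat.card {w : Fin k → Fin k → ZMod 2 // LinearIndependent (ZMod 2) w} *
            Nat.card (Fin n → Fin k → ZMod 2) := by
        rw [← h3]
        exact_mod_cast h1
      have hpos : (0 : ℝ) < (2 ^ k) ^ k := by positivity
      refine le_of_mul_le_mul_right ?_ hpos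
      rw [h1']
      calc _ = (1 / 4 : ℝ) * (2 ^ k) ^ k * Nat.card (Fin n → Fin k → ZMod 2) := by ring
        _ ≤ _ := by gcongr
    have hY : ∀ v : V, (7 / 8 : ℝ) * Nat.card Ys ≤
        Nat.card {Y : Ys //
          coeffOne k ((G.walkPoly M (Y, v.1)).coeff (stepDegree G M π (k - 1))) ≠ 0} := by
      intro v
      have h1 := card_coeff_walkPoly_eq_zero_le G M hk2 π hadj v.1 v.2
      have h2 := card_subtype_add_card_not
        (fun Y : Ys => coeffOne k ((G.walkPoly M (Y, v.1)).coeff (stepDegree G M π (k - 1))) = 0)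
      exact mul_card_le_card_not 8 (by norm_num) (by norm_num) h1 h2
    have hle : Nat.card (Σ v : V, {Y : Ys //
        coeffOne k ((G.walkPoly M (Y, v.1)).coeff (stepDegree G M π (k - 1))) ≠ 0}) ≤
        Nat.card {c : WalkChoice n k //
          coeffOne k ((G.walkPoly M c).coeff (stepDegree G M π (k - 1))) ≠ 0} := by
      refine Nat.card_le_card_of_injective (fun p => ⟨(p.2.1, p.1.1), p.2.2⟩) ?_
      rintro ⟨⟨v, hv⟩, ⟨Y, hY⟩⟩ ⟨⟨v', hv'⟩, ⟨Y', hY'⟩⟩ h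
      have h' := Subtype.ext_iff.1 h
      simp only [Prod.mk.injEq] at h'
      obtain ⟨rfl, rfl⟩ := h'
      rfl
    have : Fintype V := Fintype.ofFinite V
    rw [Nat.card_sigma] at hle
    calc (1 / 5 : ℝ) * Nat.card (WalkChoice n k)
        = 1 / 5 * (Nat.card Ys * Nat.card (Fin n → Fin k → ZMod 2)) := by
          rw [WalkChoice, Nat.card_prod]; push_cast; rfl
      _ ≤ (1 / 4 * Nat.card (Fin n → Fin k → ZMod 2)) * (7 / 8 * Nat.card Ys) := by
          have : (0 : ℝ) ≤ Nat.card Ys * Nat.card (Fin n → Fin k → ZMod 2) := by positivity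
          linarith
      _ ≤ Nat.card V * (7 / 8 * Nat.card Ys) := by gcongr
      _ = ∑ v : V, (7 / 8 * Nat.card Ys : ℝ) := by
          rw [Finset.sum_const, Finset.card_univ, nsmul_eq_mul, Nat.card_eq_fintype_card]
      _ ≤ ∑ v : V, (Nat.card {Y : Ys //
          coeffOne k ((G.walkPoly M (Y, v.1)).coeff (stepDegree G M π (k - 1))) ≠ 0} : ℝ) :=
          Finset.sum_le_sum fun v _ => hY v
      _ ≤ _ := by exact_mod_cast hle

end WalkPolyProbability

end KPath

/-! ### The exterior algebra on bit masks -/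

namespace KPath

/-- The `i`-th binary digit of `S`; a number `S < 2 ^ k` stands for the set of the positions of
its ones, and for the corresponding basis vector of the exterior algebra of `ℤᵏ`. -/
def bit (S i : ℕ) : ℕ := S / 2 ^ i % 2

/-- The sign `(-1) ^ r` where `r` is the number of elements of `S` below `i`. -/
def sgn (S i : ℕ) : ℤ := ∏ j ∈ Finset.range i, (1 - 2 * (bit S j : ℤ))

/-- Exterior multiplication by the vector `x` of `ℤᵏ`, in coordinates. -/
def wedge (k : ℕ) (x f : ℕ → ℤ) (S : ℕ) : ℤ :=
  ∑ i ∈ Finset.range k, (bit S i : ℤ) * sgn S i * x i * f (S - bit S i * 2 ^ i)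

/-- Contraction with the vector `x` of `ℤᵏ`, the transpose of `wedge`. -/
def contract (k : ℕ) (x g : ℕ → ℤ) (S : ℕ) : ℤ :=
  ∑ i ∈ Finset.range k, (1 - (bit S i : ℤ)) * sgn S i * x i * g (S + (1 - bit S i) * 2 ^ i)

theorem bit_eq_zero_or_one (S i : ℕ) : bit S i = 0 ∨ bit S i = 1 := by
  unfold bit; omega

theorem sgn_succ (S i : ℕ) : sgn S (i + 1) = sgn S i * (1 - 2 * (bit S i : ℤ)) :=
  Finset.prod_range_succ _ _

theorem abs_sgn (S i : ℕ) : |sgn S i| = 1 := by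
  induction i with
  | zero => simp [sgn]
  | succ i ih => rcases bit_eq_zero_or_one S i with h | h <;> simp [sgn_succ, ih, h]

theorem bit_add_two_pow {S i : ℕ} (h : bit S i = 0) (j : ℕ) :
    bit (S + 2 ^ i) j = if j = i then 1 else bit S j := by
  unfold bit at *
  rcases lt_trichotomy j i with hj | rfl | hj
  · obtain ⟨d, rfl⟩ : ∃ d, i = j + (d + 1) := ⟨i - j - 1, by omega⟩
    rw [if_neg (by omega), pow_add, mul_comm (2 ^ j), Nat.add_mul_div_right _ _ (by positivity),
      pow_succ]
    omega
  · rw [if_pos rfl, Nat.add_div_right _ (by positivity)]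
    omega
  · obtain ⟨d, rfl⟩ : ∃ d, j = i + 1 + d := ⟨j - i - 1, by omega⟩
    rw [if_neg (by omega), pow_add, ← Nat.div_div_eq_div_mul, ← Nat.div_div_eq_div_mul, pow_succ,
      ← Nat.div_div_eq_div_mul, ← Nat.div_div_eq_div_mul, Nat.add_div_right _ (by positivity)]
    congr 2
    omega

theorem two_pow_le_of_bit {S i : ℕ} (h : bit S i = 1) : 2 ^ i ≤ S := by
  by_contra hc
  rw [bit, Nat.div_eq_of_lt (by omega)] at h
  omega

theorem bit_sub_two_pow_self {S i : ℕ} (h : bit S i = 1) : bit (S - 2 ^ i) i = 0 := by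
  have h1 := two_pow_le_of_bit h
  obtain ⟨T, rfl⟩ := Nat.exists_eq_add_of_le' h1
  unfold bit at *
  rw [Nat.add_div_right _ (by positivity)] at h
  rw [Nat.add_sub_cancel]
  omega

theorem add_two_pow_lt {S i k : ℕ} (hS : S < 2 ^ k) (hi : i < k) (h : bit S i = 0) :
    S + 2 ^ i < 2 ^ k := by
  obtain ⟨d, rfl⟩ : ∃ d, k = i + (d + 1) := ⟨k - i - 1, by omega⟩
  rw [pow_add] at *
  have h1 : S / 2 ^ i < 2 ^ (d + 1) := Nat.div_lt_of_lt_mul hS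
  have h2 : S / 2 ^ i + 1 < 2 ^ (d + 1) := by
    unfold bit at h
    rw [pow_succ] at *
    omega
  rw [← Nat.add_div_right _ (by positivity)] at h2
  rw [mul_comm]
  exact (Nat.div_lt_iff_lt_mul (by positivity)).1 h2

theorem sgn_add_two_pow_of_le {S i j : ℕ} (h : bit S i = 0) (hj : j ≤ i) :
    sgn (S + 2 ^ i) j = sgn S j := by
  refine Finset.prod_congr rfl fun l hl => ?_
  rw [bit_add_two_pow h, if_neg (by simp at hl; omega)]

theorem sgn_add_two_pow_of_lt {S i j : ℕ} (h : bit S i = 0) (hj : i < j) :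
    sgn (S + 2 ^ i) j = - sgn S j := by
  induction j, hj using Nat.le_induction with
  | base =>
    rw [Nat.succ_eq_add_one, sgn_succ, sgn_succ, sgn_add_two_pow_of_le h le_rfl,
      bit_add_two_pow h, if_pos rfl, h]
    simp
  | succ j hj ih =>
    rw [sgn_succ, sgn_succ, ih, bit_add_two_pow h, if_neg (by omega), neg_mul]

/-- Contracting twice with the same vector gives zero: the terms in which two positions are
filled in one order or the other cancel. -/
theorem contract_contract_self (k : ℕ) (x g : ℕ → ℤ) : contract k x (contract k x g) = 0 := by
  funext S
  let A : ℕ → ℕ → ℤ := fun i j => (1 - (bit S i : ℤ)) * sgn S i * x i *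
    ((1 - (bit (S + (1 - bit S i) * 2 ^ i) j : ℤ)) * sgn (S + (1 - bit S i) * 2 ^ i) j * x j *
      g (S + (1 - bit S i) * 2 ^ i + (1 - bit (S + (1 - bit S i) * 2 ^ i) j) * 2 ^ j))
  have hlt : ∀ i j, i < j → A i j = - A j i := by
    intro i j hij
    rcases bit_eq_zero_or_one S i with hi | hi <;> rcases bit_eq_zero_or_one S j with hj | hj
    · simp only [A, hi, hj, Nat.sub_zero, one_mul, bit_add_two_pow hi, bit_add_two_pow hj,
        if_neg (show j ≠ i by omega), if_neg (show i ≠ j by omega),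
        sgn_add_two_pow_of_lt hi hij, sgn_add_two_pow_of_le hj hij.le]
      rw [add_right_comm]
      ring
    · simp [A, hi, hj, bit_add_two_pow hi, show j ≠ i by omega]
    · simp [A, hi, hj, bit_add_two_pow hj, show i ≠ j by omega]
    · simp [A, hi, hj]
  have hanti : ∀ i j, A i j = - A j i := by
    intro i j
    rcases lt_trichotomy i j with h | rfl | h
    · exact hlt i j h
    · rcases bit_eq_zero_or_one S i with hi | hi
      · simp [A, hi, bit_add_two_pow hi]
      · simp [A, hi]
    · rw [hlt j i h, neg_neg]
  have hsum : contract k x (contract k x g) S =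
      ∑ i ∈ Finset.range k, ∑ j ∈ Finset.range k, A i j := by
    simp only [contract, Finset.mul_sum, A]
  have hneg : ∑ i ∈ Finset.range k, ∑ j ∈ Finset.range k, A i j =
      - ∑ i ∈ Finset.range k, ∑ j ∈ Finset.range k, A i j := by
    conv_lhs => rw [Finset.sum_comm]
    simp only [← Finset.sum_neg_distrib]
    exact Finset.sum_congr rfl fun j _ => Finset.sum_congr rfl fun i _ => hanti i j
  rw [hsum, Pi.zero_apply]
  omega

/-- `contract` is the transpose of `wedge`. -/
theorem sum_mul_wedge (k : ℕ) (x f g : ℕ → ℤ) :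
    ∑ S ∈ Finset.range (2 ^ k), g S * wedge k x f S =
      ∑ S ∈ Finset.range (2 ^ k), contract k x g S * f S := by
  simp only [wedge, contract, Finset.mul_sum, Finset.sum_mul]
  rw [Finset.sum_comm, Finset.sum_comm (s := Finset.range (2 ^ k))]
  refine Finset.sum_congr rfl fun i hi => ?_
  rw [Finset.mem_range] at hi
  rw [← Finset.sum_filter_of_ne (p := fun S => bit S i = 1),
    ← Finset.sum_filter_of_ne (s := Finset.range (2 ^ k)) (p := fun S => bit S i = 0)]
  · refine Finset.sum_nbij' (fun S => S - 2 ^ i) (fun S => S + 2 ^ i) ?_ ?_ ?_ ?_ ?_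
    · intro S hS
      simp only [Finset.mem_filter, Finset.mem_range] at hS ⊢
      exact ⟨(Nat.sub_le _ _).trans_lt hS.1, bit_sub_two_pow_self hS.2⟩
    · intro S hS
      simp only [Finset.mem_filter, Finset.mem_range] at hS ⊢
      exact ⟨add_two_pow_lt hS.1 hi hS.2, by simp [bit_add_two_pow hS.2]⟩
    · intro S hS
      simp only [Finset.mem_filter] at hS
      exact Nat.sub_add_cancel (two_pow_le_of_bit hS.2)
    · intro S hS
      exact Nat.add_sub_cancel _ _
    · intro S hS
      simp only [Finset.mem_filter] at hS
      have h1 := two_pow_le_of_bit hS.2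
      have h2 := bit_sub_two_pow_self hS.2
      have h3 : sgn S i = sgn (S - 2 ^ i) i := by
        conv_lhs => rw [← Nat.sub_add_cancel h1]
        exact sgn_add_two_pow_of_le h2 le_rfl
      rw [h2, hS.2, h3]
      simp only [Nat.sub_zero, one_mul, Nat.sub_add_cancel h1]
      push_cast
      ring
  · intro S _ h
    rcases bit_eq_zero_or_one S i with h' | h'
    · exact h'
    · simp [h'] at h
  · intro S _ h
    rcases bit_eq_zero_or_one S i with h' | h'
    · simp [h'] at h
    · exact h'

/-- Contraction as a linear map into the endomorphisms of the space of coordinate functions. -/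
def contractHom (k : ℕ) : (Fin k → ℤ) →ₗ[ℤ] Module.End ℤ (ℕ → ℤ) where
  toFun x :=
    { toFun := contract k fun i => if h : i < k then x ⟨i, h⟩ else 0
      map_add' := fun f g => by
        funext S
        simp only [contract, Pi.add_apply, mul_add, Finset.sum_add_distrib]
      map_smul' := fun a f => by
        funext S
        simp only [contract, Pi.smul_apply, smul_eq_mul, Finset.mul_sum, RingHom.id_apply]
        exact Finset.sum_congr rfl fun i _ => by ring }
  map_add' x y := by
    refine LinearMap.ext fun f => funext fun S => ?_
    simp only [contract, LinearMap.coe_mk, AddHom.coe_mk, LinearMap.add_apply, Pi.add_apply,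
      ← Finset.sum_add_distrib]
    refine Finset.sum_congr rfl fun i _ => ?_
    split_ifs <;> ring
  map_smul' a x := by
    refine LinearMap.ext fun f => funext fun S => ?_
    simp only [contract, LinearMap.coe_mk, AddHom.coe_mk, LinearMap.smul_apply, Pi.smul_apply,
      smul_eq_mul, RingHom.id_apply, Finset.mul_sum]
    refine Finset.sum_congr rfl fun i _ => ?_
    split_ifs <;> ring

theorem contractHom_apply (k : ℕ) (x : ℕ → ℤ) (f : ℕ → ℤ) :
    contractHom k (fun i => x i) f = contract k x f := by
  funext S
  show contract k _ f S = _
  simp only [contract]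
  refine Finset.sum_congr rfl fun i hi => ?_
  simp only [Finset.mem_range] at hi
  simp [hi]

/-- The full contraction of the volume element with `k` vectors of `ℤᵏ`. -/
def fullContraction (k : ℕ) : (Fin k → ℤ) [⋀^Fin k]→ₗ[ℤ] ℤ :=
  (LinearMap.proj (R := ℤ) (φ := fun _ : ℕ => ℤ) 0 ∘ₗ
      (LinearMap.applyₗ (Pi.single (2 ^ k - 1) 1) : Module.End ℤ (ℕ → ℤ) →ₗ[ℤ] (ℕ → ℤ)) ∘ₗ
      (ExteriorAlgebra.lift ℤ ⟨contractHom k, fun m => by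
        refine LinearMap.ext fun f => ?_
        exact contract_contract_self k _ f⟩).toLinearMap).compAlternatingMap
    (ExteriorAlgebra.ιMulti ℤ k)

theorem fullContraction_apply (k : ℕ) (x : Fin k → Fin k → ℤ) :
    fullContraction k x =
      (List.ofFn fun c => contractHom k (x c)).prod (Pi.single (2 ^ k - 1) 1) 0 := by
  simp [fullContraction, ExteriorAlgebra.ιMulti_apply, map_list_prod, List.map_ofFn,
    Function.comp_def]

/-- The vector `(1, v, v², …)`; any `k` of these vectors with distinct `v` have a nonzero
Vandermonde determinant. -/
def vertexVec (v i : ℕ) : ℤ := (v : ℤ) ^ i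

/-- Contraction of the volume element with the vectors of the vertices in `l`, the last one
first. -/
def suffixForm (k : ℕ) (l : List ℕ) : ℕ → ℤ :=
  l.foldr (fun v => contract k (vertexVec v)) (Pi.single (2 ^ k - 1) 1)

theorem bit_two_pow_sub_one (m i : ℕ) (h : i < m) : bit (2 ^ m - 1) i = 1 := by
  have := Nat.testBit_two_pow_sub_one m i
  rw [Nat.testBit_eq_decide_div_mod_eq] at this
  unfold bit
  simpa [h] using this

theorem contract_single (k m : ℕ) (hm : m < k) :
    contract k (Pi.single m 1) (Pi.single (2 ^ (m + 1) - 1) 1) =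
      (-1 : ℤ) ^ m • Pi.single (2 ^ m - 1) 1 := by
  funext S
  rw [contract, Finset.sum_eq_single m]
  · rw [Pi.single_eq_same, Pi.smul_apply, smul_eq_mul]
    rcases bit_eq_zero_or_one S m with h | h
    · have h2 : 0 < 2 ^ m := by positivity
      by_cases hS : S = 2 ^ m - 1
      · have hs : sgn S m = (-1) ^ m := by
          rw [hS, sgn, Finset.prod_congr rfl (g := fun _ => (-1 : ℤ)), Finset.prod_const,
            Finset.card_range]
          intro j hj
          rw [bit_two_pow_sub_one m j (Finset.mem_range.1 hj)]
          norm_num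
        have he : S + (1 - 0) * 2 ^ m = 2 ^ (m + 1) - 1 := by rw [pow_succ]; omega
        rw [h, he, hs, Pi.single_eq_same, ← hS, Pi.single_eq_same]
        simp
      · have he : S + (1 - 0) * 2 ^ m ≠ 2 ^ (m + 1) - 1 := by rw [pow_succ]; omega
        rw [h, Pi.single_eq_of_ne he, Pi.single_eq_of_ne hS]
        simp
    · have hS : S ≠ 2 ^ m - 1 := by
        rintro rfl
        have h2 : 0 < 2 ^ m := by positivity
        rw [bit, Nat.div_eq_of_lt (by omega)] at h
        omega
      rw [h, Pi.single_eq_of_ne hS]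
      simp
  · intro i _ hi
    rw [Pi.single_eq_of_ne hi]
    simp
  · intro h
    exact absurd (Finset.mem_range.2 hm) h

theorem fullContraction_basis_ne_zero (k : ℕ) :
    fullContraction k (fun c => Pi.single c 1) ≠ 0 := by
  have key : ∀ d m, m + d = k → ∃ u : ℤ, u ≠ 0 ∧
      (List.ofFn fun c : Fin d => contractHom k fun i => if (i : ℕ) = m + c then 1 else 0).prod
        (Pi.single (2 ^ k - 1) 1) = u • Pi.single (2 ^ m - 1) 1 := by
    intro d
    induction d with
    | zero =>
      rintro m rfl
      exact ⟨1, one_ne_zero, by simp⟩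
    | succ d ih =>
      intro m hm
      obtain ⟨u, hu, h⟩ := ih (m + 1) (by omega)
      refine ⟨u * (-1) ^ m, by simp [hu], ?_⟩
      rw [List.ofFn_succ, List.prod_cons, Module.End.mul_apply]
      have h1 : ∀ c : Fin d, (fun i : Fin k => if (i : ℕ) = m + (c.succ : ℕ) then (1 : ℤ) else 0) =
          fun i : Fin k => if (i : ℕ) = m + 1 + c then (1 : ℤ) else 0 := by
        intro c
        funext i
        simp only [Fin.val_succ]
        congr 1
        simp only [eq_iff_iff]
        omega
      simp only [h1, h, map_smul, Fin.val_zero, add_zero]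
      have h2 : (fun i : Fin k => if (i : ℕ) = m then (1 : ℤ) else 0) =
          fun i : Fin k => (Pi.single m 1 : ℕ → ℤ) i := by
        funext i
        simp [Pi.single_apply]
      rw [h2, contractHom_apply, contract_single k m (by omega), smul_smul]
  obtain ⟨u, hu, h⟩ := key k 0 (by simp)
  have h3 : (fun c : Fin k => contractHom k (Pi.single c 1)) =
      fun c : Fin k => contractHom k fun i => if (i : ℕ) = 0 + c then 1 else 0 := by
    funext c
    congr 1
    funext i
    simp [Pi.single_apply, Fin.ext_iff]
  rw [fullContraction_apply, h3, h]
  simpa using hu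

theorem suffixForm_ofFn (k m : ℕ) (v : Fin m → ℕ) :
    suffixForm k (List.ofFn v) =
      (List.ofFn fun c => contractHom k fun i => vertexVec (v c) i).prod
        (Pi.single (2 ^ k - 1) 1) := by
  induction m with
  | zero => simp [suffixForm]
  | succ m ih =>
    rw [List.ofFn_succ, List.ofFn_succ, List.prod_cons, Module.End.mul_apply, contractHom_apply,
      ← ih]
    rfl

/-- Contracting the volume element with the vectors of `k` vertices gives a nonzero number
exactly if the vertices are distinct, because the result is a Vandermonde determinant up to a
nonzero factor. -/
theorem suffixForm_zero_ne_zero_iff {k : ℕ} {l : List ℕ} (hl : l.length = k) :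
    suffixForm k l 0 ≠ 0 ↔ l.Nodup := by
  subst hl
  obtain ⟨m, v, hv⟩ : ∃ (m : ℕ) (v : Fin m → ℕ), l = List.ofFn v := ⟨_, _, (List.ofFn_get l).symm⟩
  have hm : l.length = m := by simp [hv]
  rw [hm, hv, suffixForm_ofFn, List.nodup_ofFn]
  have h1 := AlternatingMap.eq_smul_basis_det (Pi.basisFun ℤ (Fin m)) (fullContraction m)
  have h2 : fullContraction m (fun c i => vertexVec (v c) i) =
      fullContraction m (fun c => Pi.single c 1) *
        (Matrix.vandermonde fun c => (v c : ℤ)).det := by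
    conv_lhs => rw [h1]
    simp only [AlternatingMap.smul_apply, smul_eq_mul, Pi.basisFun_det_apply]
    congr 1
    congr 1
    funext c
    exact Pi.basisFun_apply _ _ c
  rw [fullContraction_apply] at h2
  rw [h2, mul_ne_zero_iff, Matrix.det_vandermonde_ne_zero_iff]
  simp only [fullContraction_basis_ne_zero, ne_eq, not_false_eq_true, true_and]
  exact (Nat.cast_injective (R := ℤ)).of_comp_iff v

end KPath

/-! ### The table of extensor-valued walk sums -/

namespace KPath

/-- `table k n M adj wt y c v S e` is the coefficient at the basis vector `S` and the degree `e` of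
the sum over all walks with `c` vertices that end in `v`.  A walk contributes the product of the
scalars `y p u` of its vertices `u` at the positions `p` times the exterior product of their
vectors.  Walks start in the additional vertex `n`, at degree `2 * M`, so that no degree becomes
negative; an edge of weight `w` raises the degree by `w + M`. -/
def table (k n M : ℕ) (adj wt : ℕ → ℕ → ℤ) (y : ℕ → ℕ → ℤ) : ℕ → ℕ → ℕ → ℕ → ℤ
  | 0, v, S, e => if v = n ∧ S = 0 ∧ e = 2 * M then 1 else 0
  | c + 1, v, S, e =>
    if v < n ∧ 2 * M ≤ e then
      y c v * ∑ u ∈ Finset.range (n + 1), adj u v *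
        wedge k (vertexVec v)
          (fun S' => table k n M adj wt y c u S' ((e : ℤ) - wt u v - M).toNat) S
    else 0

/-- The pairing of two coordinate functions on masks. -/
def pairing (k : ℕ) (g f : ℕ → ℤ) : ℤ := ∑ S ∈ Finset.range (2 ^ k), g S * f S

/-- `adj` and `wt` describe the graph `G` together with a source `n` that is joined to all vertices
by edges of weight `-M`. -/
structure Encodes {n : ℕ} (G : WeightedDigraph n) (M : ℕ) (adj wt : ℕ → ℕ → ℤ) : Prop where
  adj_one : ∀ i j : Fin n, G.Adj i j → adj i j = 1
  adj_zero : ∀ i j : Fin n, ¬ G.Adj i j → adj i j = 0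
  wt_eq : ∀ i j : Fin n, G.Adj i j → wt i j = G.wt i j
  adj_source : ∀ j < n, adj n j = 1
  wt_source : ∀ j < n, wt n j = -M

section Table

variable {k n M : ℕ} {adj wt : ℕ → ℕ → ℤ} {y : ℕ → ℕ → ℤ}

theorem table_congr {y' : ℕ → ℕ → ℤ} {c : ℕ} (h : ∀ p < c, ∀ v < n, y p v = y' p v) :
    table k n M adj wt y c = table k n M adj wt y' c := by
  induction c with
  | zero => rfl
  | succ c ih =>
    funext v S e
    rw [table, table, ih fun p hp => h p (by omega)]
    split_ifs with hv
    · rw [h c (by omega) v hv.1]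
    · rfl

theorem pairing_table_succ (g : ℕ → ℤ) {c v e : ℕ} (hv : v < n) (he : 2 * M ≤ e) :
    pairing k g (fun S => table k n M adj wt y (c + 1) v S e) =
      y c v * ∑ u ∈ Finset.range (n + 1), adj u v *
        pairing k (contract k (vertexVec v) g)
          (fun S => table k n M adj wt y c u S ((e : ℤ) - wt u v - M).toNat) := by
  simp only [pairing, ← sum_mul_wedge]
  simp only [table, if_pos (And.intro hv he), Finset.mul_sum]
  rw [Finset.sum_comm]
  exact Finset.sum_congr rfl fun u _ => Finset.sum_congr rfl fun S _ => by ring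

theorem pairing_table_zero (g : ℕ → ℤ) (v e : ℕ) :
    pairing k g (fun S => table k n M adj wt y 0 v S e) =
      if v = n ∧ e = 2 * M then g 0 else 0 := by
  rw [pairing, Finset.sum_eq_single 0]
  · by_cases h : v = n ∧ e = 2 * M
    · simp [table, h]
    · have : ¬ (v = n ∧ 0 = 0 ∧ e = 2 * M) := by tauto
      rw [table, if_neg this, if_neg h, mul_zero]
  · intro S _ hS
    simp [table, hS]
  · intro h
    simp at h

theorem pairing_single (f : ℕ → ℤ) : pairing k (Pi.single (2 ^ k - 1) 1) f = f (2 ^ k - 1) := by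
  rw [pairing, Finset.sum_eq_single (2 ^ k - 1)]
  · simp
  · intro S _ hS
    simp [hS]
  · intro h
    exact absurd (Finset.mem_range.2 (Nat.sub_lt (by positivity) one_pos)) h

/-- The sum of the degrees of the edges of a walk. -/
def walkDegree (M : ℕ) (wt : ℕ → ℕ → ℤ) (l : List ℕ) : ℤ :=
  (List.zipWith (fun u v => wt u v + M) l l.tail).sum

theorem walkDegree_cons_cons (u v : ℕ) (l : List ℕ) :
    walkDegree M wt (u :: v :: l) = wt u v + M + walkDegree M wt (v :: l) := by
  simp [walkDegree]

/-- A walk traced back from its end: the vertices `s` are known, `v` is the next one, at position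
`c` and degree `e`, and the walks to `v` still have a nonzero pairing with the form of `s`. -/
structure Trace (k n M : ℕ) (adj wt : ℕ → ℕ → ℤ) (y : ℕ → ℕ → ℤ) (e₀ : ℤ) (c v e : ℕ)
    (s : List ℕ) : Prop where
  ne_zero : pairing k (suffixForm k s) (fun S => table k n M adj wt y c v S e) ≠ 0
  chain : (v :: s).IsChain fun u w => adj u w ≠ 0
  lt : ∀ w ∈ s, w < n
  degree : (e : ℤ) + walkDegree M wt (v :: s) = e₀
  length : s.length + c = k

theorem Trace.lt_and_le {e₀ : ℤ} {c v e : ℕ} {s : List ℕ}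
    (h : Trace k n M adj wt y e₀ (c + 1) v e s) : v < n ∧ 2 * M ≤ e := by
  by_contra hc
  refine h.ne_zero (Finset.sum_eq_zero fun S _ => ?_)
  simp only [table, if_neg hc, mul_zero]

/-- The terms whose sum is the pairing at position `c + 1`, one for each predecessor `u`. -/
theorem Trace.exists_pred {e₀ : ℤ} {c v e : ℕ} {s : List ℕ}
    (h : Trace k n M adj wt y e₀ (c + 1) v e s) : ∃ u < n + 1, adj u v *
      pairing k (suffixForm k (v :: s))
        (fun S => table k n M adj wt y c u S ((e : ℤ) - wt u v - M).toNat) ≠ 0 := by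
  have h1 := h.ne_zero
  rw [pairing_table_succ _ h.lt_and_le.1 h.lt_and_le.2] at h1
  obtain ⟨u, hu, hne⟩ := Finset.exists_ne_zero_of_sum_ne_zero (right_ne_zero_of_mul h1)
  exact ⟨u, Finset.mem_range.1 hu, hne⟩

section Graph

variable {G : WeightedDigraph n}

theorem Encodes.wt_bounds (hG : Encodes G M adj wt) (hw : G.WeightsIn M) {u v : ℕ}
    (hu : u ≤ n) (hv : v < n) (h : adj u v ≠ 0) : -(M : ℤ) ≤ wt u v ∧ wt u v ≤ M := by
  rcases hu.lt_or_eq with hu | rfl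
  · have hA : G.Adj ⟨u, hu⟩ ⟨v, hv⟩ := by
      by_contra hA
      exact h (hG.adj_zero ⟨u, hu⟩ ⟨v, hv⟩ hA)
    have h1 := hG.wt_eq ⟨u, hu⟩ ⟨v, hv⟩ hA
    simp only at h1
    rw [h1]
    exact hw _ _ hA
  · rw [hG.wt_source v hv]
    omega

theorem Encodes.abs_adj_le (hG : Encodes G M adj wt) {u v : ℕ}
    (hu : u ≤ n) (hv : v < n) : |adj u v| ≤ 1 := by
  rcases hu.lt_or_eq with hu | rfl
  · by_cases hA : G.Adj ⟨u, hu⟩ ⟨v, hv⟩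
    · rw [show adj u v = 1 from hG.adj_one ⟨u, hu⟩ ⟨v, hv⟩ hA]; simp
    · rw [show adj u v = 0 from hG.adj_zero ⟨u, hu⟩ ⟨v, hv⟩ hA]; simp
  · rw [hG.adj_source v hv]; simp

theorem Trace.step (hG : Encodes G M adj wt) (hw : G.WeightsIn M) {e₀ : ℤ} {c v e u : ℕ}
    {s : List ℕ} (h : Trace k n M adj wt y e₀ (c + 1) v e s) (hu : u < n + 1)
    (hne : adj u v * pairing k (suffixForm k (v :: s))
        (fun S => table k n M adj wt y c u S ((e : ℤ) - wt u v - M).toNat) ≠ 0) :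
    Trace k n M adj wt y e₀ c u ((e : ℤ) - wt u v - M).toNat (v :: s) where
  ne_zero := right_ne_zero_of_mul hne
  chain := List.isChain_cons_cons.2 ⟨left_ne_zero_of_mul hne, h.chain⟩
  lt := by
    intro w hw
    rcases List.mem_cons.1 hw with rfl | hw
    · exact h.lt_and_le.1
    · exact h.lt w hw
  degree := by
    have h1 := hG.wt_bounds hw (by omega) h.lt_and_le.1 (left_ne_zero_of_mul hne)
    have h2 := h.lt_and_le.2
    rw [walkDegree_cons_cons, Int.toNat_of_nonneg (by omega), ← h.degree]
    ring
  length := by rw [← h.length, List.length_cons]; omega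

theorem Trace.start {e v : ℕ} (h : table k n M adj wt y k v (2 ^ k - 1) e ≠ 0) :
    Trace k n M adj wt y e k v e [] where
  ne_zero := by
    show pairing k (Pi.single (2 ^ k - 1) 1) _ ≠ 0
    rwa [pairing_single]
  chain := List.isChain_singleton v
  lt := by simp
  degree := by simp [walkDegree]
  length := by simp

theorem walkDegree_map (hG : Encodes G M adj wt) {l : List (Fin n)} (hl : l.IsChain G.Adj) :
    walkDegree M wt (l.map Fin.val) = G.pathWeight l + ((l.length - 1 : ℕ) : ℤ) * M := by
  induction l with
  | nil => simp [walkDegree, WeightedDigraph.pathWeight]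
  | cons i l ih =>
    cases l with
    | nil => simp [walkDegree, WeightedDigraph.pathWeight]
    | cons j l =>
      rw [List.isChain_cons_cons] at hl
      rw [List.map_cons, List.map_cons, walkDegree_cons_cons, ← List.map_cons, ih hl.2,
        G.pathWeight_cons_cons, hG.wt_eq i j hl.1]
      simp only [List.length_cons, Nat.add_sub_cancel]
      push_cast
      ring

/-- A completed trace is a simple path of the weight given by its degree. -/
theorem Trace.finish (hG : Encodes G M adj wt) (hk : 1 ≤ k) {e₀ : ℤ} {v e : ℕ} {s : List ℕ}
    (h : Trace k n M adj wt y e₀ 0 v e s) : ∃ l : List (Fin n), G.IsKPath k l ∧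
      l.map Fin.val = s ∧ G.pathWeight l = e₀ - 2 * M - ((k : ℤ) - 1) * M := by
  have h0 := h.ne_zero
  rw [pairing_table_zero] at h0
  have hve : v = n ∧ e = 2 * M := by
    by_contra hc
    rw [if_neg hc] at h0
    exact h0 rfl
  rw [if_pos hve] at h0
  obtain ⟨rfl, rfl⟩ := hve
  have hlen : s.length = k := h.length
  have hnd : s.Nodup := (suffixForm_zero_ne_zero_iff hlen).1 h0
  have hlift : ∀ s : List ℕ, (∀ w ∈ s, w < v) → ∃ l : List (Fin v), l.map Fin.val = s := by
    intro s
    induction s with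
    | nil => exact fun _ => ⟨[], rfl⟩
    | cons w s ih =>
      intro hs
      obtain ⟨l, hl⟩ := ih fun x hx => hs x (by simp [hx])
      exact ⟨⟨w, hs w (by simp)⟩ :: l, by simp [hl]⟩
  obtain ⟨l, rfl⟩ := hlift s h.lt
  have hch : l.IsChain G.Adj := by
    have h1 := h.chain.tail
    rw [List.tail_cons, List.isChain_map] at h1
    refine h1.imp fun i j hij => ?_
    by_contra hA
    exact hij (hG.adj_zero i j hA)
  rw [List.length_map] at hlen
  refine ⟨l, ⟨hlen, List.Nodup.of_map _ hnd, hch⟩, rfl, ?_⟩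
  have h2 := h.degree
  obtain ⟨i, l', rfl⟩ : ∃ i l', l = i :: l' := List.exists_cons_of_length_pos (by omega)
  rw [List.map_cons, walkDegree_cons_cons, ← List.map_cons, walkDegree_map hG hch, hlen,
    hG.wt_source i i.2] at h2
  push_cast [hk] at h2
  linarith

theorem abs_wedge_term_le {v i S : ℕ} (hv : v < n) (hi : i < k) {f a : ℤ} {D : ℤ}
    (ha : |a| ≤ 1) (hf : |f| ≤ D) :
    |a * ((bit S i : ℤ) * sgn S i * vertexVec v i * f)| ≤ (n : ℤ) ^ k * D := by
  have hD : 0 ≤ D := (abs_nonneg _).trans hf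
  have hb : |(bit S i : ℤ)| ≤ 1 := by rcases bit_eq_zero_or_one S i with h | h <;> simp [h]
  have hx : |vertexVec v i| ≤ (n : ℤ) ^ k := by
    rw [vertexVec, abs_of_nonneg (by positivity)]
    exact_mod_cast (Nat.pow_le_pow_left hv.le i).trans (Nat.pow_le_pow_right (by omega) hi.le)
  rw [abs_mul, abs_mul, abs_mul, abs_mul, abs_sgn, mul_one]
  calc |a| * (|(bit S i : ℤ)| * |vertexVec v i| * |f|) ≤ 1 * (1 * (n : ℤ) ^ k * D) := by gcongr
    _ = _ := by ring

theorem abs_table_le (hG : Encodes G M adj wt) {Y : ℕ} (hy : ∀ p v, |y p v| ≤ Y) (c : ℕ) :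
    ∀ v S e, |table k n M adj wt y c v S e| ≤ ((Y * ((n + 1) * (k * n ^ k)) : ℕ) : ℤ) ^ c := by
  induction c with
  | zero =>
    intro v S e
    rw [table]
    split_ifs <;> simp
  | succ c ih =>
    intro v S e
    rw [table]
    split_ifs with h
    · have hs : |∑ u ∈ Finset.range (n + 1), adj u v *
          wedge k (vertexVec v)
            (fun S' => table k n M adj wt y c u S' ((e : ℤ) - wt u v - M).toNat) S| ≤
          ∑ u ∈ Finset.range (n + 1), ∑ i ∈ Finset.range k,
            (n : ℤ) ^ k * ((Y * ((n + 1) * (k * n ^ k)) : ℕ) : ℤ) ^ c := by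
        refine (Finset.abs_sum_le_sum_abs _ _).trans (Finset.sum_le_sum fun u hu => ?_)
        rw [Finset.mem_range] at hu
        rw [wedge, Finset.mul_sum]
        refine (Finset.abs_sum_le_sum_abs _ _).trans (Finset.sum_le_sum fun i hi => ?_)
        exact abs_wedge_term_le h.1 (Finset.mem_range.1 hi) (hG.abs_adj_le (by omega) h.1)
          (ih _ _ _)
      rw [abs_mul]
      calc _ ≤ (Y : ℤ) * _ := mul_le_mul (hy _ _) hs (abs_nonneg _) (by positivity)
        _ = _ := by
          simp only [Finset.sum_const, Finset.card_range, nsmul_eq_mul, pow_succ]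
          push_cast
          ring
    · rw [abs_zero]
      positivity

end Graph

end Table

end KPath

namespace KPath

/-- Random scalars `y p v` read off from a sequence of `N` values, `stride` of them for each
position `p`. -/
def flatScalars {κ : Type*} {N : ℕ} (val : κ → ℤ) (stride : ℕ) (ω : Fin N → κ) (p v : ℕ) : ℤ :=
  if h : p * stride + v < N then val (ω ⟨p * stride + v, h⟩) else 0

section TableProbability

variable {k n M : ℕ} {adj wt : ℕ → ℕ → ℤ} {G : WeightedDigraph n} {κ : Type*} [Finite κ]
  {val : κ → ℤ}

/-- The sum over the walks with `c` vertices, followed by the part of the walk `π` from position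
`c` on, without the scalars at these positions. -/
def prefixSum (k n M : ℕ) (adj wt : ℕ → ℕ → ℤ) (G : WeightedDigraph n) (l : List (Fin n))
    (x₀ : Fin n) (y : ℕ → ℕ → ℤ) (c : ℕ) : ℤ :=
  ∑ u ∈ Finset.range (n + 1), adj u (l.getD c x₀) *
    pairing k (suffixForm k ((l.drop c).map Fin.val))
      (fun S => table k n M adj wt y c u S
        (((2 * M + stepDegree G M (fun p => l.getD p x₀) c : ℕ) : ℤ) -
          wt u (l.getD c x₀) - M).toNat)

theorem prefixSum_zero_ne_zero (hG : Encodes G M adj wt) {l : List (Fin n)}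
    (hl : l.length = k) (hnd : l.Nodup) (x₀ : Fin n) (y : ℕ → ℕ → ℤ) :
    prefixSum k n M adj wt G l x₀ y 0 ≠ 0 := by
  rw [prefixSum, Finset.sum_eq_single n]
  · rw [pairing_table_zero, hG.adj_source _ (l.getD 0 x₀).2, hG.wt_source _ (l.getD 0 x₀).2,
      if_pos ⟨rfl, by simp [stepDegree]; omega⟩, one_mul, List.drop_zero,
      suffixForm_zero_ne_zero_iff (by simpa using hl)]
    exact hnd.map Fin.val_injective
  · intro u _ hu
    rw [pairing_table_zero, if_neg (by tauto), mul_zero]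
  · intro h
    exact absurd (Finset.mem_range.2 (Nat.lt_succ_self n)) h

theorem suffixForm_drop {l : List (Fin n)} (x₀ : Fin n) {c : ℕ} (hc : c < l.length) :
    contract k (vertexVec (l.getD c x₀)) (suffixForm k ((l.drop (c + 1)).map Fin.val)) =
      suffixForm k ((l.drop c).map Fin.val) := by
  rw [List.drop_eq_getElem_cons hc, List.getD_eq_getElem _ _ hc]
  rfl

/-- The scalar of the vertex of `π` at position `c` occurs linearly in the sum for `c + 1`, with the sum
for `c` as its coefficient. -/
theorem card_prefixSum_succ_eq_zero_le (hG : Encodes G M adj wt) (hw : G.WeightsIn M)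
    (hval : Function.Injective val) {l : List (Fin n)} (hl : l.length = k)
    (hch : l.IsChain G.Adj) (x₀ : Fin n) {c : ℕ} (hc : c + 1 < k) :
    Nat.card {ω : Fin (k * (n + 1)) → κ //
        prefixSum k n M adj wt G l x₀ (flatScalars val (n + 1) ω) (c + 1) = 0} * Nat.card κ ≤
      Nat.card {ω : Fin (k * (n + 1)) → κ //
        prefixSum k n M adj wt G l x₀ (flatScalars val (n + 1) ω) c = 0} * Nat.card κ +
      Nat.card (Fin (k * (n + 1)) → κ) := by
  classical
  set π : ℕ → Fin n := fun p => l.getD p x₀ with hπ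
  have hlt : ∀ u : ℕ, u < n → c * (n + 1) + u < k * (n + 1) := by
    intro u hu
    have : (c + 1) * (n + 1) ≤ k * (n + 1) := Nat.mul_le_mul_right _ (by omega)
    rw [add_mul] at this
    omega
  -- the degree at position `c + 1` if the vertex there is `u`
  let deg : ℕ → ℕ := fun u =>
    (((2 * M + stepDegree G M π (c + 1) : ℕ) : ℤ) - wt u (π (c + 1)) - M).toNat
  let b : ℕ → (Fin (k * (n + 1)) → κ) → ℤ := fun u ω => adj u (π (c + 1)) *
    if 2 * M ≤ deg u then ∑ u' ∈ Finset.range (n + 1), adj u' u *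
      pairing k (contract k (vertexVec u) (suffixForm k ((l.drop (c + 1)).map Fin.val)))
        (fun S => table k n M adj wt (flatScalars val (n + 1) ω) c u' S
          ((deg u : ℤ) - wt u' u - M).toNat) else 0
  let f : Fin n → Fin (k * (n + 1)) := fun u => ⟨c * (n + 1) + u, hlt u u.2⟩
  have hf : Function.Injective f := by
    intro u u' h
    simp only [f, Fin.mk.injEq] at h
    exact Fin.ext (by omega)
  have hmod : ∀ u : Fin n, ((f u : Fin _) : ℕ) % (n + 1) = u := by
    intro u
    simp only [f]
    rw [add_comm, Nat.add_mul_mod_self_right, Nat.mod_eq_of_lt (by omega)]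
  have key := card_linear_form_eq_zero_le hval (Finset.univ.image f)
    (fun i ω => b (i % (n + 1)) ω) (i₀ := f (π c)) (by simp) (by
      intro i _ ω a
      simp only [b]
      rw [table_congr (y' := flatScalars val (n + 1) ω)]
      intro p hp v hv
      unfold flatScalars
      split_ifs with h
      · rw [Function.update_of_ne]
        intro he
        simp only [f, Fin.mk.injEq] at he
        have : (p + 1) * (n + 1) ≤ c * (n + 1) := Nat.mul_le_mul_right _ hp
        rw [add_mul] at this
        omega
      · rfl)
  have hsum : ∀ ω : Fin (k * (n + 1)) → κ,
      prefixSum k n M adj wt G l x₀ (flatScalars val (n + 1) ω) (c + 1) =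
        ∑ i ∈ Finset.univ.image f, val (ω i) * b (i % (n + 1)) ω := by
    intro ω
    rw [Finset.sum_image fun _ _ _ _ h => hf h, prefixSum, Finset.sum_range_succ,
      Finset.sum_range]
    have hlast : ∀ e, pairing k (suffixForm k ((l.drop (c + 1)).map Fin.val))
        (fun S => table k n M adj wt (flatScalars val (n + 1) ω) (c + 1) n S e) = 0 := by
      intro e
      refine Finset.sum_eq_zero fun S _ => ?_
      simp [table]
    rw [hlast, mul_zero, add_zero]
    refine Finset.sum_congr rfl fun u _ => ?_
    rw [hmod]
    show adj u (π (c + 1)) * pairing k _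
      (fun S => table k n M adj wt (flatScalars val (n + 1) ω) (c + 1) u S (deg u)) = _
    by_cases hd : 2 * M ≤ deg u
    · rw [pairing_table_succ _ u.2 hd]
      simp only [b, if_pos hd]
      have : flatScalars val (n + 1) ω c u = val (ω (f u)) := by
        rw [flatScalars, dif_pos (hlt u u.2)]
      rw [this]
      ring
    · simp only [b, if_neg hd, mul_zero]
      rw [mul_eq_zero]
      right
      refine Finset.sum_eq_zero fun S _ => ?_
      simp only [table]
      rw [if_neg (by tauto), mul_zero]
  have hcoef : ∀ ω : Fin (k * (n + 1)) → κ, b ((f (π c) : ℕ) % (n + 1)) ω =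
      prefixSum k n M adj wt G l x₀ (flatScalars val (n + 1) ω) c := by
    intro ω
    have hA : G.Adj (π c) (π (c + 1)) := by
      simp only [hπ]
      rw [List.getD_eq_getElem _ _ (by omega), List.getD_eq_getElem _ _ (by omega)]
      exact List.isChain_iff_getElem.1 hch c (by omega)
    have hb := (hw _ _ hA).1
    have hd : deg (π c) = 2 * M + stepDegree G M π c := by
      simp only [deg]
      rw [hG.wt_eq _ _ hA, stepDegree, Finset.sum_range_succ, ← stepDegree]
      push_cast
      rw [Int.toNat_of_nonneg (by omega)]
      omega
    rw [hmod]
    simp only [b]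
    rw [hd, hG.adj_one _ _ hA, one_mul, if_pos (by omega), suffixForm_drop x₀ (by omega)]
    rfl
  simp only [hsum, ← hcoef]
  exact key

/-- The entry of the table that belongs to the weight of a given path vanishes with probability at
most `k / |κ|`. -/
theorem card_table_eq_zero_le (hG : Encodes G M adj wt) (hw : G.WeightsIn M) (hk : 1 ≤ k)
    (hval : Function.Injective val) {l : List (Fin n)} (hl : G.IsKPath k l) (x₀ : Fin n) :
    Nat.card {ω : Fin (k * (n + 1)) → κ //
        table k n M adj wt (flatScalars val (n + 1) ω) k (l.getD (k - 1) x₀) (2 ^ k - 1)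
          (2 * M + stepDegree G M (fun p => l.getD p x₀) (k - 1)) = 0} * Nat.card κ ≤
      k * Nat.card (Fin (k * (n + 1)) → κ) := by
  classical
  obtain ⟨hlen, hnd, hch⟩ := hl
  have h1 : ∀ c < k, Nat.card {ω : Fin (k * (n + 1)) → κ //
        prefixSum k n M adj wt G l x₀ (flatScalars val (n + 1) ω) c = 0} * Nat.card κ ≤
      c * Nat.card (Fin (k * (n + 1)) → κ) := by
    intro c
    induction c with
    | zero =>
      intro _
      rw [Nat.card_eq_zero.2 (Or.inl ⟨fun ω => prefixSum_zero_ne_zero hG hlen hnd x₀ _ ω.2⟩)]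
      simp
    | succ c ih =>
      intro hc
      have h := card_prefixSum_succ_eq_zero_le (val := val) hG hw hval hlen hch x₀ hc
      have h' := ih (by omega)
      rw [add_mul]
      omega
  obtain ⟨m, rfl⟩ : ∃ m, k = m + 1 := ⟨k - 1, by omega⟩
  have hlt : m * (n + 1) + (l.getD m x₀ : ℕ) < (m + 1) * (n + 1) := by
    have := (l.getD m x₀).2
    rw [add_mul]
    omega
  have key := card_linear_form_eq_zero_le hval {⟨_, hlt⟩}
    (fun _ ω => prefixSum (m + 1) n M adj wt G l x₀ (flatScalars val (n + 1) ω) m)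
    (Finset.mem_singleton_self _) (by
      intro i _ ω a
      simp only [prefixSum]
      rw [table_congr (y' := flatScalars val (n + 1) ω)]
      intro p hp v hv
      unfold flatScalars
      split_ifs with h
      · rw [Function.update_of_ne]
        intro he
        simp only [Fin.mk.injEq] at he
        have : (p + 1) * (n + 1) ≤ m * (n + 1) := Nat.mul_le_mul_right _ hp
        rw [add_mul] at this
        omega
      · rfl)
  have hsum : ∀ ω : Fin ((m + 1) * (n + 1)) → κ,
      table (m + 1) n M adj wt (flatScalars val (n + 1) ω) (m + 1) (l.getD (m + 1 - 1) x₀)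
        (2 ^ (m + 1) - 1) (2 * M + stepDegree G M (fun p => l.getD p x₀) (m + 1 - 1)) =
      ∑ i ∈ {(⟨_, hlt⟩ : Fin ((m + 1) * (n + 1)))}, val (ω i) *
        prefixSum (m + 1) n M adj wt G l x₀ (flatScalars val (n + 1) ω) m := by
    intro ω
    rw [Nat.add_sub_cancel, Finset.sum_singleton, ← pairing_single (k := m + 1)
      fun S => table (m + 1) n M adj wt (flatScalars val (n + 1) ω) (m + 1)
        (l.getD m x₀) S (2 * M + stepDegree G M (fun p => l.getD p x₀) m),
      pairing_table_succ _ (l.getD m x₀).2 (by omega)]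
    have h2 : (Pi.single (2 ^ (m + 1) - 1) 1 : ℕ → ℤ) =
        suffixForm (m + 1) ((l.drop (m + 1)).map Fin.val) := by
      rw [List.drop_eq_nil_of_le (by omega)]
      rfl
    rw [h2, suffixForm_drop x₀ (by omega), flatScalars, dif_pos hlt]
    rfl
  simp only [hsum]
  have h2 := h1 m (by omega)
  refine key.trans ?_
  linarith

end TableProbability

end KPath

/-! ### Cost accounting for bounded memories -/

namespace RAM

/-- Number of nodes of an expression. -/
def Expr.size : Expr → ℕ
  | .lit _ => 1
  | .reg _ => 1
  | .read _ e => e.size + 1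
  | .add e₁ e₂ => e₁.size + e₂.size + 1
  | .sub e₁ e₂ => e₁.size + e₂.size + 1
  | .mul e₁ e₂ => e₁.size + e₂.size + 1
  | .div e₁ e₂ => e₁.size + e₂.size + 1

/-- The largest absolute value of a literal in an expression. -/
def Expr.maxLit : Expr → ℕ
  | .lit z => z.natAbs
  | .reg _ => 0
  | .read _ e => e.maxLit
  | .add e₁ e₂ => max e₁.maxLit e₂.maxLit
  | .sub e₁ e₂ => max e₁.maxLit e₂.maxLit
  | .mul e₁ e₂ => max e₁.maxLit e₂.maxLit
  | .div e₁ e₂ => max e₁.maxLit e₂.maxLit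

/-- Every register and every cell holds a number of absolute value at most `B`. -/
def State.Bdd (s : State) (B : ℕ) : Prop :=
  (∀ i, |s.reg i| ≤ (B : ℤ)) ∧ ∀ a m, |s.arr a m| ≤ (B : ℤ)

theorem Expr.size_pos (e : Expr) : 1 ≤ e.size := by
  cases e <;> simp [Expr.size]

theorem Expr.natAbs_eval_le {s : State} {B : ℕ} (hB : 2 ≤ B) (hs : s.Bdd B) (e : Expr)
    (hl : e.maxLit ≤ B) : (e.eval s).natAbs ≤ B ^ e.size := by
  have key : ∀ a b : ℕ, 1 ≤ a → 1 ≤ b → B ^ a + B ^ b ≤ B ^ (a + b + 1) := by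
    intro a b ha hb
    have h1 : B ^ a ≤ B ^ (a + b) := Nat.pow_le_pow_right (by omega) (by omega)
    have h2 : B ^ b ≤ B ^ (a + b) := Nat.pow_le_pow_right (by omega) (by omega)
    calc B ^ a + B ^ b ≤ B ^ (a + b) * 2 := by omega
      _ ≤ B ^ (a + b) * B := Nat.mul_le_mul_left _ hB
      _ = _ := (pow_succ _ _).symm
  induction e with
  | lit z => simpa [Expr.eval, Expr.size, Expr.maxLit] using hl
  | reg i =>
    have := hs.1 i
    rw [Int.abs_eq_natAbs] at this
    simp only [Expr.eval, Expr.size, pow_one]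
    omega
  | read a e ih =>
    have h1 : (s.arr a (e.eval s).toNat).natAbs ≤ B := by
      have := hs.2 a (e.eval s).toNat
      rw [Int.abs_eq_natAbs] at this
      omega
    exact h1.trans (Nat.le_self_pow (by simp [Expr.size]) B)
  | add e₁ e₂ ih₁ ih₂ =>
    simp only [Expr.maxLit, max_le_iff] at hl
    exact (Int.natAbs_add_le _ _).trans
      ((add_le_add (ih₁ hl.1) (ih₂ hl.2)).trans (key _ _ e₁.size_pos e₂.size_pos))
  | sub e₁ e₂ ih₁ ih₂ =>
    simp only [Expr.maxLit, max_le_iff] at hl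
    exact (Int.natAbs_sub_le _ _).trans
      ((add_le_add (ih₁ hl.1) (ih₂ hl.2)).trans (key _ _ e₁.size_pos e₂.size_pos))
  | mul e₁ e₂ ih₁ ih₂ =>
    simp only [Expr.maxLit, max_le_iff] at hl
    simp only [Expr.eval, Expr.size, Int.natAbs_mul]
    calc _ ≤ B ^ e₁.size * B ^ e₂.size := Nat.mul_le_mul (ih₁ hl.1) (ih₂ hl.2)
      _ = B ^ (e₁.size + e₂.size) := (pow_add _ _ _).symm
      _ ≤ _ := Nat.pow_le_pow_right (by omega) (by omega)
  | div e₁ e₂ ih₁ ih₂ =>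
    simp only [Expr.maxLit, max_le_iff] at hl
    simp only [Expr.eval, Expr.size]
    calc _ ≤ (e₁.eval s).natAbs := Int.natAbs_ediv_le_natAbs _ _
      _ ≤ B ^ e₁.size := ih₁ hl.1
      _ ≤ _ := Nat.pow_le_pow_right (by omega) (by omega)

theorem size_pow_le (B m : ℕ) (hm : 1 ≤ m) : Nat.size (B ^ m) ≤ m * Nat.size B := by
  rw [Nat.size_le, mul_comm, pow_mul]
  exact Nat.pow_lt_pow_left (Nat.lt_size_self B) (by omega)

theorem Expr.cost_le {s : State} {B : ℕ} (hB : 2 ≤ B) (hs : s.Bdd B) (m : ℕ) (e : Expr)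
    (hl : e.maxLit ≤ B) (hm : e.size ≤ m) :
    e.cost s ≤ e.size * (1 + m * Nat.size B) := by
  have node : ∀ e : Expr, e.maxLit ≤ B → e.size ≤ m →
      1 + len (e.eval s) ≤ 1 + m * Nat.size B := by
    intro e hl hm
    have h1 : len (e.eval s) ≤ Nat.size (B ^ e.size) :=
      Nat.size_le_size (e.natAbs_eval_le hB hs hl)
    have h2 := size_pow_le B e.size e.size_pos
    have h3 := Nat.mul_le_mul_right (Nat.size B) hm
    omega
  induction e with
  | lit z => simpa [Expr.cost, Expr.size, Expr.eval] using node _ hl hm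
  | reg i => simpa [Expr.cost, Expr.size, Expr.eval] using node _ hl hm
  | read a e ih =>
    have h := node _ hl hm
    simp only [Expr.maxLit, Expr.size] at hl hm
    have h1 := ih hl (by omega)
    simp only [Expr.cost, Expr.size, add_mul, one_mul] at h h1 ⊢
    omega
  | add e₁ e₂ ih₁ ih₂ | sub e₁ e₂ ih₁ ih₂ | mul e₁ e₂ ih₁ ih₂ | div e₁ e₂ ih₁ ih₂ =>
    have h := node _ hl hm
    simp only [Expr.maxLit, max_le_iff, Expr.size] at hl hm
    have h1 := ih₁ hl.1 (by omega)
    have h2 := ih₂ hl.2 (by omega)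
    simp only [Expr.cost, Expr.size, add_mul, one_mul] at h h1 h2 ⊢
    omega

/-- An upper bound for the time of one atomic instruction on a memory bounded by `B`.  The factor
covers two expressions of `64` nodes, each node having a value of at most `64` times the length
of `B`. -/
def unitCost (B : ℕ) : ℕ := 10000 * (Nat.size B + 1)

/-- Expressions with at most `64` nodes and literals at most `B`. -/
def Expr.Ok (e : Expr) (B : ℕ) : Prop := e.size ≤ 64 ∧ e.maxLit ≤ B

theorem Expr.Ok.cost_le {s : State} {B : ℕ} (hB : 2 ≤ B) (hs : s.Bdd B) {e : Expr}
    (he : e.Ok B) : e.cost s ≤ 64 + 4096 * Nat.size B := by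
  have h1 := e.cost_le hB hs 64 he.2 he.1
  have h2 := Nat.mul_le_mul_right (1 + 64 * Nat.size B) he.1
  omega

theorem Expr.ok_of_size_of_maxLit {e : Expr} {B : ℕ} (hB : 2 ≤ B) (h : e.size ≤ 64)
    (h' : e.maxLit ≤ 2) : e.Ok B := ⟨h, h'.trans hB⟩

@[simp] theorem State.setReg_reg (s : State) (i j : ℕ) (z : ℤ) :
    (s.setReg i z).reg j = if j = i then z else s.reg j := by
  simp [State.setReg, Function.update_apply]

@[simp] theorem State.setReg_arr (s : State) (i : ℕ) (z : ℤ) : (s.setReg i z).arr = s.arr := rfl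

@[simp] theorem State.setReg_tossed (s : State) (i : ℕ) (z : ℤ) :
    (s.setReg i z).tossed = s.tossed := rfl

@[simp] theorem State.setArr_reg (s : State) (a m : ℕ) (z : ℤ) :
    (s.setArr a m z).reg = s.reg := rfl

@[simp] theorem State.setArr_arr (s : State) (a m b x : ℕ) (z : ℤ) :
    (s.setArr a m z).arr b x = if b = a ∧ x = m then z else s.arr b x := by
  by_cases h : b = a
  · subst h; simp [State.setArr, Function.update_apply]
  · simp [State.setArr, h]

theorem State.Bdd.setReg {s : State} {B : ℕ} (hs : s.Bdd B) (i : ℕ) {z : ℤ} (hz : |z| ≤ B) :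
    (s.setReg i z).Bdd B := by
  refine ⟨fun j => ?_, hs.2⟩
  rw [State.setReg_reg]
  split_ifs
  · exact hz
  · exact hs.1 j

theorem State.Bdd.setArr {s : State} {B : ℕ} (hs : s.Bdd B) (a m : ℕ) {z : ℤ} (hz : |z| ≤ B) :
    (s.setArr a m z).Bdd B := by
  refine ⟨hs.1, fun b x => ?_⟩
  rw [State.setArr_arr]
  split_ifs
  · exact hz
  · exact hs.2 b x

/-! ### A program logic with step counts -/

/-- The registers that a program may change. -/
def Cmd.writesReg : Cmd → ℕ → Bool
  | .skip, _ => false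
  | .assign i _, j => i == j
  | .write _ _ _, _ => false
  | .toss i, j => i == j
  | .seq p q, j => p.writesReg j || q.writesReg j
  | .branch _ p q, j => p.writesReg j || q.writesReg j
  | .loop _ p, j => p.writesReg j

/-- The arrays that a program may change. -/
def Cmd.writesArr : Cmd → ℕ → Bool
  | .skip, _ => false
  | .assign _ _, _ => false
  | .write a _ _, b => a == b
  | .toss _, _ => false
  | .seq p q, b => p.writesArr b || q.writesArr b
  | .branch _ p q, b => p.writesArr b || q.writesArr b
  | .loop _ p, b => p.writesArr b

/-- The memories `s` and `s'` agree outside what the program `p` may change. -/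
def Agree (p : Cmd) (s s' : State) : Prop :=
  (∀ i, p.writesReg i = false → s'.reg i = s.reg i) ∧
    ∀ a, p.writesArr a = false → s'.arr a = s.arr a

theorem Agree.refl (p : Cmd) (s : State) : Agree p s s := ⟨fun _ _ => rfl, fun _ _ => rfl⟩

theorem Agree.trans {p : Cmd} {s s' s'' : State} (h : Agree p s s') (h' : Agree p s' s'') :
    Agree p s s'' :=
  ⟨fun i hi => (h'.1 i hi).trans (h.1 i hi), fun a ha => (h'.2 a ha).trans (h.2 a ha)⟩

theorem Agree.mono {p q : Cmd} {s s' : State} (h : Agree p s s')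
    (h₁ : ∀ i, q.writesReg i = false → p.writesReg i = false)
    (h₂ : ∀ a, q.writesArr a = false → p.writesArr a = false) : Agree q s s' :=
  ⟨fun i hi => h.1 i (h₁ i hi), fun a ha => h.2 a (h₂ a ha)⟩

theorem Exec.agree {coin : ℕ → Bool} {p : Cmd} {s s' : State} {t : ℕ} (h : Exec coin p s s' t) :
    Agree p s s' := by
  induction h with
  | skip s => exact Agree.refl _ _
  | assign i e s =>
    refine ⟨fun j hj => ?_, fun _ _ => rfl⟩
    simp only [Cmd.writesReg, beq_eq_false_iff_ne] at hj
    simp [Ne.symm hj]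
  | write a e₁ e₂ s =>
    refine ⟨fun _ _ => rfl, fun b hb => ?_⟩
    simp only [Cmd.writesArr, beq_eq_false_iff_ne] at hb
    funext x
    simp [Ne.symm hb]
  | toss i s =>
    refine ⟨fun j hj => ?_, fun _ _ => rfl⟩
    simp only [Cmd.writesReg, beq_eq_false_iff_ne] at hj
    show (s.setReg i _).reg j = _
    simp [Ne.symm hj]
  | seq _ _ ih₁ ih₂ =>
    refine (ih₁.mono ?_ ?_).trans (ih₂.mono ?_ ?_) <;>
      simp +contextual [Cmd.writesReg, Cmd.writesArr]
  | branch_pos _ _ ih => refine ih.mono ?_ ?_ <;> simp +contextual [Cmd.writesReg, Cmd.writesArr]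
  | branch_neg _ _ ih => refine ih.mono ?_ ?_ <;> simp +contextual [Cmd.writesReg, Cmd.writesArr]
  | loop_neg _ => exact Agree.refl _ _
  | loop_pos _ _ _ ih₁ ih₂ =>
    refine (ih₁.mono ?_ ?_).trans ih₂ <;> simp [Cmd.writesReg, Cmd.writesArr]

/-- Programs are deterministic once the coin tosses are fixed. -/
theorem Exec.state_unique {coin : ℕ → Bool} {p : Cmd} {s s₁ s₂ : State} {t₁ t₂ : ℕ}
    (h₁ : Exec coin p s s₁ t₁) (h₂ : Exec coin p s s₂ t₂) : s₁ = s₂ := by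
  induction h₁ generalizing s₂ t₂ with
  | skip s => cases h₂; rfl
  | assign i e s => cases h₂; rfl
  | write a e₁ e₂ s => cases h₂; rfl
  | toss i s => cases h₂; rfl
  | seq _ _ ih₁ ih₂ =>
    cases h₂ with
    | seq h h' =>
      obtain rfl := ih₁ h
      exact ih₂ h'
  | branch_pos he _ ih =>
    cases h₂ with
    | branch_pos _ h => exact ih h
    | branch_neg he' _ => omega
  | branch_neg he _ ih =>
    cases h₂ with
    | branch_pos he' _ => omega
    | branch_neg _ h => exact ih h
  | loop_neg he =>
    cases h₂ with
    | loop_neg _ => rfl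
    | loop_pos he' _ _ => omega
  | loop_pos he _ _ ih₁ ih₂ =>
    cases h₂ with
    | loop_neg he' => omega
    | loop_pos _ h h' =>
      obtain rfl := ih₁ h
      exact ih₂ h'

/-- Started in `s`, the program `p` halts after at most `a` steps of unit cost in a memory that is
bounded by `B` and satisfies `Q`. -/
def Runs (coin : ℕ → Bool) (B : ℕ) (p : Cmd) (s : State) (a : ℕ) (Q : State → Prop) : Prop :=
  ∃ s' t, Exec coin p s s' t ∧ t ≤ a * unitCost B ∧ s'.Bdd B ∧ Q s'

section Rules

variable {coin : ℕ → Bool} {B : ℕ} {s : State} {Q : State → Prop}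

theorem Runs.mono {p : Cmd} {a a' : ℕ} {Q' : State → Prop} (h : Runs coin B p s a Q)
    (ha : a ≤ a') (hQ : ∀ s', s'.Bdd B → Agree p s s' → Q s' → Q' s') :
    Runs coin B p s a' Q' := by
  obtain ⟨s', t, he, ht, hb, hq⟩ := h
  exact ⟨s', t, he, ht.trans (Nat.mul_le_mul_right _ ha), hb, hQ s' hb he.agree hq⟩

theorem runs_skip (hs : s.Bdd B) (hQ : Q s) : Runs coin B .skip s 1 Q :=
  ⟨s, 1, .skip s, by simp [unitCost]; omega, hs, hQ⟩

theorem runs_assign {i : ℕ} {e : Expr} (hB : 2 ≤ B) (hs : s.Bdd B) (he : e.Ok B)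
    (hv : |e.eval s| ≤ B) (hQ : Q (s.setReg i (e.eval s))) : Runs coin B (.assign i e) s 1 Q := by
  refine ⟨_, _, .assign i e s, ?_, hs.setReg i hv, hQ⟩
  have := he.cost_le hB hs
  simp only [unitCost]; omega

theorem runs_write {a : ℕ} {e₁ e₂ : Expr} (hB : 2 ≤ B) (hs : s.Bdd B) (he₁ : e₁.Ok B)
    (he₂ : e₂.Ok B) (hv : |e₂.eval s| ≤ B)
    (hQ : Q (s.setArr a (e₁.eval s).toNat (e₂.eval s))) : Runs coin B (.write a e₁ e₂) s 1 Q := by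
  refine ⟨_, _, .write a e₁ e₂ s, ?_, hs.setArr a _ hv, hQ⟩
  have h₁ := he₁.cost_le hB hs
  have h₂ := he₂.cost_le hB hs
  simp only [unitCost]; omega

theorem runs_toss {i : ℕ} (hB : 2 ≤ B) (hs : s.Bdd B)
    (hQ : Q { s.setReg i (if coin s.tossed then 1 else 0) with tossed := s.tossed + 1 }) :
    Runs coin B (.toss i) s 1 Q := by
  refine ⟨_, _, .toss i s, by simp only [unitCost]; omega, ?_, hQ⟩
  have : |(if coin s.tossed then 1 else 0 : ℤ)| ≤ B := by split_ifs <;> simp; omega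
  exact hs.setReg i this

theorem runs_seq {p q : Cmd} {a b : ℕ}
    (h : Runs coin B p s a fun s' => s'.Bdd B → Agree p s s' → Runs coin B q s' b Q) :
    Runs coin B (.seq p q) s (a + b) Q := by
  obtain ⟨s', t, he, ht, hb, hq⟩ := h
  obtain ⟨s'', t', he', ht', hb', hq'⟩ := hq hb he.agree
  exact ⟨s'', t + t', .seq he he', by rw [add_mul]; omega, hb', hq'⟩

theorem runs_branch {e : Expr} {p q : Cmd} {a : ℕ} (hB : 2 ≤ B) (hs : s.Bdd B) (he : e.Ok B)
    (hp : 0 < e.eval s → Runs coin B p s a Q) (hq : e.eval s ≤ 0 → Runs coin B q s a Q) :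
    Runs coin B (.branch e p q) s (a + 1) Q := by
  have hc : e.cost s + 1 ≤ unitCost B := by
    have := he.cost_le hB hs
    simp only [unitCost]; omega
  rcases lt_or_ge 0 (e.eval s) with h | h
  · obtain ⟨s', t, hx, ht, hb, hq⟩ := hp h
    exact ⟨s', _, .branch_pos h hx, by rw [add_mul]; omega, hb, hq⟩
  · obtain ⟨s', t, hx, ht, hb, hq⟩ := hq h
    exact ⟨s', _, .branch_neg h hx, by rw [add_mul]; omega, hb, hq⟩

theorem runs_loop_neg {e : Expr} {p : Cmd} (hB : 2 ≤ B) (hs : s.Bdd B) (he : e.Ok B)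
    (hv : e.eval s ≤ 0) (hQ : Q s) : Runs coin B (.loop e p) s 1 Q := by
  refine ⟨s, _, .loop_neg hv, ?_, hs, hQ⟩
  have := he.cost_le hB hs
  simp only [unitCost]; omega

theorem runs_loop_pos {e : Expr} {p : Cmd} {a b : ℕ} (hB : 2 ≤ B) (hs : s.Bdd B) (he : e.Ok B)
    (hv : 0 < e.eval s)
    (h : Runs coin B p s a fun s' => s'.Bdd B → Agree p s s' → Runs coin B (.loop e p) s' b Q) :
    Runs coin B (.loop e p) s (1 + a + b) Q := by
  obtain ⟨s', t, hx, ht, hb, hq⟩ := h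
  obtain ⟨s'', t', hx', ht', hb', hq'⟩ := hq hb hx.agree
  refine ⟨s'', _, .loop_pos hv hx hx', ?_, hb', hq'⟩
  have := he.cost_le hB hs
  have h1 : e.cost s + 1 ≤ unitCost B := by simp only [unitCost]; omega
  rw [add_mul, add_mul]; omega

/-- The counting loop in which register `r` runs through `0, …, N - 1`, where `N` is the value
of `e`. -/
def forLoop (r : ℕ) (e : Expr) (p : Cmd) : Cmd :=
  .seq (.assign r (.lit 0))
    (.loop (.sub e (.reg r)) (.seq p (.assign r (.add (.reg r) (.lit 1)))))

theorem forLoop_writesReg {r : ℕ} {e : Expr} {p : Cmd} {i : ℕ} :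
    (forLoop r e p).writesReg i = (r == i || (p.writesReg i || r == i)) := rfl

theorem forLoop_writesArr {r : ℕ} {e : Expr} {p : Cmd} {i : ℕ} :
    (forLoop r e p).writesArr i = p.writesArr i := by
  simp [forLoop, Cmd.writesArr]

theorem agree_forLoop_setReg {r : ℕ} {e : Expr} {p : Cmd} {s s' : State} (z : ℤ)
    (h : Agree (forLoop r e p) s s') : Agree (forLoop r e p) s (s'.setReg r z) := by
  refine ⟨fun i hi => ?_, fun a ha => h.2 a ha⟩
  have : i ≠ r := by
    rintro rfl
    simp [forLoop_writesReg] at hi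
  simp [this, h.1 i hi]

/-- The invariant rule for counting loops. -/
theorem runs_forLoop {r : ℕ} {e : Expr} {p : Cmd} {a N : ℕ} (I : ℕ → State → Prop)
    (hB : 2 ≤ B) (hs : s.Bdd B) (he : (Expr.sub e (.reg r)).Ok B)
    (hr : p.writesReg r = false)
    (hN : ∀ s', Agree (forLoop r e p) s s' → e.eval s' = N) (hNB : N ≤ B)
    (h0 : I 0 (s.setReg r 0))
    (hstep : ∀ j < N, ∀ s', s'.Bdd B → Agree (forLoop r e p) s s' → s'.reg r = j → I j s' →
      Runs coin B p s' a fun s'' => s''.Bdd B → Agree p s' s'' →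
        I (j + 1) (s''.setReg r ((j : ℤ) + 1)))
    (hQ : ∀ s', s'.Bdd B → Agree (forLoop r e p) s s' → s'.reg r = N → I N s' → Q s') :
    Runs coin B (forLoop r e p) s (N * (a + 2) + 2) Q := by
  have main : ∀ d j, j + d = N → ∀ s', s'.Bdd B → Agree (forLoop r e p) s s' → s'.reg r = j →
      I j s' → Runs coin B (.loop (.sub e (.reg r)) (.seq p (.assign r (.add (.reg r) (.lit 1)))))
        s' (d * (a + 2) + 1) Q := by
    intro d
    induction d with
    | zero =>
      intro j hj s' hb hag hrj hI
      obtain rfl : j = N := by omega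
      have hz : (0 * (a + 2) + 1) = 1 := by ring
      rw [hz]
      exact runs_loop_neg hB hb he (by simp [Expr.eval, hN s' hag, hrj]) (hQ s' hb hag hrj hI)
    | succ d ih =>
      intro j hj s' hb hag hrj hI
      have hz : ((d + 1) * (a + 2) + 1) = 1 + (a + 1) + (d * (a + 2) + 1) := by ring
      rw [hz]
      refine runs_loop_pos hB hb he (by simp [Expr.eval, hN s' hag, hrj]; omega) ?_
      refine runs_seq ((hstep j (by omega) s' hb hag hrj hI).mono le_rfl ?_)
      intro s₁ hb₁ hag₁ hI₁ _ _
      have hr₁ : s₁.reg r = j := (hag₁.1 r hr).trans hrj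
      have hev : (Expr.add (.reg r) (.lit 1)).eval s₁ = (j : ℤ) + 1 := by simp [Expr.eval, hr₁]
      refine runs_assign hB hb₁ ⟨by simp [Expr.size], by simp [Expr.maxLit]; omega⟩ ?_ ?_
      · rw [hev, abs_of_nonneg (by positivity)]; exact_mod_cast (show j + 1 ≤ B by omega)
      · rw [hev]
        intro hb₂ _
        refine ih (j + 1) (by omega) _ hb₂ ?_ (by simp) (hI₁ hb₁ hag₁)
        refine agree_forLoop_setReg _ (hag.trans (hag₁.mono ?_ ?_))
        · simp +contextual [forLoop_writesReg]
        · simp +contextual [forLoop_writesArr]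
  have hz : N * (a + 2) + 2 = 1 + (N * (a + 2) + 1) := by ring
  rw [hz]
  refine runs_seq (runs_assign hB hs ⟨by simp [Expr.size], by simp [Expr.maxLit]⟩
    (by simp [Expr.eval]) ?_)
  intro hb _
  exact main N 0 (by simp) _ hb (agree_forLoop_setReg _ (Agree.refl _ _))
    (by simp [Expr.eval]) (by simpa [Expr.eval] using h0)

end Rules

end RAM

/-! ### The program: preparations

Registers `0` to `4` hold `n`, `k`, `M`, `2 ^ k` and the number `2 * M * k + 1` of degrees.  Arrays
`0` and `1` hold the adjacency and the weights, with an additional row `n` for a source, array `2`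
the random scalars, array `3` the table, array `4` the forms used for tracing back, and array `5`
the path found. -/

namespace RAM

section Rules

variable {coin : ℕ → Bool} {B : ℕ} {s : State} {Q : State → Prop}

theorem runs_assign_of_eq {i : ℕ} {e : Expr} {z : ℤ} (hB : 2 ≤ B) (hs : s.Bdd B) (he : e.Ok B)
    (hz : e.eval s = z) (hv : |z| ≤ B) (hQ : Q (s.setReg i z)) :
    Runs coin B (.assign i e) s 1 Q := by
  subst hz
  exact runs_assign hB hs he hv hQ

theorem runs_assign_seq {i : ℕ} {e : Expr} {z : ℤ} {q : Cmd} {b : ℕ} (hB : 2 ≤ B) (hs : s.Bdd B)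
    (he : e.Ok B) (hz : e.eval s = z) (hv : |z| ≤ B)
    (h : (s.setReg i z).Bdd B → Runs coin B q (s.setReg i z) b Q) :
    Runs coin B (.seq (.assign i e) q) s (b + 1) Q := by
  rw [add_comm]
  exact runs_seq (runs_assign_of_eq hB hs he hz hv fun hb _ => h hb)

theorem runs_write_of_eq {a m : ℕ} {e₁ e₂ : Expr} {z : ℤ} (hB : 2 ≤ B) (hs : s.Bdd B)
    (he₁ : e₁.Ok B) (he₂ : e₂.Ok B) (hm : e₁.eval s = m) (hz : e₂.eval s = z) (hv : |z| ≤ B)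
    (hQ : Q (s.setArr a m z)) : Runs coin B (.write a e₁ e₂) s 1 Q := by
  subst hz
  refine runs_write hB hs he₁ he₂ hv ?_
  rw [hm, Int.toNat_natCast]
  exact hQ

theorem abs_natCast_le {a B : ℕ} (h : a ≤ B) : |(a : ℤ)| ≤ B := by
  rw [Nat.abs_cast]
  exact_mod_cast h

end Rules

/-- `2 ^ k` in register `3` and `2 * M * k + 1` in register `4`. -/
def sizesProg : Cmd :=
  .seq (.assign 3 (.lit 1)) <| .seq (forLoop 7 (.reg 1) (.assign 3 (.mul (.reg 3) (.lit 2)))) <|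
    .assign 4 (.add (.mul (.mul (.lit 2) (.reg 2)) (.reg 1)) (.lit 1))

/-- The length in bits of `k * n ^ c` in register `6`. -/
def bitsProg (c : ℕ) : Cmd :=
  .seq (.assign 5 (.reg 1)) <|
  .seq (forLoop 7 (.lit c) (.assign 5 (.mul (.reg 5) (.reg 0)))) <|
  .seq (.assign 6 (.lit 0)) <|
    .loop (.reg 5) (.seq (.assign 6 (.add (.reg 6) (.lit 1))) (.assign 5 (.div (.reg 5) (.lit 2))))

/-- Random numbers with as many bits as register `6` tells in the cells `0, …, k * (n + 1) - 1` of
array `2`. -/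
def tossProg : Cmd :=
  forLoop 7 (.mul (.reg 1) (.add (.reg 0) (.lit 1))) <|
    .seq (.assign 8 (.lit 0)) <|
    .seq (forLoop 9 (.reg 6)
      (.seq (.toss 10) (.assign 8 (.add (.mul (.lit 2) (.reg 8)) (.reg 10)))))
      (.write 2 (.reg 7) (.reg 8))

/-- The edges of weight `-M` from the source. -/
def sourceProg : Cmd :=
  forLoop 7 (.reg 0) <|
    .seq (.write 0 (.add (.mul (.reg 0) (.reg 0)) (.reg 7)) (.lit 1))
      (.write 1 (.add (.mul (.reg 0) (.reg 0)) (.reg 7)) (.sub (.lit 0) (.reg 2)))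

/-- The number with the binary digits `f 0, …, f (t - 1)`, the most significant one first. -/
def binVal (f : ℕ → Bool) : ℕ → ℤ
  | 0 => 0
  | t + 1 => 2 * binVal f t + if f t then 1 else 0

theorem binVal_nonneg_lt (f : ℕ → Bool) (t : ℕ) : 0 ≤ binVal f t ∧ binVal f t < 2 ^ t := by
  induction t with
  | zero => simp [binVal]
  | succ t ih =>
    rw [binVal, pow_succ]
    split_ifs <;> omega

theorem binVal_inj {f g : ℕ → Bool} {t : ℕ} (h : binVal f t = binVal g t) :
    ∀ b < t, f b = g b := by
  induction t with
  | zero => simp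
  | succ t ih =>
    rw [binVal, binVal] at h
    have h1 : binVal f t = binVal g t := by split_ifs at h <;> omega
    have h2 : f t = g t := by
      rw [h1] at h
      cases hf : f t <;> cases hg : g t <;> simp [hf, hg] at h ⊢
    intro b hb
    rcases Nat.lt_succ_iff_lt_or_eq.1 hb with hb | rfl
    · exact ih h1 b hb
    · exact h2

section Preparations

variable {coin : ℕ → Bool} {B : ℕ} {s : State} {n k M c : ℕ}

theorem runs_sizesProg (hB : 2 ≤ B) (hs : s.Bdd B) (h1 : s.reg 1 = k) (h2 : s.reg 2 = M)
    (hkB : k ≤ B) (hPB : 2 ^ k ≤ B) (hWB : 2 * M * k + 1 ≤ B) :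
    Runs coin B sizesProg s (3 * k + 4) fun s' =>
      s'.reg 3 = ((2 ^ k : ℕ) : ℤ) ∧ s'.reg 4 = ((2 * M * k + 1 : ℕ) : ℤ) := by
  refine Runs.mono (a := k * (1 + 2) + 2 + 1 + 1) ?_ (by omega) fun _ _ _ h => h
  refine runs_assign_seq (z := 1) hB hs ⟨by decide, by simp [Expr.maxLit]; omega⟩ rfl
    (by simp; omega) fun hb => ?_
  refine runs_seq (b := 1) (runs_forLoop (a := 1) (N := k)
    (fun j s' => s'.reg 3 = ((2 ^ j : ℕ) : ℤ)) hB hb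
    ⟨by decide, by simp [Expr.maxLit]⟩ rfl ?_ hkB (by simp) ?_ ?_)
  · intro s' h
    simp [Expr.eval, h.1 1 rfl, h1]
  · intro j hj s' hb' _ _ hI
    refine runs_assign_of_eq (z := ((2 ^ (j + 1) : ℕ) : ℤ)) hB hb'
      ⟨by decide, by simp [Expr.maxLit]; omega⟩ ?_ (abs_natCast_le ?_) ?_
    · simp only [Expr.eval, hI]; push_cast; ring
    · exact (Nat.pow_le_pow_right (by omega) hj).trans hPB
    · simp
  · intro s' hb' hag _ hI _ _
    refine runs_assign_of_eq (z := ((2 * M * k + 1 : ℕ) : ℤ)) hB hb'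
      ⟨by decide, by simp [Expr.maxLit]; omega⟩ ?_ (abs_natCast_le hWB) ?_
    · simp [Expr.eval, hag.1 1 rfl, hag.1 2 rfl, h1, h2]
    · simpa using hI

theorem runs_bitsProg (hB : 2 ≤ B) (hs : s.Bdd B) (h0 : s.reg 0 = n) (h1 : s.reg 1 = k)
    (hn : 1 ≤ n) (hcB : c ≤ B) (hXB : k * n ^ c ≤ B) (htB : Nat.size (k * n ^ c) ≤ B) :
    Runs coin B (bitsProg c) s (3 * c + 3 * Nat.size (k * n ^ c) + 6) fun s' =>
      s'.reg 6 = (Nat.size (k * n ^ c) : ℤ) := by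
  refine Runs.mono (a := c * (1 + 2) + 2 + (3 * Nat.size (k * n ^ c) + 1 + 1) + 1) ?_
    (by omega) fun _ _ _ h => h
  have hmono : ∀ j ≤ c, k * n ^ j ≤ B := fun j hj =>
    (Nat.mul_le_mul_left k (Nat.pow_le_pow_right hn hj)).trans hXB
  refine runs_assign_seq (z := ((k * n ^ 0 : ℕ) : ℤ)) hB hs ⟨by simp [Expr.size],
    by simp [Expr.maxLit]⟩ (by simp [Expr.eval, h1]) (abs_natCast_le (hmono 0 (by omega)))
    fun hb => ?_
  refine runs_seq (runs_forLoop (N := c) (fun j s' => s'.reg 5 = ((k * n ^ j : ℕ) : ℤ)) hB hb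
    ⟨by simp [Expr.size], by simpa [Expr.maxLit] using hcB⟩ rfl ?_ hcB (by simp) ?_ ?_)
  · intro s' _
    simp [Expr.eval]
  · intro j hj s' hb' hag _ hI
    refine runs_assign_of_eq (z := ((k * n ^ (j + 1) : ℕ) : ℤ)) hB hb'
      ⟨by decide, by simp [Expr.maxLit]⟩ ?_ (abs_natCast_le (hmono _ hj)) ?_
    · have : s'.reg 0 = n := (hag.1 0 (by simp [forLoop_writesReg, Cmd.writesReg])).trans
        (by simpa using h0)
      simp only [Expr.eval, hI, this]; push_cast; ring
    · simp
  · intro s₁ hb₁ hag₁ _ hI₁ _ _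
    refine runs_assign_seq (z := 0) hB hb₁ ⟨by decide, by simp [Expr.maxLit]⟩ rfl (by simp)
      fun hb₂ => ?_
    have main : ∀ x a : ℕ, a + Nat.size x ≤ B → ∀ s' : State, s'.Bdd B → s'.reg 5 = x →
        s'.reg 6 = a → Runs coin B (.loop (.reg 5) (.seq (.assign 6 (.add (.reg 6) (.lit 1)))
          (.assign 5 (.div (.reg 5) (.lit 2))))) s' (3 * Nat.size x + 1)
          fun s'' => s''.reg 6 = ((a + Nat.size x : ℕ) : ℤ) := by
      intro x
      induction x using Nat.strong_induction_on with
      | _ x ih =>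
        intro a ha s' hb' h5 h6
        rcases Nat.eq_zero_or_pos x with rfl | hx
        · refine (runs_loop_neg hB hb' ⟨by decide, by simp [Expr.maxLit]⟩
            (by simp [Expr.eval, h5]) ?_).mono (by simp) fun _ _ _ h => h
          simpa using h6
        · have hsz : Nat.size x = Nat.size (x / 2) + 1 := by
            have h := Nat.size_bit (b := x.bodd) (n := x.div2) (by rw [Nat.bit_bodd_div2]; omega)
            rwa [Nat.bit_bodd_div2, Nat.div2_val] at h
          have hxB : (x : ℤ) ≤ B := by
            have := hb'.1 5
            rwa [h5, Nat.abs_cast] at this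
          refine Runs.mono (a := 1 + (1 + 1) + (3 * Nat.size (x / 2) + 1)) ?_ (by omega)
            fun _ _ _ h => h
          refine runs_loop_pos hB hb' ⟨by decide, by simp [Expr.maxLit]⟩
            (by simp [Expr.eval, h5, hx]) ?_
          refine runs_assign_seq (z := ((a + 1 : ℕ) : ℤ)) hB hb'
            ⟨by decide, by simp [Expr.maxLit]; omega⟩ (by simp [Expr.eval, h6])
            (abs_natCast_le (by omega)) fun hb₁ => ?_
          refine runs_assign_of_eq (z := ((x / 2 : ℕ) : ℤ)) hB hb₁
            ⟨by decide, by simp [Expr.maxLit]; omega⟩ (by simp [Expr.eval, h5])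
            (abs_natCast_le (by omega)) ?_
          intro hb₂ _
          refine (ih (x / 2) (by omega) (a + 1) (by omega) _ hb₂ (by simp) (by simp)).mono le_rfl
            fun s'' _ _ h => ?_
          rw [h, hsz]
          push_cast
          ring
    have := main (k * n ^ c) 0 (by simpa using htB) _ hb₂ (by simpa using hI₁) (by simp)
    simpa using this

theorem runs_tossProg {t : ℕ} (hB : 2 ≤ B) (hs : s.Bdd B) (h0 : s.reg 0 = n) (h1 : s.reg 1 = k)
    (h6 : s.reg 6 = t) (hNB : k * (n + 1) ≤ B) (htB : 2 ^ t ≤ B) (ht0 : s.tossed = 0)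
    (ha : ∀ m, s.arr 2 m = 0) :
    Runs coin B tossProg s (k * (n + 1) * (3 * t * 2 + 6) + 2) fun s' =>
      ∀ m, s'.arr 2 m = if m < k * (n + 1) then binVal (fun b => coin (m * t + b)) t else 0 := by
  have htB' : t ≤ B := (Nat.lt_two_pow_self.le).trans htB
  refine Runs.mono (a := k * (n + 1) * (t * ((1 + 1) + 2) + 2 + 1 + 1 + 2) + 2) ?_ ?_
    fun _ _ _ h => h
  swap
  · have : k * (n + 1) * (t * ((1 + 1) + 2) + 2 + 1 + 1 + 2) ≤
        k * (n + 1) * (3 * t * 2 + 6) := Nat.mul_le_mul_left _ (by omega)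
    omega
  refine runs_forLoop (N := k * (n + 1)) (fun j s' => s'.tossed = j * t ∧ ∀ m, s'.arr 2 m =
    if m < j then binVal (fun b => coin (m * t + b)) t else 0) hB hs
    ⟨by decide, by simp [Expr.maxLit]; omega⟩ rfl ?_ hNB ?_ ?_ ?_
  · intro s' h
    simp [Expr.eval, h.1 0 rfl, h.1 1 rfl, h0, h1]
  · simp [ht0, ha]
  · intro j hj s' hb hag h7 hI
    have hag6 : s'.reg 6 = t := (hag.1 6 rfl).trans h6
    refine runs_assign_seq (z := 0) hB hb ⟨by decide, by simp [Expr.maxLit]⟩ rfl (by simp)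
      fun hb₁ => ?_
    refine runs_seq (b := 1) (runs_forLoop (a := 1 + 1) (N := t)
      (fun b s'' => s''.tossed = j * t + b ∧
      s''.reg 8 = binVal (fun b => coin (j * t + b)) b) hB hb₁ ⟨by decide, by simp [Expr.maxLit]⟩
      rfl ?_ htB' ?_ ?_ ?_)
    · intro s'' h
      simp [Expr.eval, h.1 6 rfl, hag6]
    · simp [binVal, hI.1]
    · intro b hbt s₂ hb₂ hag₂ _ hI₂
      refine runs_seq (runs_toss hB hb₂ ?_)
      intro hb₃ _
      have hv := binVal_nonneg_lt (fun b => coin (j * t + b)) (b + 1)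
      refine runs_assign_of_eq (z := binVal (fun b => coin (j * t + b)) (b + 1)) hB hb₃
        ⟨by decide, by simp [Expr.maxLit]; omega⟩ ?_ ?_ ?_
      · show 2 * (s₂.setReg 10 (if coin s₂.tossed then 1 else 0)).reg 8 +
          (s₂.setReg 10 (if coin s₂.tossed then 1 else 0)).reg 10 = _
        simp [hI₂.2, hI₂.1, binVal]
      · rw [abs_of_nonneg hv.1]
        refine hv.2.le.trans ?_
        exact_mod_cast (Nat.pow_le_pow_right (by omega) hbt).trans htB
      · intro _ _
        refine ⟨?_, by simp⟩
        show s₂.tossed + 1 = _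
        rw [hI₂.1]; ring
    · intro s₂ hb₂ hag₂ _ hI₂ _ _
      have h7' : s₂.reg 7 = j := (hag₂.1 7 rfl).trans (by simpa using h7)
      have hv := binVal_nonneg_lt (fun b => coin (j * t + b)) t
      refine runs_write_of_eq (m := j) (z := binVal (fun b => coin (j * t + b)) t) hB hb₂
        ⟨by decide, by simp [Expr.maxLit]⟩ ⟨by decide, by simp [Expr.maxLit]⟩ h7' hI₂.2 ?_ ?_
      · rw [abs_of_nonneg hv.1]
        exact hv.2.le.trans (by exact_mod_cast htB)
      · intro _ _
        refine ⟨?_, fun m => ?_⟩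
        · show s₂.tossed = _
          rw [hI₂.1]; ring
        · have ha2 : s₂.arr 2 m = s'.arr 2 m := congrFun (hag₂.2 2 rfl) m
          simp only [State.setReg_arr, State.setArr_arr, ha2, hI.2]
          rcases lt_trichotomy m j with h | rfl | h
          · simp [h, h.ne, show m < j + 1 by omega]
          · simp
          · simp [h.ne', show ¬ m < j by omega, show ¬ m < j + 1 by omega]
  · intro s' _ _ _ hI
    exact hI.2

theorem runs_sourceProg (hB : 2 ≤ B) (hs : s.Bdd B) (h0 : s.reg 0 = n) (h2 : s.reg 2 = M)
    (hnB : n ≤ B) (hMB : M ≤ B) :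
    Runs coin B sourceProg s (4 * n + 2) fun s' =>
      (∀ m, s'.arr 0 m = if n * n ≤ m ∧ m < n * n + n then 1 else s.arr 0 m) ∧
      ∀ m, s'.arr 1 m = if n * n ≤ m ∧ m < n * n + n then -(M : ℤ) else s.arr 1 m := by
  refine Runs.mono (a := n * (1 + 1 + 2) + 2) ?_ (by omega) fun _ _ _ h => h
  refine runs_forLoop (N := n) (fun j s' =>
      (∀ m, s'.arr 0 m = if n * n ≤ m ∧ m < n * n + j then 1 else s.arr 0 m) ∧
      ∀ m, s'.arr 1 m = if n * n ≤ m ∧ m < n * n + j then -(M : ℤ) else s.arr 1 m) hB hs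
    ⟨by decide, by simp [Expr.maxLit]⟩ rfl ?_ hnB ?_ ?_ ?_
  · intro s' h
    simp [Expr.eval, h.1 0 rfl, h0]
  · constructor <;> intro m <;> rw [if_neg (by omega)] <;> simp
  · intro j hj s' hb hag h7 hI
    have hr0 : s'.reg 0 = n := (hag.1 0 rfl).trans h0
    have hr2 : s'.reg 2 = M := (hag.1 2 rfl).trans h2
    refine runs_seq (runs_write_of_eq (m := n * n + j) (z := 1) hB hb ⟨by decide, by
      simp [Expr.maxLit]⟩ ⟨by decide, by simp [Expr.maxLit]; omega⟩ (by simp [Expr.eval, hr0, h7])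
      rfl (by simp; omega) ?_)
    intro hb₁ _
    refine runs_write_of_eq (m := n * n + j) (z := -(M : ℤ)) hB hb₁ ⟨by decide, by
      simp [Expr.maxLit]⟩ ⟨by decide, by simp [Expr.maxLit]⟩ (by simp [Expr.eval, hr0, h7])
      (by simp [Expr.eval, hr2]) (by rw [abs_neg]; exact abs_natCast_le hMB) ?_
    intro _ _
    constructor <;> intro m
    · simp only [State.setReg_arr, State.setArr_arr, hI.1, true_and, zero_ne_one, false_and,
        if_false]
      split_ifs <;> first | rfl | omega
    · simp only [State.setReg_arr, State.setArr_arr, hI.2, true_and, one_ne_zero, false_and,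
        if_false]
      split_ifs <;> first | rfl | omega
  · intro s' _ _ _ hI
    exact hI

end Preparations

end RAM

/-! ### The program: filling the table -/

namespace RAM

open KPath

/-- The cell of array `3` that holds the entry `c, v, S, e` of the table. -/
def cellIdx (k n M c v S e : ℕ) : ℕ := ((c * (n + 1) + v) * 2 ^ k + S) * (2 * M * k + 1) + e

/-- The content of a cell of array `3`. -/
def flatTable (k n M : ℕ) (adj wt y : ℕ → ℕ → ℤ) (m : ℕ) : ℤ :=
  table k n M adj wt y (m / (2 * M * k + 1) / 2 ^ k / (n + 1))
    (m / (2 * M * k + 1) / 2 ^ k % (n + 1)) (m / (2 * M * k + 1) % 2 ^ k) (m % (2 * M * k + 1))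

theorem flatTable_cellIdx {k n M c v S e : ℕ} {adj wt y : ℕ → ℕ → ℤ} (hv : v < n + 1)
    (hS : S < 2 ^ k) (he : e < 2 * M * k + 1) :
    flatTable k n M adj wt y (cellIdx k n M c v S e) = table k n M adj wt y c v S e := by
  have h1 : cellIdx k n M c v S e / (2 * M * k + 1) = (c * (n + 1) + v) * 2 ^ k + S := by
    rw [cellIdx, add_comm, Nat.add_mul_div_right _ _ (by omega), Nat.div_eq_of_lt he, zero_add]
  have h2 : cellIdx k n M c v S e % (2 * M * k + 1) = e := by
    rw [cellIdx, add_comm, Nat.add_mul_mod_self_right, Nat.mod_eq_of_lt he]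
  have h3 : ((c * (n + 1) + v) * 2 ^ k + S) / 2 ^ k = c * (n + 1) + v := by
    rw [add_comm, Nat.add_mul_div_right _ _ (by positivity), Nat.div_eq_of_lt hS, zero_add]
  have h4 : ((c * (n + 1) + v) * 2 ^ k + S) % 2 ^ k = S := by
    rw [add_comm, Nat.add_mul_mod_self_right, Nat.mod_eq_of_lt hS]
  have h5 : (c * (n + 1) + v) / (n + 1) = c := by
    rw [add_comm, Nat.add_mul_div_right _ _ (by omega), Nat.div_eq_of_lt hv, zero_add]
  have h6 : (c * (n + 1) + v) % (n + 1) = v := by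
    rw [add_comm, Nat.add_mul_mod_self_right, Nat.mod_eq_of_lt hv]
  rw [flatTable, h1, h2, h3, h4, h5, h6]

theorem cellIdx_lt {k n M c v S e : ℕ} (hv : v < n + 1) (hS : S < 2 ^ k)
    (he : e < 2 * M * k + 1) :
    cellIdx k n M c v S e < (c + 1) * ((n + 1) * 2 ^ k * (2 * M * k + 1)) := by
  have h1 : c * (n + 1) + v + 1 ≤ (c + 1) * (n + 1) := by rw [add_mul c 1]; omega
  have h2 : (c * (n + 1) + v) * 2 ^ k + S + 1 ≤ (c + 1) * (n + 1) * 2 ^ k := by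
    have := Nat.mul_le_mul_right (2 ^ k) h1
    rw [add_mul _ 1] at this
    omega
  have h3 := Nat.mul_le_mul_right (2 * M * k + 1) h2
  rw [add_mul _ 1] at h3
  calc cellIdx k n M c v S e < ((c + 1) * (n + 1) * 2 ^ k) * (2 * M * k + 1) := by
        unfold cellIdx; omega
    _ = _ := by ring

/-- The adjacency function stored in array `0`, in rows of length `n`; row `n` belongs to the
source. -/
def State.adj (n : ℕ) (s : State) (u v : ℕ) : ℤ := s.arr 0 (u * n + v)

/-- The weight function stored in array `1`. -/
def State.wt (n : ℕ) (s : State) (u v : ℕ) : ℤ := s.arr 1 (u * n + v)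

/-- The scalar `y p v` of the vertex `v` at position `p`, stored in array `2` in rows of length
`n + 1`. -/
def State.scalar (n : ℕ) (s : State) (p v : ℕ) : ℤ := s.arr 2 (p * (n + 1) + v)

/-- The entries of the table for the data stored in a memory. -/
def State.tab (k n M : ℕ) (s : State) : ℕ → ℕ → ℕ → ℕ → ℤ :=
  table k n M (s.adj n) (s.wt n) (s.scalar n)

/-- The memory `s` is prepared for the instance `G, k, M`, and `B` bounds all numbers that occur.
The entries of layer `c` of the table are bounded by `D ^ c`. -/
structure Ready {n : ℕ} (G : WeightedDigraph n) (k M B D : ℕ) (s : State) : Prop where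
  n_pos : 1 ≤ n
  k_pos : 1 ≤ k
  reg0 : s.reg 0 = n
  reg1 : s.reg 1 = k
  reg2 : s.reg 2 = M
  reg3 : s.reg 3 = ((2 ^ k : ℕ) : ℤ)
  reg4 : s.reg 4 = ((2 * M * k + 1 : ℕ) : ℤ)
  encodes : Encodes G M (s.adj n) (s.wt n)
  weights : G.WeightsIn M
  le_D : (n + 1) * (k * n ^ k) ≤ D
  tab_le : ∀ c v S e, |s.tab k n M c v S e| ≤ (D : ℤ) ^ c
  cells_le : (k + 1) * ((n + 1) * 2 ^ k * (2 * M * k + 1)) ≤ B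
  values_le : 2 ^ k * (D ^ k * D ^ k) ≤ B
  two_le : 2 ≤ B

section ReadyLemmas

variable {n : ℕ} {G : WeightedDigraph n} {k M B D : ℕ} {s s' : State}

theorem Ready.congr (h : Ready G k M B D s) (hr : ∀ i < 5, s'.reg i = s.reg i)
    (ha : ∀ a < 3, s'.arr a = s.arr a) : Ready G k M B D s' := by
  have h1 : s'.adj n = s.adj n := by funext u v; simp only [State.adj, ha 0 (by omega)]
  have h2 : s'.wt n = s.wt n := by funext u v; simp only [State.wt, ha 1 (by omega)]
  have h3 : s'.scalar n = s.scalar n := by funext u v; simp only [State.scalar, ha 2 (by omega)]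
  exact ⟨h.n_pos, h.k_pos, (hr 0 (by omega)).trans h.reg0, (hr 1 (by omega)).trans h.reg1,
    (hr 2 (by omega)).trans h.reg2, (hr 3 (by omega)).trans h.reg3, (hr 4 (by omega)).trans h.reg4,
    by rw [h1, h2]; exact h.encodes, h.weights, h.le_D,
    by rw [State.tab, h1, h2, h3]; exact h.tab_le, h.cells_le, h.values_le, h.two_le⟩

theorem tab_congr (ha : ∀ a < 3, s'.arr a = s.arr a) : s'.tab k n M = s.tab k n M := by
  have h1 : s'.adj n = s.adj n := by funext u v; simp only [State.adj, ha 0 (by omega)]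
  have h2 : s'.wt n = s.wt n := by funext u v; simp only [State.wt, ha 1 (by omega)]
  have h3 : s'.scalar n = s.scalar n := by funext u v; simp only [State.scalar, ha 2 (by omega)]
  rw [State.tab, State.tab, h1, h2, h3]

theorem Ready.one_le_D (h : Ready G k M B D s) : 1 ≤ D := by
  refine le_trans ?_ h.le_D
  have h1 : 0 < n := h.n_pos
  have h2 : 0 < k := h.k_pos
  show 0 < _
  positivity

theorem Ready.pow_D_le (h : Ready G k M B D s) {c : ℕ} (hc : c ≤ k) : D ^ c ≤ B := by
  have h1 := h.one_le_D
  calc D ^ c ≤ D ^ k := Nat.pow_le_pow_right h1 hc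
    _ ≤ 2 ^ k * (D ^ k * D ^ k) := by
      have h2 : 1 ≤ 2 ^ k := Nat.one_le_two_pow
      have h3 : 1 ≤ D ^ k := Nat.one_le_pow _ _ h1
      nlinarith
    _ ≤ B := h.values_le

theorem Ready.pow_n_le (h : Ready G k M B D s) : n ^ k ≤ B := by
  have h1 : D ^ 1 ≤ B := h.pow_D_le h.k_pos
  rw [pow_one] at h1
  have h2 := h.le_D
  have h3 : n ^ k ≤ k * n ^ k := Nat.le_mul_of_pos_left _ h.k_pos
  have h4 : k * n ^ k ≤ (n + 1) * (k * n ^ k) := Nat.le_mul_of_pos_left _ (by omega)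
  omega

theorem Ready.two_pow_le (h : Ready G k M B D s) : 2 ^ k ≤ B := by
  refine le_trans ?_ h.values_le
  have h1 : 1 ≤ D ^ k := Nat.one_le_pow _ _ h.one_le_D
  exact Nat.le_mul_of_pos_right _ (by positivity)

theorem bounds_of_cells_le (hk : 1 ≤ k)
    (h3 : (k + 1) * ((n + 1) * 2 ^ k * (2 * M * k + 1)) ≤ B) :
    n + 1 ≤ B ∧ k + 1 ≤ B ∧ 2 * M * k + 1 ≤ B ∧ (k + 1) * (n + 1) ≤ B ∧ M ≤ B := by
  have h1 : 0 < 2 ^ k := by positivity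
  have h2 : 0 < 2 * M * k + 1 := by omega
  have h4 : (k + 1) * (n + 1) ≤ B := by
    refine le_trans ?_ h3
    rw [← mul_assoc, ← mul_assoc, mul_assoc]
    exact Nat.le_mul_of_pos_right _ (by positivity)
  have h5 : 2 * M * k + 1 ≤ B := by
    refine le_trans ?_ h3
    rw [← mul_assoc]
    exact Nat.le_mul_of_pos_left _ (by positivity)
  have h6 : n + 1 ≤ (k + 1) * (n + 1) := Nat.le_mul_of_pos_left _ (by omega)
  have h7 : k + 1 ≤ (k + 1) * (n + 1) := Nat.le_mul_of_pos_right _ (by omega)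
  have h8 : M * 1 ≤ M * k := Nat.mul_le_mul_left M hk
  have h9 : 2 * M * k = 2 * (M * k) := by ring
  exact ⟨by omega, by omega, h5, h4, by omega⟩

theorem Ready.bounds (h : Ready G k M B D s) :
    n + 1 ≤ B ∧ k + 1 ≤ B ∧ 2 * M * k + 1 ≤ B ∧ (k + 1) * (n + 1) ≤ B ∧ M ≤ B :=
  bounds_of_cells_le h.k_pos h.cells_le

theorem Ready.sum_bound (h : Ready G k M B D s) {c : ℕ} (hc : c < k) :
    (n + 1) * (k * (n ^ k * D ^ c)) ≤ B := by
  refine le_trans ?_ (h.pow_D_le (c := c + 1) hc)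
  calc (n + 1) * (k * (n ^ k * D ^ c)) = (n + 1) * (k * n ^ k) * D ^ c := by ring
    _ ≤ D * D ^ c := Nat.mul_le_mul_right _ h.le_D
    _ = D ^ (c + 1) := by rw [pow_succ]; ring

end ReadyLemmas

/-- The last binary digit of register `rem` goes to register `bit`. -/
def bitCmd (rem bit : ℕ) : Cmd :=
  .assign bit (.sub (.reg rem) (.mul (.lit 2) (.div (.reg rem) (.lit 2))))

/-- The address of the entry of a predecessor `u` of `v`, with the current digit removed from the
mask. -/
def predAddr : Expr :=
  .add (.mul (.add (.mul (.add (.mul (.sub (.reg 13) (.lit 1)) (.add (.reg 0) (.lit 1))) (.reg 16))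
    (.reg 3)) (.sub (.reg 12) (.mul (.reg 21) (.reg 18)))) (.reg 4))
    (.sub (.sub (.reg 10) (.read 1 (.add (.mul (.reg 16) (.reg 0)) (.reg 14)))) (.reg 2))

/-- Register `15` plus the summand of the predecessor `u` and the current digit. -/
def accExpr : Expr :=
  .add (.reg 15) (.mul (.read 0 (.add (.mul (.reg 16) (.reg 0)) (.reg 14)))
    (.mul (.mul (.reg 21) (.reg 19)) (.read 3 predAddr)))

/-- Adds the contribution of the predecessor `u` to register `15`.  Registers `10`, `12`, `13`, `14`
hold the degree, the mask, the position and the vertex `v`, register `16` holds `u`; for the digit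
`i`, register `17` holds the mask without its lower digits, register `18` holds `2 ^ i`, and
register `19` holds `v ^ i` with the sign of the digit. -/
def digitLoop : Cmd :=
  forLoop 20 (.reg 1) <|
    .seq (bitCmd 17 21) <|
    .seq (.assign 15 accExpr) <|
    .seq (.assign 19 (.mul (.mul (.reg 19) (.reg 14)) (.sub (.lit 1) (.mul (.lit 2) (.reg 21))))) <|
    .seq (.assign 17 (.div (.reg 17) (.lit 2))) (.assign 18 (.mul (.reg 18) (.lit 2)))

/-- Computes the sum over all predecessors in register `15`. -/
def predLoop : Cmd :=
  .seq (.assign 15 (.lit 0)) <|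
  forLoop 16 (.add (.reg 0) (.lit 1)) <|
    .seq (.assign 17 (.reg 12)) <| .seq (.assign 18 (.lit 1)) <|
    .seq (.assign 19 (.lit 1)) digitLoop

section Digits

theorem bit_eq_sub (S i : ℕ) :
    ((S / 2 ^ i : ℕ) : ℤ) - 2 * (((S / 2 ^ i : ℕ) : ℤ) / 2) = (bit S i : ℤ) := by
  unfold KPath.bit
  omega

theorem abs_sgn_mul_pow_le {n k v i S : ℕ} (hv : v < n) (hi : i ≤ k) :
    |sgn S i * (v : ℤ) ^ i| ≤ ((n ^ k : ℕ) : ℤ) := by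
  rw [abs_mul, abs_sgn, one_mul, abs_of_nonneg (by positivity)]
  exact_mod_cast (Nat.pow_le_pow_left hv.le i).trans (Nat.pow_le_pow_right (by omega) hi)

variable {coin : ℕ → Bool} {n : ℕ} {G : WeightedDigraph n} {k M B D : ℕ} {s : State}

theorem accExpr_ok (hB : 2 ≤ B) : accExpr.Ok B :=
  Expr.ok_of_size_of_maxLit hB (by simp [Expr.size, accExpr, predAddr])
    (by simp [Expr.maxLit, accExpr, predAddr])

theorem runs_digitLoop (hR : Ready G k M B D s) (hs : s.Bdd B) {c v S e u : ℕ}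
    (hc : c < k) (hv : v < n) (hS : S < 2 ^ k) (he : e < 2 * M * k + 1) (he' : 2 * M ≤ e)
    (hu : u < n + 1) {cur : ℕ} (hcur : (c + 1) * ((n + 1) * 2 ^ k * (2 * M * k + 1)) ≤ cur)
    (h3 : ∀ m, s.arr 3 m =
      if m < cur then flatTable k n M (s.adj n) (s.wt n) (s.scalar n) m else 0)
    {a : ℤ} (ha : |a| ≤ u * (k * ((n : ℤ) ^ k * (D : ℤ) ^ c)))
    (h10 : s.reg 10 = e) (h12 : s.reg 12 = S) (h13 : s.reg 13 = ((c + 1 : ℕ) : ℤ))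
    (h14 : s.reg 14 = v) (h15 : s.reg 15 = a) (h16 : s.reg 16 = u) (h17 : s.reg 17 = S)
    (h18 : s.reg 18 = 1) (h19 : s.reg 19 = 1) :
    Runs coin B digitLoop s (k * 7 + 2) fun s' => s'.reg 15 = a + s.adj n u v *
      wedge k (vertexVec v)
        (fun S' => s.tab k n M c u S' ((e : ℤ) - s.wt n u v - M).toNat) S := by
  have hB := hR.two_le
  let T : ℕ → ℤ := fun i => s.adj n u v * ((bit S i : ℤ) * sgn S i * vertexVec v i *
    s.tab k n M c u (S - bit S i * 2 ^ i) ((e : ℤ) - s.wt n u v - M).toNat)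
  have hT : ∀ i < k, |T i| ≤ (n : ℤ) ^ k * (D : ℤ) ^ c := fun i hi =>
    abs_wedge_term_le hv hi (hR.encodes.abs_adj_le (by omega) hv) (hR.tab_le _ _ _ _)
  have hsumT : ∀ i ≤ k, |a + ∑ i' ∈ Finset.range i, T i'| ≤ B := by
    intro i hi
    have h1 : |∑ i' ∈ Finset.range i, T i'| ≤ k * ((n : ℤ) ^ k * (D : ℤ) ^ c) := by
      refine (Finset.abs_sum_le_sum_abs _ _).trans ?_
      calc _ ≤ ∑ i' ∈ Finset.range i, (n : ℤ) ^ k * (D : ℤ) ^ c :=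
            Finset.sum_le_sum fun i' hi' => hT i' (by simp at hi'; omega)
        _ = i * ((n : ℤ) ^ k * (D : ℤ) ^ c) := by simp
        _ ≤ _ := by gcongr
    have h2 : ((u : ℤ) + 1) * (k * ((n : ℤ) ^ k * (D : ℤ) ^ c)) ≤
        ((n : ℤ) + 1) * (k * ((n : ℤ) ^ k * (D : ℤ) ^ c)) := by gcongr; omega
    have h3 : ((n : ℤ) + 1) * (k * ((n : ℤ) ^ k * (D : ℤ) ^ c)) ≤ B := by
      exact_mod_cast hR.sum_bound hc
    calc _ ≤ |a| + |∑ i' ∈ Finset.range i, T i'| := abs_add_le _ _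
      _ ≤ _ := by linarith
  refine Runs.mono (a := k * (5 + 2) + 2) ?_ le_rfl fun _ _ _ h => h
  refine runs_forLoop (a := 5) (N := k) (fun i s' => s'.reg 15 = a + ∑ i' ∈ Finset.range i, T i' ∧
    s'.reg 17 = ((S / 2 ^ i : ℕ) : ℤ) ∧ s'.reg 18 = ((2 ^ i : ℕ) : ℤ) ∧
    s'.reg 19 = sgn S i * (v : ℤ) ^ i) hB hs ⟨by decide, by simp [Expr.maxLit]⟩ rfl ?_
    (by have := hR.bounds; omega) ?_ ?_ ?_
  · intro s' h
    simp [Expr.eval, h.1 1 rfl, hR.reg1]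
  · simp [h15, h17, h18, h19, sgn]
  · rintro i hi s' hb hag - ⟨i15, i17, i18, i19⟩
    have r0 : s'.reg 0 = n := (hag.1 0 rfl).trans hR.reg0
    have r2 : s'.reg 2 = M := (hag.1 2 rfl).trans hR.reg2
    have r3 : s'.reg 3 = ((2 ^ k : ℕ) : ℤ) := (hag.1 3 rfl).trans hR.reg3
    have r4 : s'.reg 4 = ((2 * M * k + 1 : ℕ) : ℤ) := (hag.1 4 rfl).trans hR.reg4
    have r10 : s'.reg 10 = e := (hag.1 10 rfl).trans h10
    have r12 : s'.reg 12 = S := (hag.1 12 rfl).trans h12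
    have r13 : s'.reg 13 = ((c + 1 : ℕ) : ℤ) := (hag.1 13 rfl).trans h13
    have r14 : s'.reg 14 = v := (hag.1 14 rfl).trans h14
    have r16 : s'.reg 16 = u := (hag.1 16 rfl).trans h16
    have a0 : s'.arr 0 = s.arr 0 := hag.2 0 rfl
    have a1 : s'.arr 1 = s.arr 1 := hag.2 1 rfl
    have a3 : s'.arr 3 = s.arr 3 := hag.2 3 rfl
    have hbit1 : bit S i ≤ 1 := by rcases bit_eq_zero_or_one S i with h | h <;> omega
    have haddr : ((u : ℤ) * n + v).toNat = u * n + v := by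
      rw [show (u : ℤ) * n + v = ((u * n + v : ℕ) : ℤ) by push_cast; ring, Int.toNat_natCast]
    refine runs_assign_seq (z := (bit S i : ℤ)) hB hb ⟨by decide, by simp [Expr.maxLit]; omega⟩
      ?_ (abs_natCast_le (by omega)) fun hb₁ => ?_
    · rw [← bit_eq_sub]
      simp [Expr.eval, i17]
    have hz := hsumT (i + 1) hi
    refine runs_assign_seq hB hb₁ (accExpr_ok hB) ?_ hz fun hb₂ => ?_
    · rw [Finset.sum_range_succ, ← add_assoc]
      have hadj : s'.arr 0 (u * n + v) = s.adj n u v := congrFun a0 _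
      have hwt : s'.arr 1 (u * n + v) = s.wt n u v := congrFun a1 _
      simp only [accExpr, Expr.eval, predAddr, State.setReg_reg, State.setReg_arr, Nat.reduceEqDiff,
        if_true, if_false, i15, r16, r0, r14, haddr, hadj, hwt, i18, i19, r13, r3, r12, r4, r10, r2]
      congr 1
      simp only [T]
      by_cases hadj0 : s.adj n u v = 0
      · simp [hadj0]
      rcases bit_eq_zero_or_one S i with hb0 | hb1
      · simp [hb0]
      have hwb := hR.encodes.wt_bounds hR.weights (by omega) hv hadj0
      have hle := two_pow_le_of_bit hb1
      have hlt : S - 2 ^ i < 2 ^ k := (Nat.sub_le _ _).trans_lt hS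
      have hidx : ((((((c + 1 : ℕ) : ℤ) - 1) * ((n : ℤ) + 1) + u) * ((2 ^ k : ℕ) : ℤ) +
          ((S : ℤ) - (bit S i : ℤ) * ((2 ^ i : ℕ) : ℤ))) * ((2 * M * k + 1 : ℕ) : ℤ) +
          ((e : ℤ) - s.wt n u v - M)) =
          (cellIdx k n M c u (S - 2 ^ i) ((e : ℤ) - s.wt n u v - M).toNat : ℕ) := by
        rw [cellIdx, hb1]
        push_cast [hle]
        rw [Int.toNat_of_nonneg (by omega)]
        ring
      have helt : ((e : ℤ) - s.wt n u v - M).toNat < 2 * M * k + 1 := by omega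
      rw [hidx, Int.toNat_natCast, a3, h3, if_pos ((cellIdx_lt hu hlt helt).trans_le hcur),
        flatTable_cellIdx hu hlt helt, hb1]
      simp only [one_mul, Nat.cast_one, vertexVec, State.tab]
    refine runs_assign_seq (z := sgn S (i + 1) * (v : ℤ) ^ (i + 1)) hB hb₂
      ⟨by decide, by simp [Expr.maxLit]; omega⟩ ?_
      ((abs_sgn_mul_pow_le hv hi).trans (by exact_mod_cast hR.pow_n_le)) fun hb₃ => ?_
    · simp [Expr.eval, i19, r14, sgn_succ, pow_succ]
      ring
    refine runs_assign_seq (z := ((S / 2 ^ (i + 1) : ℕ) : ℤ)) hB hb₃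
      ⟨by decide, by simp [Expr.maxLit]; omega⟩ ?_
      (abs_natCast_le ((Nat.div_le_self _ _).trans (hS.le.trans hR.two_pow_le))) fun hb₄ => ?_
    · simp [Expr.eval, i17, pow_succ, ← Nat.div_div_eq_div_mul]
    refine runs_assign_of_eq (z := ((2 ^ (i + 1) : ℕ) : ℤ)) hB hb₄
      ⟨by decide, by simp [Expr.maxLit]; omega⟩ ?_
      (abs_natCast_le ((Nat.pow_le_pow_right (by omega) hi).trans hR.two_pow_le)) ?_
    · simp [Expr.eval, i18, pow_succ]
    · intro _ _
      simp
  · rintro s' - - - ⟨i15, -⟩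
    rw [i15, wedge, Finset.mul_sum]

end Digits

end RAM

namespace RAM

open KPath

/-- The program that fills array `3`.  Cell numbers are decoded into position, vertex, mask and
degree; the layer of position `0` is skipped. -/
def tableProg : Cmd :=
  forLoop 7 (.mul (.reg 1) (.mul (.mul (.add (.reg 0) (.lit 1)) (.reg 3)) (.reg 4))) <|
    .seq (.assign 8
      (.add (.mul (.mul (.add (.reg 0) (.lit 1)) (.reg 3)) (.reg 4)) (.reg 7))) <|
    .seq (.assign 9 (.div (.reg 8) (.reg 4))) <|
    .seq (.assign 10 (.sub (.reg 8) (.mul (.reg 9) (.reg 4)))) <|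
    .seq (.assign 11 (.div (.reg 9) (.reg 3))) <|
    .seq (.assign 12 (.sub (.reg 9) (.mul (.reg 11) (.reg 3)))) <|
    .seq (.assign 13 (.div (.reg 11) (.add (.reg 0) (.lit 1)))) <|
    .seq (.assign 14 (.sub (.reg 11) (.mul (.reg 13) (.add (.reg 0) (.lit 1))))) <|
    .branch (.mul (.sub (.reg 0) (.reg 14))
        (.add (.sub (.reg 10) (.mul (.lit 2) (.reg 2))) (.lit 1)))
      (.seq predLoop (.write 3 (.reg 8) (.mul
        (.read 2 (.add (.mul (.sub (.reg 13) (.lit 1)) (.add (.reg 0) (.lit 1))) (.reg 14)))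
        (.reg 15))))
      .skip

section Table

variable {coin : ℕ → Bool} {n : ℕ} {G : WeightedDigraph n} {k M B D : ℕ} {s s' : State}

theorem State.adj_congr (h : s'.arr 0 = s.arr 0) : s'.adj n = s.adj n := by
  funext u v; simp only [State.adj, h]

theorem State.wt_congr (h : s'.arr 1 = s.arr 1) : s'.wt n = s.wt n := by
  funext u v; simp only [State.wt, h]

theorem State.scalar_congr (h : s'.arr 2 = s.arr 2) : s'.scalar n = s.scalar n := by
  funext u v; simp only [State.scalar, h]

/-- The contribution of the predecessor `u` to the entry `c + 1, v, S, e`. -/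
def predTerm (k n M : ℕ) (s : State) (c v S e u : ℕ) : ℤ :=
  s.adj n u v * wedge k (vertexVec v)
    (fun S' => s.tab k n M c u S' ((e : ℤ) - s.wt n u v - M).toNat) S

theorem tab_succ {c v S e : ℕ} (hv : v < n) (he : 2 * M ≤ e) :
    s.tab k n M (c + 1) v S e =
      s.scalar n c v * ∑ u ∈ Finset.range (n + 1), predTerm k n M s c v S e u := by
  rw [State.tab, table, if_pos ⟨hv, he⟩]
  rfl

theorem abs_predTerm_le (hR : Ready G k M B D s) {c v S e u : ℕ} (hv : v < n) (hu : u < n + 1) :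
    |predTerm k n M s c v S e u| ≤ k * ((n : ℤ) ^ k * (D : ℤ) ^ c) := by
  rw [predTerm, wedge, Finset.mul_sum]
  refine (Finset.abs_sum_le_sum_abs _ _).trans ?_
  calc _ ≤ ∑ i ∈ Finset.range k, (n : ℤ) ^ k * (D : ℤ) ^ c :=
        Finset.sum_le_sum fun i hi => abs_wedge_term_le hv (Finset.mem_range.1 hi)
          (hR.encodes.abs_adj_le (by omega) hv) (hR.tab_le _ _ _ _)
    _ = _ := by simp

theorem runs_predLoop (hR : Ready G k M B D s) (hs : s.Bdd B) {c v S e : ℕ}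
    (hc : c < k) (hv : v < n) (hS : S < 2 ^ k) (he : e < 2 * M * k + 1) (he' : 2 * M ≤ e)
    {cur : ℕ} (hcur : (c + 1) * ((n + 1) * 2 ^ k * (2 * M * k + 1)) ≤ cur)
    (h3 : ∀ m, s.arr 3 m =
      if m < cur then flatTable k n M (s.adj n) (s.wt n) (s.scalar n) m else 0)
    (h10 : s.reg 10 = e) (h12 : s.reg 12 = S) (h13 : s.reg 13 = ((c + 1 : ℕ) : ℤ))
    (h14 : s.reg 14 = v) :
    Runs coin B predLoop s ((n + 1) * (k * 7 + 7) + 3) fun s' =>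
      s'.reg 15 = ∑ u ∈ Finset.range (n + 1), predTerm k n M s c v S e u := by
  have hB := hR.two_le
  refine Runs.mono (a := (n + 1) * (k * 7 + 2 + 1 + 1 + 1 + 2) + 2 + 1) ?_
    (by simp only [add_assoc]; rfl) fun _ _ _ h => h
  refine runs_assign_seq (z := 0) (b := (n + 1) * (k * 7 + 2 + 1 + 1 + 1 + 2) + 2) hB hs
    ⟨by decide, by simp [Expr.maxLit]⟩ rfl (by simp) fun hb => ?_
  refine runs_forLoop (a := k * 7 + 2 + 1 + 1 + 1) (N := n + 1)
    (fun u s' => s'.reg 15 = ∑ u' ∈ Finset.range u, predTerm k n M s c v S e u') hB hb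
    ⟨by decide, by simp [Expr.maxLit]; omega⟩ rfl ?_ hR.bounds.1 (by simp) ?_ ?_
  · intro s' h
    have := (h.1 0 rfl).trans (show _ = s.reg 0 by simp)
    simp [Expr.eval, this, hR.reg0]
  · intro u hu s' hb' hag h16 i15
    have hreg : ∀ i, (forLoop 16 (.add (.reg 0) (.lit 1)) (.seq (.assign 17 (.reg 12)) <|
        .seq (.assign 18 (.lit 1)) <| .seq (.assign 19 (.lit 1)) digitLoop)).writesReg i = false →
        i ≠ 15 → s'.reg i = s.reg i := fun i hi h => (hag.1 i hi).trans (by simp [h])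
    have harr : ∀ a, s'.arr a = s.arr a := fun a => hag.2 a rfl
    refine runs_assign_seq (z := (S : ℤ)) hB hb' ⟨by decide, by simp [Expr.maxLit]⟩ ?_
      (abs_natCast_le (hS.le.trans hR.two_pow_le)) fun hb₁ => ?_
    · exact (hreg 12 rfl (by decide)).trans h12
    refine runs_assign_seq (z := 1) hB hb₁ ⟨by decide, by simp [Expr.maxLit]; omega⟩ rfl
      (by simp; omega) fun hb₂ => ?_
    refine runs_assign_seq (z := 1) hB hb₂ ⟨by decide, by simp [Expr.maxLit]; omega⟩ rfl
      (by simp; omega) fun hb₃ => ?_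
    set s₃ := ((s'.setReg 17 (S : ℤ)).setReg 18 1).setReg 19 1 with hs₃
    have harr₃ : ∀ a, s₃.arr a = s.arr a := harr
    have hreg₃ : ∀ i < 16, i ≠ 15 → s₃.reg i = s.reg i := by
      intro i hi h
      have : s₃.reg i = s'.reg i := by
        simp [hs₃, show i ≠ 17 by omega, show i ≠ 18 by omega, show i ≠ 19 by omega]
      rw [this]
      exact hreg i (by interval_cases i <;> first | rfl | omega) h
    have hR₃ : Ready G k M B D s₃ :=
      hR.congr (fun i hi => hreg₃ i (by omega) (by omega)) fun a _ => harr₃ a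
    have e0 : s₃.adj n = s.adj n := State.adj_congr (harr₃ 0)
    have e1 : s₃.wt n = s.wt n := State.wt_congr (harr₃ 1)
    have e2 : s₃.scalar n = s.scalar n := State.scalar_congr (harr₃ 2)
    have et : s₃.tab k n M = s.tab k n M := tab_congr fun a _ => harr₃ a
    refine (runs_digitLoop hR₃ hb₃ hc hv hS he he' hu hcur (by rw [e0, e1, e2, harr₃]; exact h3)
      (a := ∑ u' ∈ Finset.range u, predTerm k n M s c v S e u') ?_
      ((hreg₃ 10 (by decide) (by decide)).trans h10) ((hreg₃ 12 (by decide) (by decide)).trans h12)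
      ((hreg₃ 13 (by decide) (by decide)).trans h13) ((hreg₃ 14 (by decide) (by decide)).trans h14)
      (by simpa [hs₃] using i15) (by simpa [hs₃] using h16) (by simp [hs₃]) (by simp [hs₃])
      (by simp [hs₃])).mono le_rfl ?_
    · refine (Finset.abs_sum_le_sum_abs _ _).trans ?_
      calc _ ≤ ∑ u' ∈ Finset.range u, (k : ℤ) * ((n : ℤ) ^ k * (D : ℤ) ^ c) :=
            Finset.sum_le_sum fun u' hu' => abs_predTerm_le hR hv (by simp at hu'; omega)
        _ = _ := by simp
    · intro s'' _ _ h15 _ _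
      rw [e0, e1, et] at h15
      rw [Finset.sum_range_succ]
      simpa [predTerm] using h15
  · intro s' _ _ _ h
    exact h

theorem flatTable_of_lt {adj wt y : ℕ → ℕ → ℤ} {m : ℕ} (hk : 1 ≤ k)
    (hm : m < (n + 1) * 2 ^ k * (2 * M * k + 1)) :
    flatTable k n M adj wt y m = if m = cellIdx k n M 0 n 0 (2 * M) then 1 else 0 := by
  by_cases h : m = cellIdx k n M 0 n 0 (2 * M)
  · have hMk : 2 * M * 1 ≤ 2 * M * k := Nat.mul_le_mul_left _ hk
    rw [if_pos h, h, flatTable_cellIdx (by omega) (by positivity) (by omega)]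
    simp [table]
  have h0 : m / (2 * M * k + 1) / 2 ^ k / (n + 1) = 0 := by
    rw [Nat.div_div_eq_div_mul, Nat.div_div_eq_div_mul]
    exact Nat.div_eq_of_lt (by linarith [hm, mul_comm ((2 * M * k + 1) * 2 ^ k) (n + 1)])
  have h1 : m / (2 * M * k + 1) / 2 ^ k < n + 1 := by
    rw [Nat.div_div_eq_div_mul]
    exact Nat.div_lt_of_lt_mul (by linarith [hm, mul_comm ((2 * M * k + 1) * 2 ^ k) (n + 1)])
  rw [flatTable, h0, table, Nat.mod_eq_of_lt h1, if_neg h, if_neg]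
  rintro ⟨a, b, c⟩
  have e1 := Nat.div_add_mod m (2 * M * k + 1)
  have e2 := Nat.div_add_mod (m / (2 * M * k + 1)) (2 ^ k)
  rw [a, b] at e2
  rw [← e2, c] at e1
  refine h ?_
  rw [← e1, cellIdx]
  ring

theorem runs_tableProg (hR : Ready G k M B D s) (hs : s.Bdd B)
    (h3 : ∀ m, s.arr 3 m = if m = cellIdx k n M 0 n 0 (2 * M) then 1 else 0) :
    Runs coin B tableProg s
      (k * ((n + 1) * 2 ^ k * (2 * M * k + 1)) * ((n + 1) * (k * 7 + 7) + 14) + 2) fun s' =>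
      ∀ m, s'.arr 3 m = if m < (k + 1) * ((n + 1) * 2 ^ k * (2 * M * k + 1)) then
        flatTable k n M (s.adj n) (s.wt n) (s.scalar n) m else 0 := by
  have hB := hR.two_le
  have hMk : 2 * M * 1 ≤ 2 * M * k := Nat.mul_le_mul_left _ hR.k_pos
  set W := 2 * M * k + 1 with hW
  set L := (n + 1) * 2 ^ k * W with hL
  have hLB : (k + 1) * L ≤ B := hR.cells_le
  rw [add_mul, one_mul] at hLB ⊢
  have hcell : cellIdx k n M 0 n 0 (2 * M) < L := by
    have := cellIdx_lt (k := k) (n := n) (M := M) (c := 0) (v := n) (S := 0) (e := 2 * M)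
      (by omega) (by positivity) (by omega)
    rwa [zero_add, one_mul] at this
  refine Runs.mono (a := k * L * ((n + 1) * (k * 7 + 7) + 3 + 1 + 1 + 7 + 2) + 2) ?_
    (le_of_eq (by ring)) fun _ _ _ h => h
  refine runs_forLoop (a := (n + 1) * (k * 7 + 7) + 3 + 1 + 1 + 7) (N := k * L)
    (fun j s' => ∀ m, s'.arr 3 m = if m < L + j then
      flatTable k n M (s.adj n) (s.wt n) (s.scalar n) m else 0) hB hs
    ⟨by simp [Expr.size], by simp [Expr.maxLit]; omega⟩ rfl ?_ (by omega) ?_ ?_ ?_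
  · intro s' h
    simp only [Expr.eval, h.1 0 rfl, h.1 1 rfl, h.1 3 rfl, h.1 4 rfl, hR.reg0, hR.reg1, hR.reg3,
      hR.reg4]
    push_cast [hL, hW]
    ring
  · intro m
    rw [State.setReg_arr, h3, add_zero]
    by_cases hm : m < L
    · rw [if_pos hm, flatTable_of_lt hR.k_pos hm]
    · rw [if_neg hm, if_neg (by omega)]
  · intro j hj s' hb hag h7 hI
    have hreg : ∀ i < 5, s'.reg i = s.reg i := fun i hi =>
      hag.1 i (by interval_cases i <;> rfl)
    have harr : ∀ a < 3, s'.arr a = s.arr a := fun a ha =>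
      hag.2 a (by interval_cases a <;> rfl)
    set x := L + j with hx
    have hxB : x ≤ B := by omega
    set q := x / W with hq
    set r := q / 2 ^ k with hr
    have hqx : q ≤ x := Nat.div_le_self _ _
    have hrq : r ≤ q := Nat.div_le_self _ _
    have hmul : (n + 1) * (2 ^ k * W) = L := by rw [hL, mul_assoc]
    have hdiv : r / (n + 1) = x / L := by
      rw [hr, hq, Nat.div_div_eq_div_mul, Nat.div_div_eq_div_mul, ← hmul]
      congr 1
      ring
    have hLpos : 0 < L := by positivity
    have hpos : 1 ≤ r / (n + 1) := by
      rw [hdiv, Nat.le_div_iff_mul_le hLpos]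
      omega
    have hltk : r / (n + 1) < k + 1 := by
      rw [hdiv, Nat.div_lt_iff_lt_mul hLpos, add_mul]
      omega
    have r0 : s'.reg 0 = n := (hreg 0 (by omega)).trans hR.reg0
    have r2 : s'.reg 2 = M := (hreg 2 (by omega)).trans hR.reg2
    have r3 : s'.reg 3 = ((2 ^ k : ℕ) : ℤ) := (hreg 3 (by omega)).trans hR.reg3
    have r4 : s'.reg 4 = (W : ℤ) := (hreg 4 (by omega)).trans hR.reg4
    have hmod : ∀ a b : ℕ, (a : ℤ) - ((a / b : ℕ) : ℤ) * b = ((a % b : ℕ) : ℤ) := by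
      intro a b
      have := Nat.div_add_mod a b
      rw [mul_comm] at this
      zify at this ⊢
      linarith
    have mod_le : ∀ a b : ℕ, a % b ≤ a := Nat.mod_le
    refine runs_assign_seq (z := (x : ℤ)) hB hb
      ⟨by simp [Expr.size], by simp [Expr.maxLit]; omega⟩ ?_ (abs_natCast_le hxB) fun hb₁ => ?_
    · simp only [Expr.eval, r0, r3, r4, h7, hx, hL]
      push_cast
      ring
    refine runs_assign_seq (z := (q : ℤ)) hB hb₁ ⟨by simp [Expr.size], by simp [Expr.maxLit]⟩
      ?_ (abs_natCast_le (by omega)) fun hb₂ => ?_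
    · simp [Expr.eval, r4, hq]
    refine runs_assign_seq (z := ((x % W : ℕ) : ℤ)) hB hb₂
      ⟨by simp [Expr.size], by simp [Expr.maxLit]⟩ ?_
      (abs_natCast_le ((mod_le _ _).trans hxB)) fun hb₃ => ?_
    · rw [← hmod]
      simp [Expr.eval, r4, hq]
    refine runs_assign_seq (z := (r : ℤ)) hB hb₃ ⟨by simp [Expr.size], by simp [Expr.maxLit]⟩
      ?_ (abs_natCast_le (by omega)) fun hb₄ => ?_
    · simp [Expr.eval, r3, hr]
    refine runs_assign_seq (z := ((q % 2 ^ k : ℕ) : ℤ)) hB hb₄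
      ⟨by simp [Expr.size], by simp [Expr.maxLit]⟩ ?_
      (abs_natCast_le ((mod_le _ _).trans (by omega))) fun hb₅ => ?_
    · simpa [Expr.eval, r3, hr] using hmod q (2 ^ k)
    refine runs_assign_seq (z := ((r / (n + 1) : ℕ) : ℤ)) hB hb₅
      ⟨by simp [Expr.size], by simp [Expr.maxLit]; omega⟩ ?_
      (abs_natCast_le ((Nat.div_le_self _ _).trans (by omega))) fun hb₆ => ?_
    · simp [Expr.eval, r0]
    refine runs_assign_seq (z := ((r % (n + 1) : ℕ) : ℤ)) hB hb₆
      ⟨by simp [Expr.size], by simp [Expr.maxLit]; omega⟩ ?_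
      (abs_natCast_le ((mod_le _ _).trans (by omega))) fun hb₇ => ?_
    · simpa [Expr.eval, r0] using hmod r (n + 1)
    obtain ⟨c, hc⟩ : ∃ c, r / (n + 1) = c + 1 := ⟨r / (n + 1) - 1, by omega⟩
    rw [hc] at hb₇ hltk hdiv ⊢
    have hv : r % (n + 1) ≤ n := Nat.lt_succ_iff.1 (Nat.mod_lt _ (by omega))
    have hS : q % 2 ^ k < 2 ^ k := Nat.mod_lt _ (by positivity)
    have he : x % W < W := Nat.mod_lt _ (by omega)
    have hflat : flatTable k n M (s.adj n) (s.wt n) (s.scalar n) x =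
        s.tab k n M (c + 1) (r % (n + 1)) (q % 2 ^ k) (x % W) := by
      rw [flatTable, ← hW, ← hq, ← hr, hc]
      rfl
    generalize r % (n + 1) = v at *
    generalize q % 2 ^ k = S at *
    generalize x % W = e at *
    set s₇ := ((((((s'.setReg 8 (x : ℤ)).setReg 9 (q : ℤ)).setReg 10 (e : ℤ)).setReg 11
      (r : ℤ)).setReg 12 (S : ℤ)).setReg 13 ((c + 1 : ℕ) : ℤ)).setReg 14 (v : ℤ) with hs₇
    have harr₇ : ∀ a, s₇.arr a = s'.arr a := fun _ => rfl
    have hreg₇ : ∀ i < 8, s₇.reg i = s'.reg i := fun i hi => by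
      simp [hs₇, show i ≠ 8 by omega, show i ≠ 9 by omega, show i ≠ 10 by omega,
        show i ≠ 11 by omega, show i ≠ 12 by omega, show i ≠ 13 by omega, show i ≠ 14 by omega]
    have t0 : s₇.reg 0 = n := (hreg₇ 0 (by omega)).trans r0
    have t2 : s₇.reg 2 = M := (hreg₇ 2 (by omega)).trans r2
    have t8 : s₇.reg 8 = x := by simp [hs₇]
    have t10 : s₇.reg 10 = e := by simp [hs₇]
    have t12 : s₇.reg 12 = S := by simp [hs₇]
    have t13 : s₇.reg 13 = ((c + 1 : ℕ) : ℤ) := by simp [hs₇]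
    have t14 : s₇.reg 14 = v := by simp [hs₇]
    clear_value s₇
    have hR₇ : Ready G k M B D s₇ :=
      hR.congr (fun i hi => (hreg₇ i (by omega)).trans (hreg i hi))
        fun a ha => (harr₇ a).trans (harr a ha)
    have e0 : s₇.adj n = s.adj n := State.adj_congr ((harr₇ 0).trans (harr 0 (by omega)))
    have e1 : s₇.wt n = s.wt n := State.wt_congr ((harr₇ 1).trans (harr 1 (by omega)))
    have e2 : s₇.scalar n = s.scalar n := State.scalar_congr ((harr₇ 2).trans (harr 2 (by omega)))
    have et : s₇.tab k n M = s.tab k n M :=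
      tab_congr fun a ha => (harr₇ a).trans (harr a ha)
    have hpt : ∀ u, predTerm k n M s₇ c v S e u = predTerm k n M s c v S e u := fun u => by
      rw [predTerm, predTerm, e0, e1, et]
    have h3₇ : ∀ m, s₇.arr 3 m = if m < x then
        flatTable k n M (s.adj n) (s.wt n) (s.scalar n) m else 0 := by
      rw [harr₇]; exact hI
    refine runs_branch (a := (n + 1) * (k * 7 + 7) + 3 + 1) hB hb₇
      ⟨by simp [Expr.size], by simp [Expr.maxLit]; omega⟩ (fun hev => ?_) fun hev => ?_
    · simp only [Expr.eval, t0, t2, t10, t14] at hev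
      have hve : v < n ∧ 2 * M ≤ e := by
        rcases pos_and_pos_or_neg_and_neg_of_mul_pos hev with h | h <;> omega
      have hcur : (c + 1) * ((n + 1) * 2 ^ k * (2 * M * k + 1)) ≤ x := by
        rw [← hW, ← hL, hdiv]
        exact Nat.div_mul_le_self _ _
      refine runs_seq ((runs_predLoop hR₇ hb₇ (c := c) (by omega) hve.1 hS he hve.2 hcur
        (by rw [e0, e1, e2]; exact h3₇) t10 t12 t13 t14).mono le_rfl ?_)
      intro s₈ hb₈ hag₈ h15 hb₈' _
      have u0 : s₈.reg 0 = n := (hag₈.1 0 rfl).trans t0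
      have u8 : s₈.reg 8 = x := (hag₈.1 8 rfl).trans t8
      have u13 : s₈.reg 13 = ((c + 1 : ℕ) : ℤ) := (hag₈.1 13 rfl).trans t13
      have u14 : s₈.reg 14 = v := (hag₈.1 14 rfl).trans t14
      have hsc : s₈.arr 2 (c * (n + 1) + v) = s.scalar n c v :=
        (congrFun (hag₈.2 2 rfl) _).trans (congrFun (congrFun e2 c) v)
      have hab : |flatTable k n M (s.adj n) (s.wt n) (s.scalar n) x| ≤ B := by
        rw [hflat]
        exact (hR.tab_le _ _ _ _).trans (by exact_mod_cast hR.pow_D_le (c := c + 1) (by omega))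
      refine runs_write_of_eq (m := x) hB hb₈ ⟨by simp [Expr.size], by simp [Expr.maxLit]⟩
        ⟨by simp [Expr.size], by simp [Expr.maxLit]; omega⟩ u8 ?_ hab ?_
      · have hadr : (((c + 1 : ℕ) : ℤ) - 1) * ((n : ℤ) + 1) + v = ((c * (n + 1) + v : ℕ) : ℤ) := by
          push_cast; ring
        simp only [Expr.eval, u0, u13, u14, h15, hadr, Int.toNat_natCast, hsc, hpt]
        rw [hflat, tab_succ hve.1 hve.2]
      · intro _ _ m
        have h3₈ : s₈.arr 3 m = s₇.arr 3 m := congrFun (hag₈.2 3 rfl) m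
        simp only [State.setReg_arr, State.setArr_arr, true_and, h3₈, h3₇]
        rcases lt_trichotomy m x with h | rfl | h
        · simp [h, h.ne, show m < L + (j + 1) by omega]
        · simp [hx, ← add_assoc]
        · simp [h.ne', show ¬ m < x by omega, show ¬ m < L + (j + 1) by omega]
    · simp only [Expr.eval, t0, t2, t10, t14] at hev
      have hve : ¬ (v < n ∧ 2 * M ≤ e) := by
        rintro ⟨h1, h2⟩
        refine absurd (mul_pos (a := (n : ℤ) - v) (b := e - 2 * M + 1) ?_ ?_) (not_lt.2 hev) <;>
          omega
      refine (runs_skip hb₇ (Q := fun s'' => s'' = s₇) rfl).mono (by omega) ?_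
      rintro _ - - rfl - - m
      rw [State.setReg_arr, h3₇]
      rcases lt_trichotomy m x with h | rfl | h
      · simp [h, show m < L + (j + 1) by omega]
      · rw [if_neg (lt_irrefl _), if_pos (by omega), hflat, State.tab, table, if_neg hve]
      · simp [show ¬ m < x by omega, show ¬ m < L + (j + 1) by omega]
  · intro s' _ _ _ h m
    rw [h m, add_mul, one_mul, add_comm L]

end Table

end RAM

/-! ### The program: search for the least degree -/

namespace RAM

open KPath

/-- Looks for the least degree `e` and a vertex `v` with a nonzero table entry at the volume
element.  The degrees are scanned downwards, so that the last entry found has the least one. -/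
def searchProg : Cmd :=
  .seq (.assign 22 (.lit 0)) <|
  forLoop 7 (.reg 4) <| forLoop 8 (.reg 0) <|
    .seq (.assign 9 (.read 3 (.add (.mul (.add (.mul (.add (.mul (.reg 1) (.add (.reg 0) (.lit 1)))
      (.reg 8)) (.reg 3)) (.sub (.reg 3) (.lit 1))) (.reg 4))
      (.sub (.sub (.reg 4) (.lit 1)) (.reg 7))))) <|
    .branch (.mul (.reg 9) (.reg 9))
      (.seq (.assign 22 (.lit 1)) <|
        .seq (.assign 23 (.sub (.sub (.reg 4) (.lit 1)) (.reg 7))) (.assign 24 (.reg 8)))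
      .skip

/-- The registers `22`, `23`, `24` tell the result of a search for the least `e` with
`X e v ≠ 0` for some `v`, among the pairs `e, v` in `Z`. -/
def Searched (X : ℕ → ℕ → ℤ) (Z : ℕ → ℕ → Prop) (s : State) : Prop :=
  (s.reg 22 = 0 ∧ ∀ e v, Z e v → X e v = 0) ∨
    (s.reg 22 = 1 ∧ ∃ e v : ℕ, Z e v ∧ s.reg 23 = e ∧ s.reg 24 = v ∧ X e v ≠ 0 ∧
      ∀ e' v', Z e' v' → e' < e → X e' v' = 0)

theorem Searched.congr {X : ℕ → ℕ → ℤ} {Z Z' : ℕ → ℕ → Prop} {s s' : State}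
    (h : Searched X Z s) (hZ : ∀ e v, Z' e v ↔ Z e v)
    (hr : ∀ i, 22 ≤ i → i < 25 → s'.reg i = s.reg i) : Searched X Z' s' := by
  simp only [Searched, hZ, hr 22 (by omega) (by omega), hr 23 (by omega) (by omega),
    hr 24 (by omega) (by omega)]
  exact h

/-- Extending the search by one pair with the value zero. -/
theorem Searched.extend {X : ℕ → ℕ → ℤ} {Z Z' : ℕ → ℕ → Prop} {s : State} (h : Searched X Z s)
    (hZ : ∀ e v, Z e v → Z' e v) (hX : ∀ e v, Z' e v → Z e v ∨ X e v = 0) :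
    Searched X Z' s := by
  rcases h with ⟨h1, h2⟩ | ⟨h1, e, v, hz, h23, h24, hne, hmin⟩
  · exact .inl ⟨h1, fun e v h => (hX e v h).elim (h2 e v) id⟩
  · exact .inr ⟨h1, e, v, hZ _ _ hz, h23, h24, hne, fun e' v' h hlt =>
      (hX e' v' h).elim (fun h => hmin e' v' h hlt) id⟩

section Search

variable {coin : ℕ → Bool} {n : ℕ} {G : WeightedDigraph n} {k M B D : ℕ} {s s' : State}

theorem runs_searchProg (hR : Ready G k M B D s) (hs : s.Bdd B)
    (h3 : ∀ m, s.arr 3 m = if m < (k + 1) * ((n + 1) * 2 ^ k * (2 * M * k + 1)) then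
        flatTable k n M (s.adj n) (s.wt n) (s.scalar n) m else 0) :
    Runs coin B searchProg s ((2 * M * k + 1) * (n * 7 + 4) + 3) fun s' =>
      Searched (fun e v => s.tab k n M k v (2 ^ k - 1) e)
        (fun e v => e < 2 * M * k + 1 ∧ v < n) s' := by
  have hB := hR.two_le
  obtain ⟨hnB, -, hWB, -, -⟩ := hR.bounds
  set W := 2 * M * k + 1 with hW
  refine Runs.mono (a := W * (n * (5 + 2) + 2 + 2) + 2 + 1) ?_ le_rfl fun _ _ _ h => h
  refine runs_assign_seq (z := 0) (b := W * (n * (5 + 2) + 2 + 2) + 2) hB hs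
    ⟨by decide, by simp [Expr.maxLit]⟩ rfl (by simp) fun hb => ?_
  let Z : ℕ → ℕ → ℕ → ℕ → Prop := fun j i e v =>
    e < W ∧ v < n ∧ (W ≤ e + j ∨ (W = e + j + 1 ∧ v < i))
  refine runs_forLoop (a := n * (5 + 2) + 2) (N := W)
    (fun j s' => Searched (fun e v => s.tab k n M k v (2 ^ k - 1) e) (Z j 0) s') hB hb
    ⟨by decide, by simp [Expr.maxLit]⟩ rfl ?_ hWB ?_ ?_ ?_
  · intro s' h
    exact (h.1 4 rfl).trans ((by simp : _ = s.reg 4).trans hR.reg4)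
  · refine .inl ⟨by simp, fun e v h => ?_⟩
    simp only [Z] at h
    omega
  · intro j hj s' hb' hag h7 hI
    have hreg : ∀ i < 5, s'.reg i = s.reg i := fun i hi =>
      (hag.1 i (by interval_cases i <;> rfl)).trans (by
        rw [State.setReg_reg, if_neg (by omega)])
    refine runs_forLoop (a := 5) (N := n)
      (fun i s'' => Searched (fun e v => s.tab k n M k v (2 ^ k - 1) e) (Z j i) s'') hB hb'
      ⟨by decide, by simp [Expr.maxLit]⟩ rfl ?_ (by omega) ?_ ?_ ?_
    · intro s'' h
      exact (h.1 0 rfl).trans ((hreg 0 (by omega)).trans hR.reg0)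
    · exact hI.congr (fun _ _ => Iff.rfl) fun i _ _ => by simp [show i ≠ 8 by omega]
    · intro i hi s₁ hb₁ hag₁ h8 hI₁
      have hreg₁ : ∀ i < 5, s₁.reg i = s.reg i := fun i hi =>
        (hag₁.1 i (by interval_cases i <;> rfl)).trans (hreg i hi)
      have r0 := (hreg₁ 0 (by omega)).trans hR.reg0
      have r1 := (hreg₁ 1 (by omega)).trans hR.reg1
      have r3 := (hreg₁ 3 (by omega)).trans hR.reg3
      have r4 := (hreg₁ 4 (by omega)).trans hR.reg4
      have r7 : s₁.reg 7 = j := (hag₁.1 7 rfl).trans h7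
      have a3 : s₁.arr 3 = s.arr 3 := (hag₁.2 3 rfl).trans (hag.2 3 rfl)
      have hP : 1 ≤ 2 ^ k := Nat.one_le_two_pow
      have hcell : s.arr 3 (cellIdx k n M k i (2 ^ k - 1) (W - 1 - j)) =
          s.tab k n M k i (2 ^ k - 1) (W - 1 - j) := by
        rw [h3, if_pos (cellIdx_lt (by omega) (by omega) (by omega)),
          flatTable_cellIdx (by omega) (by omega) (by omega)]
        rfl
      refine runs_assign_seq (z := s.tab k n M k i (2 ^ k - 1) (W - 1 - j)) hB hb₁
        ⟨by simp [Expr.size], by simp [Expr.maxLit]; omega⟩ ?_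
        ((hR.tab_le _ _ _ _).trans (by exact_mod_cast hR.pow_D_le le_rfl)) fun hb₂ => ?_
      · rw [← hcell]
        simp only [Expr.eval, r0, r1, r3, r4, r7, h8, a3]
        congr 1
        rw [show ((k : ℤ) * ((n : ℤ) + 1) + i) * ((2 ^ k : ℕ) : ℤ) + (((2 ^ k : ℕ) : ℤ) - 1) =
          (((k * (n + 1) + i) * 2 ^ k + (2 ^ k - 1) : ℕ) : ℤ) by push_cast [hP]; ring,
          show ((2 * M * k + 1 : ℕ) : ℤ) - 1 - j = ((W - 1 - j : ℕ) : ℤ) by omega, cellIdx]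
        norm_cast
      refine runs_branch (a := 3) hB hb₂ ⟨by simp [Expr.size], by simp [Expr.maxLit]⟩
        (fun hev => ?_) fun hev => ?_
      · have hne : s.tab k n M k i (2 ^ k - 1) (W - 1 - j) ≠ 0 := by
          intro h
          simp [Expr.eval, h] at hev
        refine runs_assign_seq (z := 1) hB hb₂ ⟨by decide, by simp [Expr.maxLit]; omega⟩ rfl
          (by simp; omega) fun hb₃ => ?_
        refine runs_assign_seq (z := ((W - 1 - j : ℕ) : ℤ)) hB hb₃
          ⟨by decide, by simp [Expr.maxLit]; omega⟩ ?_ (abs_natCast_le (by omega)) fun hb₄ => ?_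
        · simp only [Expr.eval, State.setReg_reg, Nat.reduceEqDiff, if_false, r4, r7]
          omega
        refine runs_assign_of_eq (z := (i : ℤ)) hB hb₄ ⟨by decide, by simp [Expr.maxLit]⟩
          (by simp [Expr.eval, h8]) (abs_natCast_le (by omega)) ?_
        intro _ _
        refine .inr ⟨by simp, W - 1 - j, i, ?_, by simp, by simp, hne, ?_⟩
        · simp only [Z]; omega
        · intro e' v' h hlt
          simp only [Z] at h
          omega
      · have h0 : s.tab k n M k i (2 ^ k - 1) (W - 1 - j) = 0 := by
          by_contra h
          have := mul_self_pos.2 h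
          simp only [Expr.eval, State.setReg_reg, if_true] at hev
          omega
        refine (runs_skip hb₂ (Q := fun s'' => s'' = _) rfl).mono (by omega) ?_
        rintro _ - - rfl - -
        refine (hI₁.congr (fun _ _ => Iff.rfl) fun l _ _ => ?_).extend (Z := Z j i) ?_ ?_
        · simp [show l ≠ 8 by omega, show l ≠ 9 by omega]
        · intro e v h
          simp only [Z] at h ⊢
          omega
        · intro e v h
          simp only [Z] at h ⊢
          by_cases hev' : e = W - 1 - j ∧ v = i
          · obtain ⟨rfl, rfl⟩ := hev'
            exact .inr h0
          · omega
    · intro s'' _ _ _ h _ _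
      refine h.congr (fun e v => ?_) fun l _ _ => by simp [show l ≠ 7 by omega]
      simp only [Z]
      omega
  · intro s' _ _ _ h
    refine h.congr (fun e v => ?_) fun _ _ _ => rfl
    simp only [Z]
    omega

end Search

end RAM

/-! ### The program: tracing back a path -/

namespace KPath

theorem abs_contract_le {k n v : ℕ} (hv : v < n) {g : ℕ → ℤ} {D : ℤ} (hg : ∀ S, |g S| ≤ D)
    (S m : ℕ) (hm : m ≤ k) :
    |∑ i ∈ Finset.range m, (1 - (bit S i : ℤ)) * sgn S i * vertexVec v i *
      g (S + (1 - bit S i) * 2 ^ i)| ≤ k * (n : ℤ) ^ k * D := by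
  have hD : 0 ≤ D := (abs_nonneg _).trans (hg 0)
  refine (Finset.abs_sum_le_sum_abs _ _).trans ?_
  calc _ ≤ ∑ i ∈ Finset.range m, (n : ℤ) ^ k * D := by
        refine Finset.sum_le_sum fun i hi => ?_
        rw [abs_mul, abs_mul, abs_mul, abs_sgn, mul_one]
        have h1 : |1 - (bit S i : ℤ)| ≤ 1 := by
          rcases bit_eq_zero_or_one S i with h | h <;> simp [h]
        have h2 : |vertexVec v i| ≤ (n : ℤ) ^ k := by
          rw [vertexVec, abs_of_nonneg (by positivity)]
          exact_mod_cast (Nat.pow_le_pow_left hv.le i).trans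
            (Nat.pow_le_pow_right (by omega) (by simp at hi; omega))
        calc _ ≤ 1 * (n : ℤ) ^ k * D := by
              gcongr
              exact hg _
          _ = _ := by ring
    _ = m * ((n : ℤ) ^ k * D) := by simp
    _ ≤ k * ((n : ℤ) ^ k * D) := by gcongr
    _ = _ := by ring

theorem abs_suffixForm_le {k n : ℕ} {l : List ℕ} (hl : ∀ v ∈ l, v < n) (S : ℕ) :
    |suffixForm k l S| ≤ (k * (n : ℤ) ^ k) ^ l.length := by
  induction l generalizing S with
  | nil =>
    by_cases h : S = 2 ^ k - 1
    · simp [suffixForm, h]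
    · simp [suffixForm, h]
  | cons v l ih =>
    refine (abs_contract_le (hl v (by simp)) (ih fun w hw => hl w (by simp [hw])) S k le_rfl).trans
      (le_of_eq ?_)
    rw [List.length_cons, pow_succ]
    ring

theorem Encodes.adj_eq_zero_or_one {n : ℕ} {G : WeightedDigraph n} {M : ℕ} {adj wt : ℕ → ℕ → ℤ}
    (hG : Encodes G M adj wt) {u v : ℕ} (hu : u ≤ n) (hv : v < n) : adj u v = 0 ∨ adj u v = 1 := by
  rcases hu.lt_or_eq with hu | rfl
  · by_cases hA : G.Adj ⟨u, hu⟩ ⟨v, hv⟩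
    · exact .inr (hG.adj_one ⟨u, hu⟩ ⟨v, hv⟩ hA)
    · exact .inl (hG.adj_zero ⟨u, hu⟩ ⟨v, hv⟩ hA)
  · exact .inr (hG.adj_source v hv)

end KPath

namespace RAM

open KPath

/-- Computes row `c` (register `8`) of array `4` from row `c + 1` by contraction with the vector of
the vertex in register `24`. -/
def contractLoop : Cmd :=
  forLoop 12 (.reg 3) <|
    .seq (.assign 15 (.lit 0)) <|
    .seq (.assign 17 (.reg 12)) <| .seq (.assign 18 (.lit 1)) <| .seq (.assign 19 (.lit 1)) <|
    .seq (forLoop 20 (.reg 1) <|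
      .seq (bitCmd 17 21) <|
      .seq (.assign 15 (.add (.reg 15) (.mul (.mul (.sub (.lit 1) (.reg 21)) (.reg 19))
        (.read 4 (.add (.mul (.add (.reg 8) (.lit 1)) (.reg 3))
          (.add (.reg 12) (.mul (.sub (.lit 1) (.reg 21)) (.reg 18)))))))) <|
      .seq (.assign 19 (.mul (.mul (.reg 19) (.reg 24))
        (.sub (.lit 1) (.mul (.lit 2) (.reg 21))))) <|
      .seq (.assign 17 (.div (.reg 17) (.lit 2))) (.assign 18 (.mul (.reg 18) (.lit 2))))
    (.write 4 (.add (.mul (.reg 8) (.reg 3)) (.reg 12)) (.reg 15))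

/-- Looks for a predecessor `u` of the vertex in register `24` whose term in the pairing at
position `c` (register `8`) is not zero; `u` and its degree go to the registers `27` and `28`. -/
def choosePred : Cmd :=
  forLoop 16 (.add (.reg 0) (.lit 1)) <|
    .seq (.assign 29 (.mul (.read 0 (.add (.mul (.reg 16) (.reg 0)) (.reg 24)))
      (.sub (.sub (.reg 23) (.read 1 (.add (.mul (.reg 16) (.reg 0)) (.reg 24)))) (.reg 2)))) <|
    .seq (.assign 15 (.lit 0)) <|
    .seq (forLoop 12 (.reg 3) (.assign 15 (.add (.reg 15) (.mul
      (.read 4 (.add (.mul (.reg 8) (.reg 3)) (.reg 12)))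
      (.read 3 (.add (.mul (.add (.mul (.add (.mul (.reg 8) (.add (.reg 0) (.lit 1))) (.reg 16))
        (.reg 3)) (.reg 12)) (.reg 4)) (.reg 29))))))) <|
    .seq (.assign 15 (.mul (.read 0 (.add (.mul (.reg 16) (.reg 0)) (.reg 24))) (.reg 15))) <|
    .branch (.mul (.reg 15) (.reg 15)) (.seq (.assign 27 (.reg 16)) (.assign 28 (.reg 29))) .skip

/-- Traces back a path from its last vertex and its degree in the registers `24` and `23`.  The
vertices go to array `5` and the weight to register `26`. -/
def traceProg : Cmd :=
  .seq (.assign 26 (.sub (.sub (.reg 23) (.mul (.lit 2) (.reg 2)))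
    (.mul (.sub (.reg 1) (.lit 1)) (.reg 2)))) <|
  .seq (.write 4 (.add (.mul (.reg 1) (.reg 3)) (.sub (.reg 3) (.lit 1))) (.lit 1)) <|
  forLoop 7 (.reg 1) <|
    .seq (.assign 8 (.sub (.sub (.reg 1) (.lit 1)) (.reg 7))) <|
    .seq (.write 5 (.reg 8) (.reg 24)) <|
    .seq contractLoop <|
    .seq choosePred <|
    .seq (.assign 24 (.reg 27)) (.assign 23 (.reg 28))

section Trace

variable {coin : ℕ → Bool} {n : ℕ} {G : WeightedDigraph n} {k M B D : ℕ} {s s' : State}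

theorem runs_contractLoop (hR : Ready G k M B D s) (hs : s.Bdd B) {c v j : ℕ} {g : ℕ → ℤ}
    (hv : v < n) (hj : j < k) (h8 : s.reg 8 = c) (h24 : s.reg 24 = v)
    (hg : ∀ S, |g S| ≤ (k * (n : ℤ) ^ k) ^ j)
    (h4 : ∀ S < 2 ^ k, s.arr 4 ((c + 1) * 2 ^ k + S) = g S) :
    Runs coin B contractLoop s (2 ^ k * (k * 7 + 9) + 2) fun s' =>
      ∀ S < 2 ^ k, s'.arr 4 (c * 2 ^ k + S) = contract k (vertexVec v) g S := by
  have hB := hR.two_le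
  have hPB := hR.two_pow_le
  have hkD : k * n ^ k ≤ D := le_trans (Nat.le_mul_of_pos_left _ (by omega)) hR.le_D
  have hbound : ∀ S m, m ≤ k → |∑ i ∈ Finset.range m, (1 - (bit S i : ℤ)) * sgn S i *
      vertexVec v i * g (S + (1 - bit S i) * 2 ^ i)| ≤ B := by
    intro S m hm
    refine (abs_contract_le hv hg S m hm).trans ?_
    rw [← pow_succ']
    exact_mod_cast (Nat.pow_le_pow_left hkD (j + 1)).trans (hR.pow_D_le hj)
  refine Runs.mono (a := 2 ^ k * (k * (5 + 2) + 2 + 1 + 1 + 1 + 1 + 1 + 2) + 2) ?_ le_rfl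
    fun _ _ _ h => h
  refine runs_forLoop (a := k * (5 + 2) + 2 + 1 + 1 + 1 + 1 + 1) (N := 2 ^ k)
    (fun T s' => (∀ S < 2 ^ k, s'.arr 4 ((c + 1) * 2 ^ k + S) = g S) ∧
      ∀ S < T, s'.arr 4 (c * 2 ^ k + S) = contract k (vertexVec v) g S) hB hs
    ⟨by decide, by simp [Expr.maxLit]⟩ rfl ?_ hPB ⟨h4, by simp⟩ ?_ ?_
  · intro s' h
    exact (h.1 3 rfl).trans hR.reg3
  · intro S hS s' hb hag h12 hI
    have hreg : ∀ i < 5, s'.reg i = s.reg i := fun i hi => hag.1 i (by interval_cases i <;> rfl)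
    have r1 := (hreg 1 (by omega)).trans hR.reg1
    have r3 := (hreg 3 (by omega)).trans hR.reg3
    have r8 : s'.reg 8 = c := (hag.1 8 rfl).trans h8
    have r24 : s'.reg 24 = v := (hag.1 24 rfl).trans h24
    refine runs_assign_seq (b := k * (5 + 2) + 2 + 1 + 1 + 1 + 1) (z := 0) hB hb
      ⟨by decide, by simp [Expr.maxLit]⟩ rfl (by simp) fun hb₁ => ?_
    refine runs_assign_seq (b := k * (5 + 2) + 2 + 1 + 1 + 1) (z := (S : ℤ)) hB hb₁
      ⟨by decide, by simp [Expr.maxLit]⟩ (by simp [Expr.eval, h12])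
      (abs_natCast_le (by omega)) fun hb₂ => ?_
    refine runs_assign_seq (b := k * (5 + 2) + 2 + 1 + 1) (z := 1) hB hb₂
      ⟨by decide, by simp [Expr.maxLit]; omega⟩ rfl (by simp; omega) fun hb₃ => ?_
    refine runs_assign_seq (b := k * (5 + 2) + 2 + 1) (z := 1) hB hb₃
      ⟨by decide, by simp [Expr.maxLit]; omega⟩ rfl (by simp; omega) fun hb₄ => ?_
    set s₄ := (((s'.setReg 15 0).setReg 17 (S : ℤ)).setReg 18 1).setReg 19 1 with hs₄
    have harr₄ : s₄.arr = s'.arr := rfl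
    have t1 : s₄.reg 1 = k := by simp [hs₄, r1]
    have t3 : s₄.reg 3 = ((2 ^ k : ℕ) : ℤ) := by simp [hs₄, r3]
    have t8 : s₄.reg 8 = c := by simp [hs₄, r8]
    have t12 : s₄.reg 12 = S := by simp [hs₄, h12]
    have t15 : s₄.reg 15 = 0 := by simp [hs₄]
    have t17 : s₄.reg 17 = S := by simp [hs₄]
    have t18 : s₄.reg 18 = 1 := by simp [hs₄]
    have t19 : s₄.reg 19 = 1 := by simp [hs₄]
    have t24 : s₄.reg 24 = v := by simp [hs₄, r24]
    clear_value s₄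
    refine runs_seq (b := 1) (runs_forLoop (a := 5) (N := k) (fun i s' =>
      s'.reg 15 = ∑ i' ∈ Finset.range i, (1 - (bit S i' : ℤ)) * sgn S i' *
        vertexVec v i' * g (S + (1 - bit S i') * 2 ^ i') ∧
      s'.reg 17 = ((S / 2 ^ i : ℕ) : ℤ) ∧ s'.reg 18 = ((2 ^ i : ℕ) : ℤ) ∧
      s'.reg 19 = sgn S i * (v : ℤ) ^ i) hB hb₄ ⟨by decide, by simp [Expr.maxLit]⟩ rfl ?_
      (by have := hR.bounds; omega) ?_ ?_ ?_)
    · intro s'' h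
      exact (h.1 1 rfl).trans t1
    · simp [t15, t17, t18, t19, sgn]
    · rintro i hi s₁ hb₁ hag₁ - ⟨i15, i17, i18, i19⟩
      have u3 : s₁.reg 3 = ((2 ^ k : ℕ) : ℤ) := (hag₁.1 3 rfl).trans t3
      have u8 : s₁.reg 8 = c := (hag₁.1 8 rfl).trans t8
      have u12 : s₁.reg 12 = S := (hag₁.1 12 rfl).trans t12
      have u24 : s₁.reg 24 = v := (hag₁.1 24 rfl).trans t24
      have a4 : s₁.arr 4 = s'.arr 4 := (hag₁.2 4 rfl).trans (congrFun harr₄ 4)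
      have hbit1 : bit S i ≤ 1 := by rcases bit_eq_zero_or_one S i with h | h <;> omega
      refine runs_assign_seq (z := (bit S i : ℤ)) hB hb₁ ⟨by decide, by simp [Expr.maxLit]; omega⟩
        ?_ (abs_natCast_le (by omega)) fun hb₂ => ?_
      · rw [← bit_eq_sub]
        simp [Expr.eval, i17]
      refine runs_assign_seq (z := ∑ i' ∈ Finset.range (i + 1), (1 - (bit S i' : ℤ)) * sgn S i' *
        vertexVec v i' * g (S + (1 - bit S i') * 2 ^ i')) hB hb₂
        ⟨by simp [Expr.size], by simp [Expr.maxLit]; omega⟩ ?_ (hbound S _ hi) fun hb₃ => ?_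
      · rw [Finset.sum_range_succ]
        simp only [Expr.eval, State.setReg_reg, State.setReg_arr, Nat.reduceEqDiff,
          if_true, if_false, i15, i18, i19, u8, u3, u12]
        congr 1
        rcases bit_eq_zero_or_one S i with hb0 | hb1
        · have hlt := add_two_pow_lt hS hi hb0
          rw [a4, hb0, ← hI.1 _ (by simpa using hlt),
            show (((c : ℤ) + 1) * ((2 ^ k : ℕ) : ℤ) + ((S : ℤ) + (1 - ((0 : ℕ) : ℤ)) *
              ((2 ^ i : ℕ) : ℤ))) = (((c + 1) * 2 ^ k + (S + (1 - 0) * 2 ^ i) : ℕ) : ℤ) by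
              push_cast; ring, Int.toNat_natCast, vertexVec]
          ring
        · simp [hb1]
      refine runs_assign_seq (z := sgn S (i + 1) * (v : ℤ) ^ (i + 1)) hB hb₃
        ⟨by decide, by simp [Expr.maxLit]; omega⟩ ?_
        ((abs_sgn_mul_pow_le hv hi).trans (by exact_mod_cast hR.pow_n_le)) fun hb₄ => ?_
      · simp [Expr.eval, i19, u24, sgn_succ, pow_succ]
        ring
      refine runs_assign_seq (z := ((S / 2 ^ (i + 1) : ℕ) : ℤ)) hB hb₄
        ⟨by decide, by simp [Expr.maxLit]; omega⟩ ?_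
        (abs_natCast_le ((Nat.div_le_self _ _).trans (by omega))) fun hb₅ => ?_
      · simp [Expr.eval, i17, pow_succ, ← Nat.div_div_eq_div_mul]
      refine runs_assign_of_eq (z := ((2 ^ (i + 1) : ℕ) : ℤ)) hB hb₅
        ⟨by decide, by simp [Expr.maxLit]; omega⟩ ?_
        (abs_natCast_le ((Nat.pow_le_pow_right (by omega) hi).trans hR.two_pow_le)) ?_
      · simp [Expr.eval, i18, pow_succ]
      · intro _ _
        simp
    · rintro s₂ hb₂ hag₂ - ⟨i15, -⟩ - -
      have u3 : s₂.reg 3 = ((2 ^ k : ℕ) : ℤ) := (hag₂.1 3 rfl).trans t3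
      have u8 : s₂.reg 8 = c := (hag₂.1 8 rfl).trans t8
      have u12 : s₂.reg 12 = S := (hag₂.1 12 rfl).trans t12
      have a4 : s₂.arr 4 = s'.arr 4 := (hag₂.2 4 rfl).trans (congrFun harr₄ 4)
      refine runs_write_of_eq (m := c * 2 ^ k + S) (z := contract k (vertexVec v) g S) hB hb₂
        ⟨by decide, by simp [Expr.maxLit]⟩ ⟨by decide, by simp [Expr.maxLit]⟩ ?_ i15
        (hbound S k le_rfl) ?_
      · simp only [Expr.eval, u8, u3, u12]
        push_cast
        rfl
      · intro _ _
        simp only [State.setReg_arr, State.setArr_arr, true_and, a4]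
        refine ⟨fun S' hS' => ?_, fun S' hS' => ?_⟩
        · rw [if_neg (by rw [add_mul]; omega)]
          exact hI.1 S' hS'
        · by_cases h : S' = S
          · simp [h]
          · rw [if_neg (by omega)]
            exact hI.2 S' (by omega)
  · intro s' _ _ _ h
    exact h.2

/-- The term of the predecessor `u` in the pairing of the walks to `v` with a form; see
`KPath.pairing_table_succ`. -/
def pairTerm (k n M : ℕ) (s : State) (g : ℕ → ℤ) (c v e u : ℕ) : ℤ :=
  s.adj n u v * pairing k g (fun S => s.tab k n M c u S ((e : ℤ) - s.wt n u v - M).toNat)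

theorem runs_choosePred (hR : Ready G k M B D s) (hs : s.Bdd B) {c v e j : ℕ} {g : ℕ → ℤ}
    (hv : v < n) (hjc : j + c ≤ k) (he : e < 2 * M * k + 1) (he' : 2 * M ≤ e)
    (h8 : s.reg 8 = c) (h23 : s.reg 23 = e) (h24 : s.reg 24 = v)
    (hg : ∀ S, |g S| ≤ (D : ℤ) ^ j)
    (h4 : ∀ S < 2 ^ k, s.arr 4 (c * 2 ^ k + S) = g S)
    (h3 : ∀ m, s.arr 3 m = if m < (k + 1) * ((n + 1) * 2 ^ k * (2 * M * k + 1)) then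
        flatTable k n M (s.adj n) (s.wt n) (s.scalar n) m else 0) :
    Runs coin B choosePred s ((n + 1) * (2 ^ k * 3 + 10) + 2) fun s' =>
      (∃ u < n + 1, pairTerm k n M s g c v e u ≠ 0 ∧ s'.reg 27 = u ∧
        s'.reg 28 = (((e : ℤ) - s.wt n u v - M).toNat : ℕ)) ∨
      ∀ u < n + 1, pairTerm k n M s g c v e u = 0 := by
  have hB := hR.two_le
  have hPB := hR.two_pow_le
  have hD := hR.one_le_D
  obtain ⟨hnB, -, hWB, -, -⟩ := hR.bounds
  have hpart : ∀ u d T, T ≤ 2 ^ k →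
      |∑ S ∈ Finset.range T, g S * s.tab k n M c u S d| ≤ B := by
    intro u d T hT
    refine (Finset.abs_sum_le_sum_abs _ _).trans ?_
    calc _ ≤ ∑ S ∈ Finset.range T, (D : ℤ) ^ k * (D : ℤ) ^ k := by
          refine Finset.sum_le_sum fun S _ => ?_
          rw [abs_mul]
          have hD' : (1 : ℤ) ≤ D := by exact_mod_cast hD
          refine mul_le_mul ((hg S).trans ?_) ((hR.tab_le _ _ _ _).trans ?_) (abs_nonneg _)
            (by positivity)
          · exact pow_le_pow_right₀ hD' (by omega)
          · exact pow_le_pow_right₀ hD' (by omega)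
      _ = T * ((D : ℤ) ^ k * (D : ℤ) ^ k) := by simp
      _ ≤ (2 ^ k : ℕ) * ((D : ℤ) ^ k * (D : ℤ) ^ k) := by gcongr
      _ ≤ B := by exact_mod_cast hR.values_le
  refine Runs.mono (a := (n + 1) * (2 ^ k * (1 + 2) + 2 + (2 + 1 + 1) + 1 + 1 + 2) + 2) ?_ le_rfl
    fun _ _ _ h => h
  refine runs_forLoop (a := 2 ^ k * (1 + 2) + 2 + (2 + 1 + 1) + 1 + 1) (N := n + 1)
    (fun m s' => (∃ u < n + 1, pairTerm k n M s g c v e u ≠ 0 ∧ s'.reg 27 = u ∧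
        s'.reg 28 = (((e : ℤ) - s.wt n u v - M).toNat : ℕ)) ∨
      ∀ u < m, pairTerm k n M s g c v e u = 0) hB hs
    ⟨by decide, by simp [Expr.maxLit]; omega⟩ rfl ?_ hnB (.inr (by simp)) ?_ ?_
  · intro s' h
    simp [Expr.eval, h.1 0 rfl, hR.reg0]
  · intro u hu s' hb hag h16 hI
    have hreg : ∀ i < 5, s'.reg i = s.reg i := fun i hi => hag.1 i (by interval_cases i <;> rfl)
    have harr : ∀ a, s'.arr a = s.arr a := fun a => hag.2 a rfl
    have r0 := (hreg 0 (by omega)).trans hR.reg0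
    have r2 := (hreg 2 (by omega)).trans hR.reg2
    have r3 := (hreg 3 (by omega)).trans hR.reg3
    have r4 := (hreg 4 (by omega)).trans hR.reg4
    have r8 : s'.reg 8 = c := (hag.1 8 rfl).trans h8
    have r23 : s'.reg 23 = e := (hag.1 23 rfl).trans h23
    have r24 : s'.reg 24 = v := (hag.1 24 rfl).trans h24
    have haddr : ((u : ℤ) * n + v).toNat = u * n + v := by
      rw [show (u : ℤ) * n + v = ((u * n + v : ℕ) : ℤ) by push_cast; ring, Int.toNat_natCast]
    have hadj : s'.arr 0 (u * n + v) = s.adj n u v := congrFun (harr 0) _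
    have hwt : s'.arr 1 (u * n + v) = s.wt n u v := congrFun (harr 1) _
    have hadj01 := hR.encodes.adj_eq_zero_or_one (show u ≤ n by omega) hv
    obtain ⟨d, hd, hdW⟩ : ∃ d : ℕ, s.adj n u v * ((e : ℤ) - s.wt n u v - M) = d ∧
        d < 2 * M * k + 1 := by
      rcases hadj01 with h | h
      · exact ⟨0, by simp [h], by omega⟩
      · have := hR.encodes.wt_bounds hR.weights (show u ≤ n by omega) hv (by rw [h]; simp)
        exact ⟨((e : ℤ) - s.wt n u v - M).toNat, by rw [h, one_mul]; omega, by omega⟩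
    have hterm : pairTerm k n M s g c v e u =
        s.adj n u v * ∑ S ∈ Finset.range (2 ^ k), g S * s.tab k n M c u S d := by
      rcases hadj01 with h | h
      · simp [pairTerm, h]
      · rw [h, one_mul] at hd
        rw [pairTerm, pairing, hd, Int.toNat_natCast]
    refine runs_assign_seq (z := (d : ℤ)) hB hb ⟨by simp [Expr.size], by simp [Expr.maxLit]⟩ ?_
      (abs_natCast_le (by omega)) fun hb₁ => ?_
    · simp only [Expr.eval, h16, r0, r24, r23, r2, haddr, hadj, hwt, hd]
    refine runs_assign_seq (b := 2 ^ k * (1 + 2) + 2 + (2 + 1 + 1)) (z := 0) hB hb₁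
      ⟨by decide, by simp [Expr.maxLit]⟩ rfl (by simp) fun hb₂ => ?_
    set s₂ := (s'.setReg 29 (d : ℤ)).setReg 15 0 with hs₂
    have hreg₂ : ∀ i, i ≠ 15 → i ≠ 29 → s₂.reg i = s'.reg i := fun i h h' => by simp [hs₂, h, h']
    have t15 : s₂.reg 15 = 0 := by simp [hs₂]
    have t29 : s₂.reg 29 = d := by simp [hs₂]
    have harr₂ : ∀ a, s₂.arr a = s.arr a := harr
    clear_value s₂
    refine runs_seq (runs_forLoop (a := 1) (N := 2 ^ k) (fun T s'' =>
      s''.reg 15 = ∑ S ∈ Finset.range T, g S * s.tab k n M c u S d) hB hb₂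
      ⟨by decide, by simp [Expr.maxLit]⟩ rfl ?_ hPB (by simp [t15]) ?_ ?_)
    · intro s'' h
      exact (h.1 3 rfl).trans ((hreg₂ 3 (by decide) (by decide)).trans r3)
    · intro S hS s₃ hb₃ hag₃ h12 i15
      have q : ∀ i, i ≠ 15 → i ≠ 29 → i ≠ 12 → s₃.reg i = s'.reg i := fun i h h' h'' =>
        (hag₃.1 i (by simp [forLoop_writesReg, Cmd.writesReg, Ne.symm h, Ne.symm h''])).trans
          (hreg₂ i h h')
      have u0 := (q 0 (by decide) (by decide) (by decide)).trans r0
      have u3 := (q 3 (by decide) (by decide) (by decide)).trans r3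
      have u4 := (q 4 (by decide) (by decide) (by decide)).trans r4
      have u8 := (q 8 (by decide) (by decide) (by decide)).trans r8
      have u16 := (q 16 (by decide) (by decide) (by decide)).trans h16
      have u29 : s₃.reg 29 = d := (hag₃.1 29 rfl).trans t29
      have b3 : s₃.arr 3 = s.arr 3 := (hag₃.2 3 rfl).trans (harr₂ 3)
      have b4 : s₃.arr 4 = s.arr 4 := (hag₃.2 4 rfl).trans (harr₂ 4)
      have hcell : s.arr 3 (cellIdx k n M c u S d) = s.tab k n M c u S d := by
        have h1 := cellIdx_lt (c := c) hu hS hdW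
        have h2 : (c + 1) * ((n + 1) * 2 ^ k * (2 * M * k + 1)) ≤
            (k + 1) * ((n + 1) * 2 ^ k * (2 * M * k + 1)) := by gcongr; omega
        rw [h3, if_pos (h1.trans_le h2), flatTable_cellIdx hu hS hdW]
        rfl
      refine runs_assign_of_eq hB hb₃ ⟨by simp [Expr.size], by simp [Expr.maxLit]; omega⟩ ?_
        (hpart u d (S + 1) hS) ?_
      · rw [Finset.sum_range_succ, ← i15, ← h4 S hS, ← hcell]
        simp only [Expr.eval, u0, u3, u4, u8, u16, u29, h12, b3, b4]
        have e1 : (c : ℤ) * ((2 ^ k : ℕ) : ℤ) + S = ((c * 2 ^ k + S : ℕ) : ℤ) := by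
          push_cast; ring
        have e2 : (((c : ℤ) * ((n : ℤ) + 1) + u) * ((2 ^ k : ℕ) : ℤ) + S) *
            ((2 * M * k + 1 : ℕ) : ℤ) + d = (cellIdx k n M c u S d : ℤ) := by
          rw [cellIdx]; push_cast; ring
        rw [e1, e2, Int.toNat_natCast, Int.toNat_natCast]
      · intro _ _
        simp
    · rintro s₃ hb₃ hag₃ - i15 - -
      have q : ∀ i, i ≠ 15 → i ≠ 29 → i ≠ 12 → s₃.reg i = s'.reg i := fun i h h' h'' =>
        (hag₃.1 i (by simp [forLoop_writesReg, Cmd.writesReg, Ne.symm h, Ne.symm h''])).trans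
          (hreg₂ i h h')
      have u0 := (q 0 (by decide) (by decide) (by decide)).trans r0
      have u24 := (q 24 (by decide) (by decide) (by decide)).trans r24
      have u16 := (q 16 (by decide) (by decide) (by decide)).trans h16
      have u29 : s₃.reg 29 = d := (hag₃.1 29 rfl).trans t29
      have b0 : s₃.arr 0 (u * n + v) = s.adj n u v :=
        congrFun ((hag₃.2 0 rfl).trans (harr₂ 0)) _
      refine runs_assign_seq (b := 2 + 1) (z := pairTerm k n M s g c v e u) hB hb₃
        ⟨by simp [Expr.size], by simp [Expr.maxLit]⟩ ?_ ?_ fun hb₄ => ?_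
      · simp only [Expr.eval, u0, u16, u24, haddr, b0, i15, hterm]
      · rw [hterm]
        rcases hadj01 with h | h
        · simp [h]
        · rw [h, one_mul]
          exact hpart u d _ le_rfl
      refine runs_branch (a := 2) hB hb₄ ⟨by decide, by simp [Expr.maxLit]⟩ (fun hev => ?_)
        fun hev => ?_
      · have hne : pairTerm k n M s g c v e u ≠ 0 := by
          intro h
          simp [Expr.eval, h] at hev
        have hadj1 : s.adj n u v = 1 := hadj01.resolve_left fun h => hne (by simp [hterm, h])
        rw [hadj1, one_mul] at hd
        refine runs_assign_seq (z := (u : ℤ)) hB hb₄ ⟨by decide, by simp [Expr.maxLit]⟩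
          (by simp [Expr.eval, u16]) (abs_natCast_le (by omega)) fun hb₅ => ?_
        refine runs_assign_of_eq (z := (d : ℤ)) hB hb₅ ⟨by decide, by simp [Expr.maxLit]⟩
          (by simp [Expr.eval, u29]) (abs_natCast_le (by omega)) ?_
        intro _ _
        exact .inl ⟨u, hu, hne, by simp, by rw [hd, Int.toNat_natCast]; simp⟩
      · have h0 : pairTerm k n M s g c v e u = 0 := by
          by_contra h
          have := mul_self_pos.2 h
          simp only [Expr.eval, State.setReg_reg, if_true] at hev
          omega
        refine (runs_skip hb₄ (Q := fun s'' => s'' = _) rfl).mono (by omega) ?_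
        rintro _ - - rfl - -
        rcases hI with ⟨u', hu', hne', h27, h28⟩ | hI
        · have u27 := (q 27 (by decide) (by decide) (by decide)).trans h27
          have u28 := (q 28 (by decide) (by decide) (by decide)).trans h28
          exact .inl ⟨u', hu', hne', by simpa using u27, by simpa using u28⟩
        · refine .inr fun u' hu' => ?_
          rcases Nat.lt_succ_iff_lt_or_eq.1 hu' with h | rfl
          · exact hI u' h
          · exact h0
  · intro s' _ _ _ h
    exact h

theorem runs_traceProg (hR : Ready G k M B D s) (hs : s.Bdd B) {v e : ℕ}
    (he : e < 2 * M * k + 1) (h23 : s.reg 23 = e) (h24 : s.reg 24 = v)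
    (hne : s.tab k n M k v (2 ^ k - 1) e ≠ 0) (h4 : ∀ m, s.arr 4 m = 0)
    (h3 : ∀ m, s.arr 3 m = if m < (k + 1) * ((n + 1) * 2 ^ k * (2 * M * k + 1)) then
        flatTable k n M (s.adj n) (s.wt n) (s.scalar n) m else 0) :
    Runs coin B traceProg s
      (k * (2 ^ k * (k * 7 + 9) + (n + 1) * (2 ^ k * 3 + 10) + 10) + 4) fun s' =>
      s'.reg 26 = (e : ℤ) - 2 * M - ((k : ℤ) - 1) * M ∧
      ∃ l : List (Fin n), G.IsKPath k l ∧
        G.pathWeight l = (e : ℤ) - 2 * M - ((k : ℤ) - 1) * M ∧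
        ∀ i (h : i < l.length), s'.arr 5 i = ((l[i] : Fin n) : ℕ) := by
  have hB := hR.two_le
  have hPB := hR.two_pow_le
  have hD := hR.one_le_D
  obtain ⟨hnB, hkB, hWB, -, hMB⟩ := hR.bounds
  have hP : 1 ≤ 2 ^ k := Nat.one_le_two_pow
  have hk := hR.k_pos
  have hkD : k * n ^ k ≤ D := le_trans (Nat.le_mul_of_pos_left _ (by omega)) hR.le_D
  have htr : Trace k n M (s.adj n) (s.wt n) (s.scalar n) e k v e [] := Trace.start hne
  have he2 : 2 * M ≤ e := by
    obtain ⟨k', rfl⟩ : ∃ k', k = k' + 1 := ⟨k - 1, by omega⟩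
    exact htr.lt_and_le.2
  obtain ⟨a₁, ha₁⟩ : ∃ a, a = 2 ^ k * (k * 7 + 9) + 2 := ⟨_, rfl⟩
  obtain ⟨a₂, ha₂⟩ : ∃ a, a = (n + 1) * (2 ^ k * 3 + 10) + 2 := ⟨_, rfl⟩
  refine Runs.mono (a := 1 + (k * (a₁ + (a₂ + 2) + 1 + 1 + 2) + 2) + 1) ?_
    (le_of_eq (by rw [ha₁, ha₂]; ring)) fun _ _ _ h => h
  refine runs_assign_seq (b := 1 + (k * (a₁ + (a₂ + 2) + 1 + 1 + 2) + 2))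
    (z := (e : ℤ) - 2 * M - ((k : ℤ) - 1) * M) hB hs ⟨by simp [Expr.size],
      by simp [Expr.maxLit]; omega⟩ ?_ ?_ fun hb₁ => ?_
  · simp [Expr.eval, h23, hR.reg1, hR.reg2]
  · obtain ⟨k', rfl⟩ : ∃ k', k = k' + 1 := ⟨k - 1, by omega⟩
    have h1 : 2 * M * (k' + 1) = 2 * (k' * M) + 2 * M := by ring
    have h2 : (((k' + 1 : ℕ) : ℤ) - 1) * M = ((k' * M : ℕ) : ℤ) := by push_cast; ring
    rw [h2, abs_le]
    omega
  refine runs_seq (runs_write_of_eq (m := k * 2 ^ k + (2 ^ k - 1)) (z := 1) hB hb₁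
    ⟨by decide, by simp [Expr.maxLit]; omega⟩ ⟨by decide, by simp [Expr.maxLit]; omega⟩ ?_ rfl
    (by simp; omega) ?_)
  · simp only [Expr.eval, State.setReg_reg, Nat.reduceEqDiff, if_false, hR.reg1, hR.reg3]
    push_cast [hP]
    ring
  intro hb₂ _
  set s₂ := (s.setReg 26 ((e : ℤ) - 2 * M - ((k : ℤ) - 1) * M)).setArr 4 (k * 2 ^ k + (2 ^ k - 1)) 1
    with hs₂
  have hreg₂ : ∀ i, i ≠ 26 → s₂.reg i = s.reg i := fun i hi => by simp [hs₂, hi]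
  have t26 : s₂.reg 26 = (e : ℤ) - 2 * M - ((k : ℤ) - 1) * M := by simp [hs₂]
  have harr₂ : ∀ a, a ≠ 4 → s₂.arr a = s.arr a := fun a ha => by
    funext x; simp [hs₂, ha]
  have t4 : ∀ m, s₂.arr 4 m = if m = k * 2 ^ k + (2 ^ k - 1) then 1 else s.arr 4 m :=
    fun m => by simp [hs₂]
  clear_value s₂
  refine runs_forLoop (a := a₁ + (a₂ + 2) + 1 + 1) (N := k) (fun j s' => ∃ (v' e' : ℕ) (l : List ℕ),
      Trace k n M (s.adj n) (s.wt n) (s.scalar n) e (k - j) v' e' l ∧ s'.reg 24 = v' ∧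
      s'.reg 23 = e' ∧ e' < 2 * M * k + 1 ∧
      (∀ S < 2 ^ k, s'.arr 4 ((k - j) * 2 ^ k + S) = suffixForm k l S) ∧
      ∀ i (h : i < l.length), s'.arr 5 (k - j + i) = ((l[i] : ℕ) : ℤ)) hB hb₂
    ⟨by decide, by simp [Expr.maxLit]⟩ rfl ?_ (by omega) ?_ ?_ ?_
  · intro s' h
    exact (h.1 1 rfl).trans ((hreg₂ 1 (by decide)).trans hR.reg1)
  · refine ⟨v, e, [], by simpa using htr, ?_, ?_, he, fun S hS => ?_, by simp⟩
    · rw [State.setReg_reg, if_neg (by decide), hreg₂ 24 (by decide), h24]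
    · rw [State.setReg_reg, if_neg (by decide), hreg₂ 23 (by decide), h23]
    · rw [State.setReg_arr, t4, h4, suffixForm, List.foldr_nil, Pi.single_apply]
      refine if_congr ?_ rfl rfl
      rw [Nat.sub_zero]
      omega
  · rintro j hj s' hb hag h7 ⟨v', e', l, ht, r24, r23, he', i4, i5⟩
    obtain ⟨c, hc⟩ : ∃ c, k = c + 1 + j := ⟨k - 1 - j, by omega⟩
    have hkj : k - j = c + 1 := by omega
    have hkj' : k - (j + 1) = c := by omega
    rw [hkj] at ht i4 i5
    rw [hkj']
    obtain ⟨hv', h2e'⟩ := ht.lt_and_le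
    have hlen : l.length = j := by have := ht.length; omega
    have hreg : ∀ i < 5, s'.reg i = s.reg i := fun i hi =>
      (hag.1 i (by interval_cases i <;> rfl)).trans (hreg₂ i (by omega))
    have harr : ∀ a < 4, s'.arr a = s.arr a := fun a ha =>
      (hag.2 a (by interval_cases a <;> rfl)).trans (harr₂ a (by omega))
    have r1 := (hreg 1 (by omega)).trans hR.reg1
    refine runs_assign_seq (b := a₁ + (a₂ + 2) + 1) (z := (c : ℤ)) hB hb
      ⟨by decide, by simp [Expr.maxLit]; omega⟩ ?_ (abs_natCast_le (by omega)) fun hb₃ => ?_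
    · simp only [Expr.eval, r1, h7]
      omega
    rw [add_comm]
    refine runs_seq (runs_write_of_eq (m := c) (z := (v' : ℤ)) hB hb₃
      ⟨by decide, by simp [Expr.maxLit]⟩ ⟨by decide, by simp [Expr.maxLit]⟩
      (by simp [Expr.eval]) (by simp [Expr.eval, r24]) (abs_natCast_le (by omega)) ?_)
    intro hb₄ _
    set s₄ := (s'.setReg 8 (c : ℤ)).setArr 5 c (v' : ℤ) with hs₄
    have hreg₄ : ∀ i, i ≠ 8 → s₄.reg i = s'.reg i := fun i hi => by simp [hs₄, hi]
    have t8 : s₄.reg 8 = c := by simp [hs₄]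
    have harr₄ : ∀ a, a ≠ 5 → s₄.arr a = s'.arr a := fun a ha => by
      funext x; simp [hs₄, ha]
    have t5 : ∀ m, s₄.arr 5 m = if m = c then (v' : ℤ) else s'.arr 5 m := fun m => by simp [hs₄]
    clear_value s₄
    have hR₄ : Ready G k M B D s₄ := hR.congr
      (fun i hi => (hreg₄ i (by omega)).trans (hreg i hi))
      fun a ha => (harr₄ a (by omega)).trans (harr a (by omega))
    have hl : ∀ w ∈ l, w < n := ht.lt
    have hvl : ∀ w ∈ v' :: l, w < n := by
      intro w hw
      rcases List.mem_cons.1 hw with rfl | hw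
      · exact hv'
      · exact hl w hw
    refine runs_seq ((runs_contractLoop hR₄ hb₄ (c := c) (v := v') (j := j) (g := suffixForm k l)
      hv' hj t8 ((hreg₄ 24 (by decide)).trans r24) (fun S => hlen ▸ abs_suffixForm_le hl S)
      fun S hS => ?_).mono ha₁.ge ?_)
    · rw [harr₄ 4 (by decide)]
      exact i4 S hS
    intro s₅ hb₅ hag₅ h4₅ _ _
    have hreg₅ : ∀ i < 5, s₅.reg i = s.reg i := fun i hi =>
      (hag₅.1 i (by interval_cases i <;> rfl)).trans ((hreg₄ i (by omega)).trans (hreg i hi))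
    have harr₅ : ∀ a < 4, s₅.arr a = s.arr a := fun a ha =>
      (hag₅.2 a (by interval_cases a <;> rfl)).trans
        ((harr₄ a (by omega)).trans (harr a (by omega)))
    have hR₅ : Ready G k M B D s₅ := hR.congr hreg₅ fun a ha => harr₅ a (by omega)
    have e0 : s₅.adj n = s.adj n := State.adj_congr (harr₅ 0 (by omega))
    have e1 : s₅.wt n = s.wt n := State.wt_congr (harr₅ 1 (by omega))
    have e2 : s₅.scalar n = s.scalar n := State.scalar_congr (harr₅ 2 (by omega))
    have et : s₅.tab k n M = s.tab k n M := tab_congr fun a ha => harr₅ a (by omega)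
    have hpt : ∀ u, pairTerm k n M s₅ (suffixForm k (v' :: l)) c v' e' u =
        pairTerm k n M s (suffixForm k (v' :: l)) c v' e' u := fun u => by
      rw [pairTerm, pairTerm, e0, e1, et]
    refine runs_seq ((runs_choosePred hR₅ hb₅ (c := c) (v := v') (e := e') (j := j + 1)
      (g := suffixForm k (v' :: l)) hv' (by omega) he' h2e' ((hag₅.1 8 rfl).trans t8)
      ((hag₅.1 23 rfl).trans ((hreg₄ 23 (by decide)).trans r23))
      ((hag₅.1 24 rfl).trans ((hreg₄ 24 (by decide)).trans r24)) (fun S => ?_) h4₅ ?_).mono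
      ha₂.ge ?_)
    · refine (abs_suffixForm_le hvl S).trans ?_
      rw [List.length_cons, hlen]
      exact_mod_cast Nat.pow_le_pow_left hkD (j + 1)
    · rw [harr₅ 3 (by omega), e0, e1, e2]
      exact h3
    intro s₆ hb₆ hag₆ hch _ _
    simp only [hpt, e1] at hch
    rcases hch with ⟨u, hu, hne', r27, r28⟩ | hch
    · have ht' := ht.step hR.encodes hR.weights hu hne'
      have hadj : s.adj n u v' ≠ 0 := left_ne_zero_of_mul hne'
      have hwb := hR.encodes.wt_bounds hR.weights (show u ≤ n by omega) hv' hadj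
      refine runs_assign_seq (b := 1) (z := (u : ℤ)) hB hb₆ ⟨by decide, by simp [Expr.maxLit]⟩ r27
        (abs_natCast_le (by omega)) fun hb₇ => ?_
      refine runs_assign_of_eq (z := ((((e' : ℤ) - s.wt n u v' - M).toNat : ℕ) : ℤ)) hB hb₇
        ⟨by decide, by simp [Expr.maxLit]⟩ (by simp [Expr.eval, r28])
        (abs_natCast_le (by omega)) ?_
      intro _ _
      refine ⟨u, _, v' :: l, ht', by simp, by simp, by omega, fun S hS => ?_, fun i h => ?_⟩
      · exact (congrFun (hag₆.2 4 rfl) _).trans (h4₅ S hS)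
      · have h5 : s₆.arr 5 = s₄.arr 5 := (hag₆.2 5 rfl).trans (hag₅.2 5 rfl)
        simp only [State.setReg_arr, h5, t5]
        cases i with
        | zero => simp
        | succ i =>
          rw [if_neg (by omega), List.getElem_cons_succ,
            ← i5 i (by rw [List.length_cons] at h; omega)]
          congr 1
          omega
    · obtain ⟨u, hu, hne'⟩ := ht.exists_pred
      exact absurd (hch u hu) hne'
  · rintro s' - hag - ⟨v', e', l, ht, -, -, -, -, i5⟩
    rw [Nat.sub_self] at ht
    obtain ⟨l', hl', rfl, hw⟩ := ht.finish hR.encodes hk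
    refine ⟨(hag.1 26 rfl).trans t26, l', hl', hw, fun i h => ?_⟩
    have := i5 i (by simpa using h)
    simpa using this

end Trace

end RAM

/-! ### The complete program -/

namespace RAM

open KPath

/-- Copies the path to array `0` and sets the output registers. -/
def outputProg : Cmd :=
  .seq (forLoop 7 (.reg 1) (.write 0 (.reg 7) (.read 5 (.reg 7)))) <|
    .seq (.assign 1 (.reg 26)) (.assign 0 (.reg 22))

/-- The randomized algorithm for minimum-weight `k`-paths, with error probability at most
`n ^ (-c)`. -/
def solveProg (c : ℕ) : Cmd :=
  .seq sizesProg <| .seq (bitsProg c) <| .seq tossProg <| .seq sourceProg <|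
  .seq (.write 3 (.add (.mul (.mul (.reg 0) (.reg 3)) (.reg 4)) (.mul (.lit 2) (.reg 2)))
    (.lit 1)) <|
  .seq tableProg <| .seq searchProg <| .seq (.branch (.reg 22) traceProg .skip) outputProg

/-- The adjacency function of the graph with the additional source. -/
noncomputable def instAdj {n : ℕ} (G : WeightedDigraph n) (u v : ℕ) : ℤ :=
  if n * n ≤ u * n + v ∧ u * n + v < n * n + n then 1 else (G.input 0 0).arr 0 (u * n + v)

/-- The weight function of the graph with the additional source. -/
noncomputable def instWt {n : ℕ} (G : WeightedDigraph n) (M : ℕ) (u v : ℕ) : ℤ :=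
  if n * n ≤ u * n + v ∧ u * n + v < n * n + n then -(M : ℤ) else (G.input 0 0).arr 1 (u * n + v)

/-- The coin tosses, grouped into `N` words of `t` bits. -/
def coinBits (N t : ℕ) (coin : ℕ → Bool) (m : Fin N) (b : Fin t) : Bool := coin (m * t + b)

/-- The number with the binary digits `f`. -/
def bitsVal {t : ℕ} (f : Fin t → Bool) : ℤ :=
  binVal (fun b => if h : b < t then f ⟨b, h⟩ else false) t

theorem binVal_congr {f g : ℕ → Bool} {t : ℕ} (h : ∀ b < t, f b = g b) :
    binVal f t = binVal g t := by
  induction t with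
  | zero => rfl
  | succ t ih => rw [binVal, binVal, ih fun b hb => h b (by omega), h t (by omega)]

theorem bitsVal_injective {t : ℕ} : Function.Injective (bitsVal (t := t)) := by
  intro f g h
  funext b
  have := binVal_inj h b b.2
  simpa using this

section Instance

variable {n : ℕ} {G : WeightedDigraph n} {k M : ℕ}

theorem encodes_inst : Encodes G M (instAdj G) (instWt G M) := by
  have hidx : ∀ i j : Fin n, (i : ℕ) * n + j < n * n := fun i j => by
    have := Nat.mul_le_mul_right n (show (i : ℕ) + 1 ≤ n from i.2)
    rw [add_mul, one_mul] at this
    omega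
  have hdiv : ∀ i j : Fin n, ((i : ℕ) * n + j) / n = i := fun i j => by
    rw [add_comm, Nat.add_mul_div_right _ _ i.pos, Nat.div_eq_of_lt j.2, zero_add]
  have hmod : ∀ i j : Fin n, ((i : ℕ) * n + j) % n = j := fun i j => by
    rw [add_comm, Nat.add_mul_mod_self_right, Nat.mod_eq_of_lt j.2]
  have hno : ∀ i j : Fin n, ¬ (n * n ≤ (i : ℕ) * n + j ∧ (i : ℕ) * n + j < n * n + n) :=
    fun i j h => absurd h.1 (not_le.2 (hidx i j))
  constructor
  · intro i j h
    simp [instAdj, hno i j, WeightedDigraph.input, hidx i j, hdiv i j, hmod i j, h]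
  · intro i j h
    simp [instAdj, hno i j, WeightedDigraph.input, hidx i j, hdiv i j, hmod i j, h]
  · intro i j h
    simp [instWt, hno i j, WeightedDigraph.input, hidx i j, hdiv i j, hmod i j, h]
  · intro j hj
    simp [instAdj, hj]
  · intro j hj
    simp [instWt, hj]

theorem input_bdd {B : ℕ} (hw : G.WeightsIn M) (hn : n ≤ B) (hk : k ≤ B) (hM : M ≤ B)
    (hB : 1 ≤ B) : (G.input k M).Bdd B := by
  refine ⟨fun i => ?_, fun a m => ?_⟩
  · simp only [WeightedDigraph.input]
    split_ifs
    · exact abs_natCast_le hn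
    · exact abs_natCast_le hk
    · exact abs_natCast_le hM
    · simp
  · simp only [WeightedDigraph.input]
    split_ifs with h1 h2
    · simp; omega
    · have := hw _ _ h2
      rw [abs_le]
      omega
    all_goals simp

theorem abs_pathWeight_le (hw : G.WeightsIn M) {l : List (Fin n)} (hl : l.IsChain G.Adj) :
    |G.pathWeight l| ≤ ((l.length - 1 : ℕ) : ℤ) * M := by
  induction l with
  | nil => simp [WeightedDigraph.pathWeight]
  | cons i l ih =>
    cases l with
    | nil => simp [WeightedDigraph.pathWeight]
    | cons j l =>
      rw [List.isChain_cons_cons] at hl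
      rw [G.pathWeight_cons_cons]
      have h1 := ih hl.2
      have h2 : |G.wt i j| ≤ M := abs_le.2 (hw i j hl.1)
      refine (abs_add_le _ _).trans ?_
      simp only [List.length_cons, Nat.add_sub_cancel] at h1 ⊢
      push_cast
      linarith

theorem exists_isMinWeight (hw : G.WeightsIn M) (h : ∃ l, G.IsKPath k l) :
    ∃ d, G.IsMinWeight k d := by
  obtain ⟨l, hl⟩ := h
  obtain ⟨d, hd, hmin⟩ := Int.exists_least_of_bdd
    (P := fun z => ∃ l, G.IsKPath k l ∧ G.pathWeight l = z)
    ⟨-(((k - 1 : ℕ) : ℤ) * M), by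
      rintro z ⟨l, hl, rfl⟩
      have := abs_pathWeight_le hw hl.2.2
      rw [hl.1] at this
      exact (abs_le.1 this).1⟩ ⟨_, l, hl, rfl⟩
  exact ⟨d, hd, fun z hz => hmin z hz⟩

/-- If some entry of the degree of a minimum path is not zero, the least degree found gives the
right answers. -/
theorem answers_of_searched (hw : G.WeightsIn M) (hk : 1 ≤ k) {X : ℕ → ℕ → ℤ} {s : State}
    (hhit : ∀ d, G.IsMinWeight k d →
      ∃ v < n, X (d + ((k : ℤ) - 1) * M + 2 * M).toNat v ≠ 0)
    (h : (s.reg 0 = 0 ∧ ∀ e v : ℕ, e < 2 * M * k + 1 ∧ v < n → X e v = 0) ∨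
      (s.reg 0 = 1 ∧ ∃ e : ℕ,
        (∀ e' v : ℕ, e' < 2 * M * k + 1 ∧ v < n → e' < e → X e' v = 0) ∧
        s.reg 1 = (e : ℤ) - 2 * M - ((k : ℤ) - 1) * M ∧
        ∃ l : List (Fin n), G.IsKPath k l ∧
          G.pathWeight l = (e : ℤ) - 2 * M - ((k : ℤ) - 1) * M ∧
          ∀ i (h : i < l.length), s.arr 0 i = ((l[i] : Fin n) : ℕ))) :
    G.WeightAnswer k s ∧ G.PathAnswer k s := by
  have hbd : ∀ d, G.IsMinWeight k d → 0 ≤ d + ((k : ℤ) - 1) * M ∧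
      (d + ((k : ℤ) - 1) * M + 2 * M).toNat < 2 * M * k + 1 := by
    rintro d ⟨⟨l, hl, rfl⟩, -⟩
    have h1 := abs_le.1 (abs_pathWeight_le hw hl.2.2)
    rw [hl.1] at h1
    push_cast [hk] at h1
    refine ⟨by linarith, ?_⟩
    have h2 : G.pathWeight l + ((k : ℤ) - 1) * M + 2 * M ≤ ((2 * M * k : ℕ) : ℤ) := by
      push_cast; linarith
    omega
  rcases h with ⟨h0, hz⟩ | ⟨h0, e, hmin, h1, l, hl, hlw, harr⟩
  · have hno : ¬ ∃ l, G.IsKPath k l := by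
      intro hex
      obtain ⟨d, hd⟩ := exists_isMinWeight hw hex
      obtain ⟨v, hv, hne⟩ := hhit d hd
      exact hne (hz _ _ ⟨(hbd d hd).2, hv⟩)
    exact ⟨.inr ⟨h0, hno⟩, .inr ⟨h0, hno⟩⟩
  · obtain ⟨d, hd⟩ := exists_isMinWeight hw ⟨l, hl⟩
    obtain ⟨v, hv, hne⟩ := hhit d hd
    have hb := hbd d hd
    have hle : d ≤ (e : ℤ) - 2 * M - ((k : ℤ) - 1) * M := hd.2 ⟨l, hl, hlw⟩
    have heq : d = (e : ℤ) - 2 * M - ((k : ℤ) - 1) * M := by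
      refine le_antisymm hle ?_
      by_contra hlt
      exact hne (hmin _ _ ⟨hb.2, hv⟩ (by omega))
    subst heq
    exact ⟨.inl ⟨h0, by rw [h1]; exact hd⟩, .inl ⟨h0, l, hl, by rw [hlw]; exact hd, harr⟩⟩

end Instance

/-- Whether a program contains a coin toss. -/
def Cmd.tosses : Cmd → Bool
  | .skip => false
  | .assign _ _ => false
  | .write _ _ _ => false
  | .toss _ => true
  | .seq p q => p.tosses || q.tosses
  | .branch _ p q => p.tosses || q.tosses
  | .loop _ p => p.tosses

theorem Exec.tossed_eq {coin : ℕ → Bool} {p : Cmd} {s s' : State} {t : ℕ}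
    (h : Exec coin p s s' t) (hp : p.tosses = false) : s'.tossed = s.tossed := by
  induction h with
  | skip | assign | write | loop_neg => rfl
  | toss => simp [Cmd.tosses] at hp
  | seq _ _ ih₁ ih₂ =>
    simp only [Cmd.tosses, Bool.or_eq_false_iff] at hp
    exact (ih₂ hp.2).trans (ih₁ hp.1)
  | branch_pos _ _ ih =>
    simp only [Cmd.tosses, Bool.or_eq_false_iff] at hp
    exact ih hp.1
  | branch_neg _ _ ih =>
    simp only [Cmd.tosses, Bool.or_eq_false_iff] at hp
    exact ih hp.2
  | loop_pos _ _ _ ih₁ ih₂ => exact (ih₂ hp).trans (ih₁ hp)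

theorem Runs.tossed {coin : ℕ → Bool} {B a : ℕ} {p : Cmd} {s : State} {Q : State → Prop}
    (h : Runs coin B p s a Q) (hp : p.tosses = false) :
    Runs coin B p s a fun s' => s'.tossed = s.tossed ∧ Q s' := by
  obtain ⟨s', t, he, ht, hb, hq⟩ := h
  exact ⟨s', t, he, ht, hb, he.tossed_eq hp, hq⟩

section Solve

variable {coin : ℕ → Bool} {n : ℕ} {G : WeightedDigraph n} {k M B c : ℕ}

theorem runs_outputProg {s : State} (hB : 2 ≤ B) (hs : s.Bdd B) (h1 : s.reg 1 = k) (hkB : k ≤ B) :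
    Runs coin B outputProg s (k * 3 + 4) fun s' => s'.reg 0 = s.reg 22 ∧ s'.reg 1 = s.reg 26 ∧
      ∀ i < k, s'.arr 0 i = s.arr 5 i := by
  refine runs_seq (a := k * (1 + 2) + 2) (b := 1 + 1) (runs_forLoop (a := 1) (N := k)
    (fun j s' => ∀ i < j, s'.arr 0 i = s.arr 5 i) hB hs ⟨by decide, by simp [Expr.maxLit]⟩ rfl
    ?_ hkB (by simp) ?_ ?_)
  · intro s' h
    exact (h.1 1 rfl).trans h1
  · intro j hj s' hb hag h7 hI
    have a5 : s'.arr 5 = s.arr 5 := hag.2 5 rfl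
    refine runs_write_of_eq (m := j) (z := s.arr 5 j) hB hb ⟨by decide, by simp [Expr.maxLit]⟩
      ⟨by decide, by simp [Expr.maxLit]⟩ h7 (by simp [Expr.eval, h7, a5]) (hs.2 5 j) ?_
    intro _ _ i hi
    simp only [State.setReg_arr, State.setArr_arr, true_and]
    split_ifs with h
    · rw [h]
    · exact hI i (by omega)
  · intro s' hb hag _ hI _ _
    have r22 : s'.reg 22 = s.reg 22 := hag.1 22 rfl
    have r26 : s'.reg 26 = s.reg 26 := hag.1 26 rfl
    refine runs_assign_seq (b := 1) hB hb ⟨by decide, by simp [Expr.maxLit]⟩ r26 (hs.1 26)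
      fun hb₁ => ?_
    refine runs_assign_of_eq (z := s.reg 22) hB hb₁ ⟨by decide, by simp [Expr.maxLit]⟩
      (by simp [Expr.eval, r22]) (hs.1 22) ?_
    exact ⟨by simp, by simp, hI⟩

/-- The number of steps of the program, on random numbers of `t` bits. -/
def solveSteps (c n k M t : ℕ) : ℕ :=
  (3 * k + 4) + ((3 * c + 3 * t + 6) + ((k * (n + 1) * (3 * t * 2 + 6) + 2) + ((4 * n + 2) + (1 +
    ((k * ((n + 1) * 2 ^ k * (2 * M * k + 1)) * ((n + 1) * (k * 7 + 7) + 14) + 2) +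
      (((2 * M * k + 1) * (n * 7 + 4) + 3) +
        ((k * (2 ^ k * (k * 7 + 9) + (n + 1) * (2 ^ k * 3 + 10) + 10) + 4 + 1) +
          (k * 3 + 4))))))))

/-- Every run of the program is bounded in time and space, and it gives the right answers unless
all entries of the degree of a minimum path vanish. -/
theorem runs_solveProg (hw : G.WeightsIn M) (hn : 1 ≤ n) (hk : 1 ≤ k) {t D : ℕ}
    (ht : t = Nat.size (k * n ^ c)) (hD : D = 2 ^ t * ((n + 1) * (k * n ^ k))) (hB : 2 ≤ B)
    (hcB : c ≤ B) (hcells : (k + 1) * ((n + 1) * 2 ^ k * (2 * M * k + 1)) ≤ B)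
    (hvalues : 2 ^ k * (D ^ k * D ^ k) ≤ B) :
    Runs coin B (solveProg c) (G.input k M) (solveSteps c n k M t) fun s' =>
      (∀ d, G.IsMinWeight k d → ∃ v < n,
        table k n M (instAdj G) (instWt G M)
          (flatScalars bitsVal (n + 1) (coinBits (k * (n + 1)) t coin)) k v (2 ^ k - 1)
          (d + ((k : ℤ) - 1) * M + 2 * M).toNat ≠ 0) →
      G.WeightAnswer k s' ∧ G.PathAnswer k s' := by
  obtain ⟨hnB, hkB, hWB, hNB, hMB⟩ := bounds_of_cells_le hk hcells
  have hP : 1 ≤ 2 ^ k := Nat.one_le_two_pow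
  have hknk : 1 ≤ (n + 1) * (k * n ^ k) := Nat.mul_pos (by omega) (Nat.mul_pos hk (by positivity))
  have htD : 2 ^ t ≤ D := hD ▸ Nat.le_mul_of_pos_right _ hknk
  have hD1 : 1 ≤ D := Nat.one_le_two_pow.trans htD
  have hDB : D ≤ B := by
    have h1 : D ≤ D ^ k := Nat.le_self_pow (by omega) D
    have h2 : D ^ k ≤ D ^ k * D ^ k := Nat.le_mul_of_pos_right _ (by positivity)
    have h3 : D ^ k * D ^ k ≤ 2 ^ k * (D ^ k * D ^ k) := Nat.le_mul_of_pos_left _ (by positivity)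
    omega
  have hPB : 2 ^ k ≤ B := (Nat.le_mul_of_pos_right _ (by positivity)).trans hvalues
  have htB : 2 ^ t ≤ B := htD.trans hDB
  have hXB : k * n ^ c ≤ B := by
    have : k * n ^ c < 2 ^ t := ht ▸ Nat.lt_size_self _
    omega
  have hs₀ : (G.input k M).Bdd B := input_bdd hw (by omega) (by omega) hMB (by omega)
  have i0 : (G.input k M).reg 0 = n := rfl
  have i1 : (G.input k M).reg 1 = k := rfl
  have i2 : (G.input k M).reg 2 = M := rfl
  have iarr : ∀ a, 2 ≤ a → ∀ m, (G.input k M).arr a m = 0 := fun a ha m => by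
    simp [WeightedDigraph.input, show a ≠ 0 by omega, show a ≠ 1 by omega]
  refine runs_seq (((runs_sizesProg hB hs₀ i1 i2 (by omega) hPB hWB).tossed rfl).mono le_rfl ?_)
  rintro s₁ hb₁ hag₁ ⟨ht₁, r3, r4⟩ - -
  have a0 := (hag₁.1 0 rfl).trans i0
  have a1 := (hag₁.1 1 rfl).trans i1
  refine runs_seq (((runs_bitsProg hB hb₁ a0 a1 hn hcB hXB
    (ht ▸ Nat.lt_two_pow_self.le.trans htB)).tossed rfl).mono (by rw [ht]) ?_)
  rintro s₂ hb₂ hag₂ ⟨ht₂, r6⟩ - -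
  rw [← ht] at r6
  refine runs_seq ((runs_tossProg hB hb₂ ((hag₂.1 0 rfl).trans a0) ((hag₂.1 1 rfl).trans a1) r6
    ?_ htB (ht₂.trans ht₁) fun m => ?_).mono le_rfl ?_)
  · have : k * (n + 1) ≤ (k + 1) * (n + 1) := Nat.mul_le_mul_right _ (by omega)
    omega
  · rw [hag₂.2 2 rfl, hag₁.2 2 rfl]
    exact iarr 2 le_rfl m
  intro s₃ hb₃ hag₃ hy _ _
  have hreg₃ : ∀ i < 5, i ≠ 3 → i ≠ 4 → s₃.reg i = (G.input k M).reg i := fun i hi h h' =>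
    (hag₃.1 i (by interval_cases i <;> rfl)).trans ((hag₂.1 i (by interval_cases i <;> rfl)).trans
      (hag₁.1 i (by interval_cases i <;> first | rfl | omega)))
  have harr₃ : ∀ a, a ≠ 2 → s₃.arr a = (G.input k M).arr a := fun a ha =>
    (hag₃.2 a (by simp [tossProg, forLoop, Cmd.writesArr, Ne.symm ha])).trans
      ((hag₂.2 a rfl).trans (hag₁.2 a rfl))
  refine runs_seq ((runs_sourceProg hB hb₃ (hreg₃ 0 (by omega) (by omega) (by omega))
    (hreg₃ 2 (by omega) (by omega) (by omega)) (by omega) hMB).mono le_rfl ?_)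
  rintro s₄ hb₄ hag₄ ⟨hsrc0, hsrc1⟩ - -
  have r0₄ : s₄.reg 0 = n := (hag₄.1 0 rfl).trans (hreg₃ 0 (by omega) (by omega) (by omega))
  have r1₄ : s₄.reg 1 = k := (hag₄.1 1 rfl).trans (hreg₃ 1 (by omega) (by omega) (by omega))
  have r2₄ : s₄.reg 2 = M := (hag₄.1 2 rfl).trans (hreg₃ 2 (by omega) (by omega) (by omega))
  have r3₄ : s₄.reg 3 = ((2 ^ k : ℕ) : ℤ) :=
    (hag₄.1 3 rfl).trans ((hag₃.1 3 rfl).trans ((hag₂.1 3 rfl).trans r3))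
  have r4₄ : s₄.reg 4 = ((2 * M * k + 1 : ℕ) : ℤ) :=
    (hag₄.1 4 rfl).trans ((hag₃.1 4 rfl).trans ((hag₂.1 4 rfl).trans r4))
  have harr₄ : ∀ a, 3 ≤ a → ∀ m, s₄.arr a m = 0 := fun a ha m => by
    rw [hag₄.2 a (by simp [sourceProg, forLoop, Cmd.writesArr]; omega), harr₃ a (by omega)]
    exact iarr a (by omega) m
  refine runs_seq (runs_write_of_eq (m := cellIdx k n M 0 n 0 (2 * M)) (z := 1) hB hb₄
    ⟨by decide, by simp [Expr.maxLit]; omega⟩ ⟨by decide, by simp [Expr.maxLit]; omega⟩ ?_ rfl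
    (by simp; omega) ?_)
  · simp only [Expr.eval, r0₄, r2₄, r3₄, r4₄, cellIdx]
    push_cast
    ring
  intro hb₅ _
  set s₅ := s₄.setArr 3 (cellIdx k n M 0 n 0 (2 * M)) 1 with hs₅
  have hreg₅ : s₅.reg = s₄.reg := rfl
  have harr₅ : ∀ a, a ≠ 3 → s₅.arr a = s₄.arr a := fun a ha => by
    funext x; simp [hs₅, ha]
  have h3₅ : ∀ m, s₅.arr 3 m = if m = cellIdx k n M 0 n 0 (2 * M) then 1 else 0 := fun m => by
    simp [hs₅, harr₄]
  clear_value s₅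
  have eadj : s₅.adj n = instAdj G := by
    funext u v
    rw [State.adj, harr₅ 0 (by decide), hsrc0, harr₃ 0 (by decide)]
    rfl
  have ewt : s₅.wt n = instWt G M := by
    funext u v
    rw [State.wt, harr₅ 1 (by decide), hsrc1, harr₃ 1 (by decide)]
    rfl
  have escalar : s₅.scalar n = flatScalars bitsVal (n + 1) (coinBits (k * (n + 1)) t coin) := by
    funext p v
    rw [State.scalar, harr₅ 2 (by decide), hag₄.2 2 rfl, hy, flatScalars]
    split_ifs with h
    · refine binVal_congr fun b hb => ?_
      rw [dif_pos hb]
      rfl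
    · rfl
  have hscalar : ∀ p v, |s₅.scalar n p v| ≤ ((2 ^ t : ℕ) : ℤ) := fun p v => by
    rw [escalar, flatScalars]
    split_ifs with h
    · have := binVal_nonneg_lt (fun b => if hb : b < t then
        coinBits (k * (n + 1)) t coin ⟨p * (n + 1) + v, h⟩ ⟨b, hb⟩ else false) t
      rw [bitsVal, abs_of_nonneg this.1]
      exact_mod_cast this.2.le
    · simp
  have hR₅ : Ready G k M B D s₅ :=
    ⟨hn, hk, hreg₅ ▸ r0₄, hreg₅ ▸ r1₄, hreg₅ ▸ r2₄, hreg₅ ▸ r3₄, hreg₅ ▸ r4₄,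
      by rw [eadj, ewt]; exact encodes_inst, hw,
      hD ▸ Nat.le_mul_of_pos_left _ (by positivity),
      fun c v S e => by
        rw [hD]
        exact abs_table_le (by rw [eadj, ewt]; exact encodes_inst) hscalar c v S e,
      hcells, hvalues, hB⟩
  refine runs_seq ((runs_tableProg hR₅ hb₅ h3₅).mono le_rfl ?_)
  intro s₆ hb₆ hag₆ h3₆ _ _
  have harr₆ : ∀ a < 3, s₆.arr a = s₅.arr a := fun a ha =>
    hag₆.2 a (by interval_cases a <;> rfl)
  have hR₆ : Ready G k M B D s₆ :=
    hR₅.congr (fun i hi => hag₆.1 i (by interval_cases i <;> rfl)) harr₆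
  have e0 : s₆.adj n = s₅.adj n := State.adj_congr (harr₆ 0 (by omega))
  have e1 : s₆.wt n = s₅.wt n := State.wt_congr (harr₆ 1 (by omega))
  have e2 : s₆.scalar n = s₅.scalar n := State.scalar_congr (harr₆ 2 (by omega))
  rw [← e0, ← e1, ← e2] at h3₆
  refine runs_seq ((runs_searchProg hR₆ hb₆ h3₆).mono le_rfl ?_)
  intro s₇ hb₇ hag₇ hse _ _
  have harr₇ : ∀ a, s₇.arr a = s₆.arr a := fun a => hag₇.2 a rfl
  have hR₇ : Ready G k M B D s₇ :=
    hR₆.congr (fun i hi => hag₇.1 i (by interval_cases i <;> rfl)) fun a _ => harr₇ a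
  have f0 : s₇.adj n = s₆.adj n := State.adj_congr (harr₇ 0)
  have f1 : s₇.wt n = s₆.wt n := State.wt_congr (harr₇ 1)
  have f2 : s₇.scalar n = s₆.scalar n := State.scalar_congr (harr₇ 2)
  have etab : s₆.tab k n M = table k n M (instAdj G) (instWt G M)
      (flatScalars bitsVal (n + 1) (coinBits (k * (n + 1)) t coin)) := by
    rw [State.tab, e0, e1, e2, eadj, ewt, escalar]
  have etab₇ : s₇.tab k n M = s₆.tab k n M := tab_congr fun a _ => harr₇ a
  rw [← etab]
  refine runs_seq (a := k * (2 ^ k * (k * 7 + 9) + (n + 1) * (2 ^ k * 3 + 10) + 10) + 4 + 1)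
    (runs_branch (Q := fun s₈ => s₈.Bdd B → Agree (.branch (.reg 22) traceProg .skip) s₇ s₈ →
      Runs coin B outputProg s₈ (k * 3 + 4) _) hB hb₇
    ⟨by decide, by simp [Expr.maxLit]⟩ (fun hev => ?_) fun hev => ?_)
  · obtain ⟨h22, -⟩ | ⟨h22, e, v, ⟨heW, -⟩, h23, h24, hne, hmin⟩ := hse
    · simp [Expr.eval, h22] at hev
    refine (runs_traceProg hR₇ hb₇ heW h23 h24 (by rw [etab₇]; exact hne) (fun m => ?_)
      (by rw [harr₇, f0, f1, f2]; exact h3₆)).mono le_rfl ?_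
    · rw [harr₇, hag₆.2 4 rfl, harr₅ 4 (by decide)]
      exact harr₄ 4 (by decide) m
    rintro s₈ hb₈ hag₈ ⟨h26, l, hl, hlw, harr₈⟩ _ _
    have r1₈ : s₈.reg 1 = k := (hag₈.1 1 rfl).trans hR₇.reg1
    have r22₈ : s₈.reg 22 = 1 := (hag₈.1 22 rfl).trans h22
    refine (runs_outputProg hB hb₈ r1₈ (by omega)).mono le_rfl ?_
    rintro s₉ - - ⟨o0, o1, oarr⟩ hhit
    refine answers_of_searched (X := fun e v => s₆.tab k n M k v (2 ^ k - 1) e) hw hk hhit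
      (.inr ⟨o0.trans r22₈, e, fun e' v' h => hmin e' v' h, o1.trans h26, l, hl, hlw,
        fun i h => ?_⟩)
    rw [oarr i (hl.1 ▸ h), harr₈ i h]
  · obtain ⟨h22, hz⟩ | ⟨h22, -⟩ := hse
    · refine (runs_skip hb₇ (Q := fun s'' => s'' = _) rfl).mono (by omega) ?_
      rintro _ - - rfl _ _
      refine (runs_outputProg hB hb₇ hR₇.reg1 (by omega)).mono le_rfl ?_
      rintro s₉ - - ⟨o0, -, -⟩ hhit
      exact answers_of_searched (X := fun e v => s₆.tab k n M k v (2 ^ k - 1) e) hw hk hhit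
        (.inl ⟨o0.trans h22, hz⟩)
    · simp [Expr.eval, h22] at hev

end Solve

end RAM

/-! ### The error probability -/

namespace RAM

open KPath MeasureTheory

/-- The tosses of finitely many fair coins are uniformly distributed. -/
theorem coinLaw_real_coinBits_le (N t : ℕ) (P : (Fin N → Fin t → Bool) → Prop) :
    coinLaw.real {coin | P (coinBits N t coin)} ≤
      (Nat.card {ω : Fin N → Fin t → Bool // P ω} : ℝ) / (2 : ℝ) ^ (N * t) := by
  classical
  have hprob : IsProbabilityMeasure coinLaw := by unfold coinLaw; infer_instance
  have hsingle : ∀ ω : Fin N → Fin t → Bool,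
      coinLaw.real {coin | coinBits N t coin = ω} ≤ ((2 : ℝ) ^ (N * t))⁻¹ := by
    intro ω
    have hsub : {coin | coinBits N t coin = ω} ⊆ Set.pi (Finset.range (N * t) : Set ℕ)
        (fun i => if h : i < N * t then
          {ω ⟨i / t, Nat.div_lt_of_lt_mul (by rwa [mul_comm] at h)⟩
            ⟨i % t, Nat.mod_lt _ (Nat.pos_of_ne_zero (by rintro rfl; simp at h))⟩}
          else Set.univ) := by
      rintro coin rfl i hi
      rw [Finset.coe_range, Set.mem_Iio] at hi
      simp only [dif_pos hi, Set.mem_singleton_iff, coinBits]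
      congr 1
      rw [mul_comm]
      exact (Nat.div_add_mod i t).symm
    refine (measureReal_mono hsub (measure_ne_top _ _)).trans (le_of_eq ?_)
    rw [measureReal_def, coinLaw, Measure.infinitePi_pi]
    · rw [Finset.prod_congr rfl (g := fun _ => (2 : ENNReal)⁻¹)]
      · simp
      · intro i hi
        rw [dif_pos (Finset.mem_range.1 hi), PMF.toMeasure_apply_singleton _ _ (by simp)]
        simp
    · intro i _
      exact MeasurableSet.of_discrete
  have hunion : {coin | P (coinBits N t coin)} ⊆
      ⋃ ω ∈ Finset.univ.filter P, {coin | coinBits N t coin = ω} := by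
    intro coin h
    simpa using h
  refine (measureReal_mono hunion (measure_ne_top _ _)).trans
    ((measureReal_biUnion_finset_le _ _).trans ?_)
  refine (Finset.sum_le_sum fun ω _ => hsingle ω).trans (le_of_eq ?_)
  rw [Finset.sum_const, nsmul_eq_mul, Nat.card_eq_fintype_card, Fintype.card_subtype,
    div_eq_mul_inv]

section Solve

variable {n : ℕ} {G : WeightedDigraph n} {k M c : ℕ}

/-- All entries of the degree of a minimum path vanish with probability at most `n ^ (-c)`. -/
theorem coinLaw_real_miss_le (hw : G.WeightsIn M) (hn : 1 ≤ n) (hk : 1 ≤ k) {t : ℕ}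
    (ht : k * n ^ c ≤ 2 ^ t) :
    coinLaw.real {coin | ¬ ∀ d, G.IsMinWeight k d → ∃ v < n,
        table k n M (instAdj G) (instWt G M)
          (flatScalars bitsVal (n + 1) (coinBits (k * (n + 1)) t coin)) k v (2 ^ k - 1)
          (d + ((k : ℤ) - 1) * M + 2 * M).toNat ≠ 0} ≤ 1 / (n : ℝ) ^ c := by
  by_cases hex : ∃ d, G.IsMinWeight k d
  swap
  · have : {coin | ¬ ∀ d, G.IsMinWeight k d → ∃ v < n,
        table k n M (instAdj G) (instWt G M)
          (flatScalars bitsVal (n + 1) (coinBits (k * (n + 1)) t coin)) k v (2 ^ k - 1)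
          (d + ((k : ℤ) - 1) * M + 2 * M).toNat ≠ 0} = ∅ := by
      refine Set.eq_empty_of_forall_notMem fun coin h => h fun d hd => absurd ⟨d, hd⟩ hex
    rw [this, measureReal_empty]
    positivity
  obtain ⟨d, hd⟩ := hex
  obtain ⟨l, hl, hld⟩ := hd.1
  set x₀ : Fin n := ⟨0, hn⟩
  let P : (Fin (k * (n + 1)) → Fin t → Bool) → Prop := fun ω =>
    table k n M (instAdj G) (instWt G M) (flatScalars bitsVal (n + 1) ω) k (l.getD (k - 1) x₀)
      (2 ^ k - 1) (2 * M + stepDegree G M (fun p => l.getD p x₀) (k - 1)) = 0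
  have hdeg : (d + ((k : ℤ) - 1) * M + 2 * M).toNat =
      2 * M + stepDegree G M (fun p => l.getD p x₀) (k - 1) := by
    have := stepDegree_getD hw x₀ hl.2.2 (by rw [hl.1]; exact hk)
    rw [hl.1, hld] at this
    omega
  have hsub : {coin | ¬ ∀ d, G.IsMinWeight k d → ∃ v < n,
        table k n M (instAdj G) (instWt G M)
          (flatScalars bitsVal (n + 1) (coinBits (k * (n + 1)) t coin)) k v (2 ^ k - 1)
          (d + ((k : ℤ) - 1) * M + 2 * M).toNat ≠ 0} ⊆
      {coin | P (coinBits (k * (n + 1)) t coin)} := by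
    intro coin h
    by_contra hP
    refine h fun d' hd' => ⟨l.getD (k - 1) x₀, Fin.is_lt _, ?_⟩
    rw [hd'.unique hd, hdeg]
    exact hP
  have hprob : IsProbabilityMeasure coinLaw := by unfold coinLaw; infer_instance
  refine (measureReal_mono hsub (measure_ne_top _ _)).trans
    ((coinLaw_real_coinBits_le _ _ P).trans ?_)
  have hcard := card_table_eq_zero_le (κ := Fin t → Bool) (val := bitsVal) (M := M)
    (encodes_inst (G := G)) hw hk bitsVal_injective hl x₀
  have h1 : Nat.card (Fin t → Bool) = 2 ^ t := by simp
  have h2 : Nat.card (Fin (k * (n + 1)) → Fin t → Bool) = 2 ^ (k * (n + 1) * t) := by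
    simp [← pow_mul, mul_comm]
  rw [h1, h2] at hcard
  have hcard' : (Nat.card {ω // P ω} : ℝ) * 2 ^ t ≤ k * 2 ^ (k * (n + 1) * t) := by
    exact_mod_cast hcard
  have ht' : (k : ℝ) * n ^ c ≤ 2 ^ t := by exact_mod_cast ht
  have hn' : (0 : ℝ) < (n : ℝ) ^ c := by
    have : (0 : ℝ) < n := by exact_mod_cast hn
    positivity
  have hk' : (0 : ℝ) < k := by exact_mod_cast hk
  rw [div_le_div_iff₀ (by positivity) hn', one_mul]
  have hX : (0 : ℝ) ≤ Nat.card {ω // P ω} := by positivity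
  have h3 := (mul_le_mul_of_nonneg_left ht' hX).trans hcard'
  refine le_of_mul_le_mul_left ?_ hk'
  calc (k : ℝ) * (Nat.card {ω // P ω} * n ^ c) = Nat.card {ω // P ω} * (k * n ^ c) := by ring
    _ ≤ _ := h3

end Solve

end RAM

/-! ### The exponent of matrix multiplication is at least two -/

section Exponent

variable {K : Type*} [Field K]

/-- The rank of the matrix multiplication tensor is at least `n ^ 2`, because the matrices `γ t`
of a bilinear algorithm span the space of all matrices. -/
theorem HasBilinearMatMul.sq_le {n r : ℕ} (h : HasBilinearMatMul K n r) : n ^ 2 ≤ r := by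
  obtain ⟨α, β, γ, h⟩ := h
  have hspan : Submodule.span K (Set.range γ) = ⊤ := by
    rw [eq_top_iff]
    intro A _
    rw [← mul_one A, h A 1]
    exact Submodule.sum_mem _ fun t _ =>
      Submodule.smul_mem _ _ (Submodule.subset_span (Set.mem_range_self t))
  have h1 := finrank_range_le_card (R := K) γ
  rw [Set.finrank, hspan, finrank_top, Module.finrank_matrix] at h1
  simpa [sq] using h1

theorem hasBilinearMatMul_cube (n : ℕ) : HasBilinearMatMul K n (n ^ 3) := by
  let e : Fin (n ^ 3) ≃ Fin n × Fin n × Fin n :=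
    Fintype.equivOfCardEq (by simp; ring)
  refine ⟨fun t => Matrix.entryLinearMap K K (e t).1 (e t).2.1,
    fun t => Matrix.entryLinearMap K K (e t).2.1 (e t).2.2,
    fun t => Matrix.single (e t).1 (e t).2.2 1, fun A B => ?_⟩
  rw [Equiv.sum_comp e fun x : Fin n × Fin n × Fin n =>
    (Matrix.entryLinearMap K K x.1 x.2.1 A * Matrix.entryLinearMap K K x.2.1 x.2.2 B) •
      Matrix.single x.1 x.2.2 (1 : K)]
  ext i j
  rw [Matrix.mul_apply, Matrix.sum_apply, Fintype.sum_prod_type]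
  simp_rw [Fintype.sum_prod_type]
  symm
  rw [Finset.sum_eq_single i]
  · refine Finset.sum_congr rfl fun l _ => ?_
    rw [Finset.sum_eq_single j] <;> simp +contextual
  · intro i' _ hi'
    refine Finset.sum_eq_zero fun l _ => Finset.sum_eq_zero fun j' _ => ?_
    simp [hi']
  · simp

theorem two_le_matMulExponent : 2 ≤ matMulExponent K := by
  refine le_csInf ⟨3, 1, fun n _ => ⟨n ^ 3, ?_, hasBilinearMatMul_cube n⟩⟩ ?_
  · rw [one_mul]
    norm_cast
  · rintro τ ⟨C, hC⟩
    by_contra hτ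
    rw [not_le] at hτ
    -- otherwise `n ^ (2 - τ)` would be bounded
    have h1 : ∀ n : ℕ, 1 ≤ n → (n : ℝ) ^ (2 - τ) ≤ C := by
      intro n hn
      obtain ⟨r, hr, hmul⟩ := hC n hn
      have hn' : (0 : ℝ) < n := by exact_mod_cast hn
      have h2 : ((n : ℝ) ^ (2 : ℝ)) ≤ C * (n : ℝ) ^ τ := by
        refine le_trans ?_ hr
        rw [Real.rpow_two]
        exact_mod_cast hmul.sq_le
      rw [Real.rpow_sub hn', div_le_iff₀ (Real.rpow_pos_of_pos hn' _)]
      exact h2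
    have h2 : Filter.Tendsto (fun n : ℕ => (n : ℝ) ^ (2 - τ)) Filter.atTop Filter.atTop :=
      (tendsto_rpow_atTop (by linarith)).comp tendsto_natCast_atTop_atTop
    obtain ⟨n, hn, hn1⟩ := ((h2.eventually_gt_atTop C).and (Filter.eventually_ge_atTop 1)).exists
    exact absurd (h1 n hn1) (not_le.2 hn)

end Exponent

/-! ### The running time -/

namespace RAM

theorem size_mul_le (a b : ℕ) : Nat.size (a * b) ≤ Nat.size a + Nat.size b := by
  rw [Nat.size_le, pow_add]
  exact Nat.mul_lt_mul'' (Nat.lt_size_self a) (Nat.lt_size_self b)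

theorem size_le_self (a : ℕ) : Nat.size a ≤ a := Nat.size_le.2 Nat.lt_two_pow_self

theorem size_natCast_le_log {N : ℕ} (hN : 3 ≤ N) : (Nat.size N : ℝ) ≤ 3 * Real.log N := by
  obtain ⟨m, hm⟩ : ∃ m, Nat.size N = m + 1 :=
    ⟨Nat.size N - 1, by have := Nat.size_pos.2 (show 0 < N by omega); omega⟩
  have h1 : 2 ^ m ≤ N := Nat.lt_size.1 (by omega)
  have hN' : (3 : ℝ) ≤ N := by exact_mod_cast hN
  have h2 : (m : ℝ) * Real.log 2 ≤ Real.log N := by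
    rw [← Real.log_pow]
    exact Real.log_le_log (by positivity) (by exact_mod_cast h1)
  have h3 : 1 ≤ Real.log N := by
    rw [Real.le_log_iff_exp_le (by linarith)]
    linarith [Real.exp_one_lt_d9]
  have h4 := Real.log_two_gt_d9
  have hm0 : (0 : ℝ) ≤ m := by positivity
  rw [hm]
  push_cast
  nlinarith

/-- A bound for all numbers that occur in a run on random numbers of `t` bits. -/
def valueBound (c n k M t : ℕ) : ℕ :=
  (c + 2) * ((k + 1) * ((n + 1) * 2 ^ k * (2 * M * k + 1))) *
    (2 ^ k * ((2 ^ t * ((n + 1) * (k * n ^ k))) ^ k * (2 ^ t * ((n + 1) * (k * n ^ k))) ^ k))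

section Bounds

variable {c n k M t S : ℕ}

theorem size_length_le (hn : 1 ≤ n) (hk : 1 ≤ k) (hS : Nat.size (n + 1) ≤ S) :
    Nat.size (k * n ^ c) ≤ (c + 2) * (k * S) := by
  have hS1 : 1 ≤ S := (Nat.size_pos.2 (by omega)).trans_le hS
  have h1 : k ≤ k * S := Nat.le_mul_of_pos_right _ hS1
  have hnS : Nat.size n ≤ S := (Nat.size_le_size (by omega)).trans hS
  have h2 : Nat.size (n ^ c) ≤ c * S + 1 := by
    rcases Nat.eq_zero_or_pos c with rfl | hc
    · simp
    · have := size_pow_le n c hc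
      have := Nat.mul_le_mul_left c hnS
      omega
  have h3 : c * S ≤ c * (k * S) := Nat.mul_le_mul_left _ (Nat.le_mul_of_pos_left _ hk)
  have h4 := size_mul_le k (n ^ c)
  have h5 := size_le_self k
  rw [add_mul]
  omega

theorem size_valueBound_le (hn : 1 ≤ n) (hk : 1 ≤ k) (hS : Nat.size (n + 1) ≤ S)
    (hSM : Nat.size M ≤ S) (ht : t ≤ (c + 2) * (k * S)) :
    Nat.size (valueBound c n k M t) + 1 ≤ (3 * c + 33) * (k ^ 2 * S) := by
  have hS1 : 1 ≤ S := (Nat.size_pos.2 (by omega)).trans_le hS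
  have hnS : Nat.size n ≤ S := (Nat.size_le_size (by omega)).trans hS
  have hkS : k ≤ k * S := Nat.le_mul_of_pos_right _ hS1
  have hSk : S ≤ k * S := Nat.le_mul_of_pos_left _ hk
  have hD : Nat.size (2 ^ t * ((n + 1) * (k * n ^ k))) ≤ (c + 7) * (k * S) := by
    have h1 := size_mul_le (2 ^ t) ((n + 1) * (k * n ^ k))
    have h2 := size_mul_le (n + 1) (k * n ^ k)
    have h3 := size_mul_le k (n ^ k)
    have h4 := (size_pow_le n k hk).trans (Nat.mul_le_mul_left k hnS)
    have h5 := size_le_self k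
    have h6 : Nat.size (2 ^ t) = t + 1 := Nat.size_pow
    have h7 : (c + 7) * (k * S) = (c + 2) * (k * S) + 5 * (k * S) := by ring
    omega
  have hDk := (size_pow_le (2 ^ t * ((n + 1) * (k * n ^ k))) k hk).trans
    (Nat.mul_le_mul_left k hD)
  set D := 2 ^ t * ((n + 1) * (k * n ^ k)) with hDdef
  have hX : k * ((c + 7) * (k * S)) = (c + 7) * (k ^ 2 * S) := by ring
  rw [hX] at hDk
  have h1 := size_mul_le ((c + 2) * ((k + 1) * ((n + 1) * 2 ^ k * (2 * M * k + 1))))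
    (2 ^ k * (D ^ k * D ^ k))
  have h2 := size_mul_le (c + 2) ((k + 1) * ((n + 1) * 2 ^ k * (2 * M * k + 1)))
  have h3 := size_mul_le (k + 1) ((n + 1) * 2 ^ k * (2 * M * k + 1))
  have h4 := size_mul_le ((n + 1) * 2 ^ k) (2 * M * k + 1)
  have h5 := size_mul_le (n + 1) (2 ^ k)
  have h6 : Nat.size (2 * M * k + 1) ≤ S + k + 2 := by
    refine Nat.size_le.2 ?_
    have e1 : M + 1 ≤ 2 ^ S := Nat.size_le.1 hSM
    have e2 : k + 1 ≤ 2 ^ k := Nat.lt_two_pow_self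
    have e3 := Nat.mul_le_mul e1 e2
    rw [pow_add, pow_add]
    nlinarith
  have h7 := size_mul_le (2 ^ k) (D ^ k * D ^ k)
  have h8 := size_mul_le (D ^ k) (D ^ k)
  have h9 : Nat.size (2 ^ k) = k + 1 := Nat.size_pow
  have h10 := size_le_self (c + 2)
  have h11 := size_le_self (k + 1)
  have hk2 : k ≤ k ^ 2 := Nat.le_self_pow (by omega) k
  have hY : k * S ≤ k ^ 2 * S := Nat.mul_le_mul_right _ hk2
  have hcY : c ≤ c * (k ^ 2 * S) := Nat.le_mul_of_pos_right _ (by positivity)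
  have h12 : (3 * c + 33) * (k ^ 2 * S) = c * (k ^ 2 * S) + 2 * ((c + 7) * (k ^ 2 * S)) +
    19 * (k ^ 2 * S) := by ring
  rw [valueBound, ← hDdef, h12]
  omega

theorem solveSteps_le (hn : 1 ≤ n) (hk : 1 ≤ k) (hM : 1 ≤ M) (hS : 1 ≤ S)
    (ht : t ≤ (c + 2) * (k * S)) :
    solveSteps c n k M t ≤ (18 * c + 500) * (2 ^ k * k ^ 3 * M * n ^ 2 * S) := by
  have hP : 1 ≤ 2 ^ k := Nat.one_le_two_pow
  rw [solveSteps]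
  generalize 2 ^ k = P at *
  set X := P * k ^ 3 * M * n ^ 2 * S with hX
  have hXpos : 0 < X := by positivity
  have m1 : k ≤ X := Nat.le_of_dvd hXpos (Dvd.intro (P * k ^ 2 * M * n ^ 2 * S) (by rw [hX]; ring))
  have m2 : k * S ≤ X := Nat.le_of_dvd hXpos (Dvd.intro (P * k ^ 2 * M * n ^ 2) (by rw [hX]; ring))
  have m3 : k ^ 2 * n * S ≤ X := Nat.le_of_dvd hXpos (Dvd.intro (P * k * M * n) (by rw [hX]; ring))
  have m4 : n ≤ X := Nat.le_of_dvd hXpos (Dvd.intro (P * k ^ 3 * M * n * S) (by rw [hX]; ring))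
  have m5 : P * k ^ 3 * M * n ^ 2 ≤ X := Nat.le_of_dvd hXpos (Dvd.intro S hX.symm)
  have m6 : M * k * n ≤ X := Nat.le_of_dvd hXpos (Dvd.intro (P * k ^ 2 * n * S) (by rw [hX]; ring))
  have m7 : P * k ^ 2 * n ≤ X := Nat.le_of_dvd hXpos (Dvd.intro (k * M * n * S) (by rw [hX]; ring))
  have hn2 : n + 1 ≤ 2 * n := by omega
  have hMk : 2 * M * k + 1 ≤ 3 * (M * k) := by
    have : 1 ≤ M * k := Nat.mul_pos hM hk
    linarith
  have hkS : 1 ≤ k * S := Nat.mul_pos hk hS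
  have t1 : k * (n + 1) * (3 * t * 2 + 6) ≤ (12 * c + 36) * X := by
    calc k * (n + 1) * (3 * t * 2 + 6)
        ≤ k * (2 * n) * (3 * ((c + 2) * (k * S)) * 2 + 6 * (k * S)) := by gcongr; omega
      _ = (12 * c + 36) * (k ^ 2 * n * S) := by ring
      _ ≤ _ := by gcongr
  have t2 : k * ((n + 1) * P * (2 * M * k + 1)) * ((n + 1) * (k * 7 + 7) + 14) ≤ 252 * X := by
    have h : (n + 1) * (k * 7 + 7) + 14 ≤ 42 * (n * k) := by nlinarith [Nat.mul_le_mul hn hk]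
    calc _ ≤ k * (2 * n * P * (3 * (M * k))) * (42 * (n * k)) := by gcongr
      _ = 252 * (P * k ^ 3 * M * n ^ 2) := by ring
      _ ≤ _ := by gcongr
  have t3 : (2 * M * k + 1) * (n * 7 + 4) ≤ 33 * X := by
    calc _ ≤ 3 * (M * k) * (11 * n) := by gcongr; omega
      _ = 33 * (M * k * n) := by ring
      _ ≤ _ := by gcongr
  have t4 : k * (P * (k * 7 + 9) + (n + 1) * (P * 3 + 10) + 10) ≤ 52 * X := by
    calc _ ≤ k * (P * (16 * k) + 2 * n * (13 * P) + 10) := by gcongr <;> omega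
      _ = 16 * (k * k * P * 1) + 26 * (k * 1 * P * n) + 10 * (k * 1 * 1 * 1) := by ring
      _ ≤ 16 * (k * k * P * n) + 26 * (k * k * P * n) + 10 * (k * k * P * n) := by gcongr
      _ = 52 * (P * k ^ 2 * n) := by ring
      _ ≤ _ := by gcongr
  have t5 : 3 * c ≤ 3 * c * X := Nat.le_mul_of_pos_right _ hXpos
  have t6 : 3 * t ≤ (3 * c + 6) * X := by
    calc 3 * t ≤ 3 * ((c + 2) * (k * S)) := by gcongr
      _ = (3 * c + 6) * (k * S) := by ring
      _ ≤ _ := by gcongr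
  have t7 : (18 * c + 500) * X = 3 * c * X + (3 * c + 6) * X + (12 * c + 36) * X + 458 * X := by
    ring
  rw [t7]
  omega

end Bounds

end RAM

/-! ### The algorithm for both problems -/

section Algorithm

variable {n : ℕ} {G : WeightedDigraph n} {k M c t : ℕ}

theorem RAM.steps_mul_unitCost_le (hn : 1 ≤ n) (hk : 1 ≤ k) (hM : 1 ≤ M)
    (ht : t = Nat.size (k * n ^ c)) :
    ((solveSteps c n k M t * unitCost (valueBound c n k M t) : ℕ) : ℝ) ≤
      ((18 * c + 500) * (3 * c + 33) * 90000 : ℕ) * 2 ^ k * (k : ℝ) ^ 5 * M * (n : ℝ) ^ 2 *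
        Real.log (n + M + 1) ^ 2 := by
  set S := Nat.size (n + M + 1) with hS
  have h1 : Nat.size (n + 1) ≤ S := Nat.size_le_size (by omega)
  have h2 : Nat.size M ≤ S := Nat.size_le_size (by omega)
  have hS1 : 1 ≤ S := Nat.size_pos.2 (by omega)
  have htS : t ≤ (c + 2) * (k * S) := ht ▸ size_length_le hn hk h1
  have h3 := solveSteps_le hn hk hM hS1 htS
  have h4 := size_valueBound_le hn hk h1 h2 htS
  have h5 : solveSteps c n k M t * unitCost (valueBound c n k M t) ≤
      (18 * c + 500) * (3 * c + 33) * 10000 * 2 ^ k * k ^ 5 * M * n ^ 2 * S ^ 2 := by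
    calc _ ≤ (18 * c + 500) * (2 ^ k * k ^ 3 * M * n ^ 2 * S) *
          (10000 * ((3 * c + 33) * (k ^ 2 * S))) := Nat.mul_le_mul h3 (Nat.mul_le_mul_left _ h4)
      _ = _ := by ring
  have h6 : (S : ℝ) ≤ 3 * Real.log (n + M + 1) := by
    have := size_natCast_le_log (N := n + M + 1) (by omega)
    exact_mod_cast this
  calc _ ≤ (((18 * c + 500) * (3 * c + 33) * 10000 * 2 ^ k * k ^ 5 * M * n ^ 2 * S ^ 2 : ℕ) :
          ℝ) := by exact_mod_cast h5
    _ = (18 * c + 500) * (3 * c + 33) * 10000 * 2 ^ k * (k : ℝ) ^ 5 * M * (n : ℝ) ^ 2 *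
        (S : ℝ) ^ 2 := by push_cast; ring
    _ ≤ (18 * c + 500) * (3 * c + 33) * 10000 * 2 ^ k * (k : ℝ) ^ 5 * M * (n : ℝ) ^ 2 *
        (3 * Real.log (n + M + 1)) ^ 2 := by gcongr
    _ = _ := by push_cast; ring

open RAM in
/-- The same program serves both problems, because its final memory holds the minimum weight in
register `1` and a path in array `0`. -/
theorem RAM.solves_solveProg (hw : G.WeightsIn M) (hn : 1 ≤ n) (hk : 1 ≤ k) (hM : 1 ≤ M) {T : ℝ}
    (hT : ((18 * c + 500) * (3 * c + 33) * 90000 : ℕ) * 2 ^ k * (k : ℝ) ^ 5 * M * (n : ℝ) ^ 2 *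
        Real.log (n + M + 1) ^ 2 ≤ T) {Good : State → Prop}
    (hGood : ∀ s, G.WeightAnswer k s ∧ G.PathAnswer k s → Good s) :
    Solves (solveProg c) (G.input k M) T (1 / (n : ℝ) ^ c) Good := by
  obtain ⟨t, ht⟩ : ∃ t, t = Nat.size (k * n ^ c) := ⟨_, rfl⟩
  set D := 2 ^ t * ((n + 1) * (k * n ^ k)) with hD
  set L := (k + 1) * ((n + 1) * 2 ^ k * (2 * M * k + 1)) with hL
  have hB : valueBound c n k M t = (c + 2) * L * (2 ^ k * (D ^ k * D ^ k)) := rfl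
  have hL1 : 1 ≤ L := Nat.succ_le_of_lt (by positivity)
  have hn0 : 0 < n := hn
  have hk0 : 0 < k := hk
  have hV1 : 1 ≤ 2 ^ k * (D ^ k * D ^ k) := Nat.succ_le_of_lt (by positivity)
  have hcL : (c + 2) * L ≤ valueBound c n k M t := hB ▸ Nat.le_mul_of_pos_right _ hV1
  have hc2 : c + 2 ≤ valueBound c n k M t := (Nat.le_mul_of_pos_right _ hL1).trans hcL
  have hLB : L ≤ valueBound c n k M t := (Nat.le_mul_of_pos_left _ (by omega)).trans hcL
  have hVB : 2 ^ k * (D ^ k * D ^ k) ≤ valueBound c n k M t :=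
    hB ▸ Nat.le_mul_of_pos_left _ (Nat.mul_pos (by omega) hL1)
  have hruns := fun coin => runs_solveProg (coin := coin) (c := c) hw hn hk ht hD (by omega)
    (by omega) hLB hVB
  constructor
  · intro coin
    obtain ⟨s', t', he, ht', -, -⟩ := hruns coin
    refine ⟨s', t', he, le_trans ?_ ((steps_mul_unitCost_le hn hk hM ht).trans hT)⟩
    exact_mod_cast ht'
  · have hprob : MeasureTheory.IsProbabilityMeasure coinLaw := by unfold coinLaw; infer_instance
    refine (MeasureTheory.measureReal_mono ?_ (MeasureTheory.measure_ne_top _ _)).trans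
      (coinLaw_real_miss_le (t := t) hw hn hk (ht ▸ (Nat.lt_size_self _).le))
    rintro coin ⟨s', t', he, hbad⟩ hhit
    obtain ⟨s'', t'', he', -, -, hans⟩ := hruns coin
    obtain rfl := he.state_unique he'
    exact hbad (hGood _ (hans hhit))

end Algorithm

theorem mainTheorem1 (K : Type*) [Field K] :
    (∀ c : ℕ, ∃ (weightProg pathProg : RAM.Cmd) (C C' : ℝ) (a b b' : ℕ),
      ∀ n k M : ℕ, 1 ≤ n → 1 ≤ k → 1 ≤ M →
        ∀ G : WeightedDigraph n, G.WeightsIn M →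
          ∀ T : ℝ,
            T = C * 2 ^ k * (k : ℝ) ^ a * M * (n : ℝ) ^ matMulExponent K *
              Real.log (n + M + 1) ^ b →
            RAM.Solves weightProg (G.input k M) T (1 / (n : ℝ) ^ c) (G.WeightAnswer k) ∧
            RAM.Solves pathProg (G.input k M) (C' * k * (1 + Real.log n) ^ b' * T)
              (1 / (n : ℝ) ^ c) (G.PathAnswer k)) ∧
    (∀ n k M : ℕ, 1 ≤ n → 1 ≤ k → 1 ≤ M →
      ∀ G : WeightedDigraph n, G.WeightsIn M →
        ((¬ ∃ l, G.IsKPath k l) → ∀ c : WalkChoice n k, G.walkPoly M c = 0) ∧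
        ∀ d : ℤ, G.IsMinWeight k d →
          (∀ (c : WalkChoice n k) (m : ℕ), (G.walkPoly M c).coeff m ≠ 0 →
            d + (k - 1) * M ≤ m) ∧
          (1 / 5 : ℝ) * Nat.card (WalkChoice n k) ≤
            Nat.card {c : WalkChoice n k //
              ∃ m : ℕ, IsLeast {e : ℕ | (G.walkPoly M c).coeff e ≠ 0} m ∧
                (m : ℤ) = d + (k - 1) * M}) := by
  refine ⟨fun c => ?_, fun n k M hn hk hM G hw => ⟨fun hno ch => ?_, fun d hd => ⟨?_, ?_⟩⟩⟩
  · refine ⟨RAM.solveProg c, RAM.solveProg c, ((18 * c + 500) * (3 * c + 33) * 90000 : ℕ), 1, 5, 2,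
      0, fun n k M hn hk hM G hw T hT => ?_⟩
    have hn' : (1 : ℝ) ≤ n := by exact_mod_cast hn
    have hlog : 0 ≤ Real.log (n + M + 1) :=
      Real.log_nonneg (by linarith [Nat.cast_nonneg (α := ℝ) M])
    -- the exponent of matrix multiplication enters only through `2 ≤ ω`
    have hpow : (n : ℝ) ^ 2 ≤ (n : ℝ) ^ matMulExponent K := by
      rw [← Real.rpow_two]
      exact Real.rpow_le_rpow_of_exponent_le hn' two_le_matMulExponent
    have hle : ((18 * c + 500) * (3 * c + 33) * 90000 : ℕ) * 2 ^ k * (k : ℝ) ^ 5 * M *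
        (n : ℝ) ^ 2 * Real.log (n + M + 1) ^ 2 ≤ T := by
      rw [hT]
      gcongr
    have hT0 : 0 ≤ T := le_trans (by positivity) hle
    refine ⟨RAM.solves_solveProg hw hn hk hM hle fun s h => h.1,
      RAM.solves_solveProg hw hn hk hM (hle.trans ?_) fun s h => h.2⟩
    rw [pow_zero, mul_one, one_mul]
    exact le_mul_of_one_le_left hT0 (by exact_mod_cast hk)
  · ext m : 1
    by_contra hne
    obtain ⟨l, hl, -⟩ := KPath.exists_isKPath_of_coeff_walkPoly_ne_zero hk hw ch hne
    exact hno ⟨l, hl⟩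
  · intro ch m hne
    obtain ⟨l, hl, hlm⟩ := KPath.exists_isKPath_of_coeff_walkPoly_ne_zero hk hw ch hne
    rw [← hlm]
    have := hd.2 ⟨l, hl, rfl⟩
    linarith
  · exact KPath.fifth_le_card_walkChoice hk hw hd
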